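/- **Setting.** Let $P\subset\mathbb Z^2$ be either the square $\{0,1\}^2$ (square plaquette model) or the triangle $\{0,\vec e_2,\vec e_1+\vec e_2\}$ (triangular plaquette model); the plaquettes are the translates $B=P+z$, $z\in\mathbb Z^2$. Let $\Omega=\{-1,1\}^{\mathbb Z^2}$ and $[\sigma]_B=\prod_{x\in B}\sigma_x$. For a finite $\Lambda\subset\mathbb Z^2$, $\tau\in\Omega$ and $\beta>0$ let $\mu_\Lambda^{\beta,\tau}$ be the probability measure on the configurations $\sigma$ which agree with $\tau$ outside $\Lambda$, with weights proportional to $\exp\bigl(\frac\beta2\sum_{B\cap\Lambda\ne\emptyset}[\sigma]_B\bigr)$, and let $\mathrm{Cov}_\Lambda^{\beta,\tau}$ be its covariance. Write $\|H\|=|P|/2$, $d$ for the $\ell^1$-distance, $Q_\ell=\{1,\dots,\ell\}^2$, $\sigma^x$ for $\sigma$ with the spin at $x$ flipped, and $S_f$ for the support of $f$ (the smallest set of sites on whose spins $f$ depends); $f$ is local if $S_f$ is finite. Set $$h_x(\sigma)=\exp\Bigl(\tfrac\beta2\sum_{B\ni x}([\sigma^x]_B-[\sigma]_B)\Bigr),\qquad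 \varphi(\ell)=\sup_{\substack{x,y\notin Q_\ell\\ d(x,y)\ge \ell/4}}\ \sup_{\tau\in\Omega}\bigl|\mathrm{Cov}_{Q_\ell}^{\beta,\tau}(h_x,h_y)\bigr| .$$ For $\varepsilon>0$ the *strong mixing scale* $\ell_c^{(\mathrm{mix})}=\ell_c^{(\mathrm{mix})}(\varepsilon,\beta)$ is the smallest integer $\ell\ge1$ with $e^{4\beta\|H\|}\,\ell\,\varphi(\ell)\le\varepsilon$. A finite set is $\ell$-regular if it is a disjoint union of squares $Q_\ell+\ell x$, $x\in\mathbb Z^2$. The property $SM(\ell,C,m)$ says that for all $\ell$-regular $\Lambda$, all $\tau\in\Omega$ and all functions $f,g$ of the spins in $\Lambda$, $$|\mathrm{Cov}_\Lambda^{\beta,\tau}(f,g)|\le C\,\|f\|_\infty\|g\|_\infty|S_f||S_g|\,e^{-m\,d(S_f,S_g)} .$$ **Theorem.** For each of the two models: 1. For every $\varepsilon>0$, $\ell_c^{(\mathrm{mix})}(\varepsilon,\beta)$ is finite for every $\beta>0$, and $\ell_c^{(\mathrm{mix})}(\varepsilon,\beta)=O(\beta e^\beta)$ as $\beta\to\infty$.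 2. Strong mixing on regular volumes holds at every positive temperature: there are a constant $c_0>0$ and positive integers $L(\beta)$, $\beta>0$, with $L(\beta)=O(\beta e^\beta)$ as $\beta\to\infty$, such that $SM\bigl(L(\beta),e^{c_0(\beta+1)},1/L(\beta)\bigr)$ holds for every $\beta>0$. 3. For every $\beta>0$ there is exactly one infinite-volume Gibbs measure $\mu^\beta$, that is, exactly one probability measure on $\Omega$ which satisfies the DLR equations $\mu(A)=\int\mu_\Lambda^{\beta,\tau}(A)\,d\mu(\tau)$ for all finite $\Lambda$ and all measurable $A$. For every $\tau\in\Omega$ and every local $f$, $\mu_\Lambda^{\beta,\tau}(f)\to\mu^\beta(f)$ as $\Lambda\uparrow\mathbb Z^2$. The measure $\mu^\beta$ has exponentially decaying correlations: there are $C,m>0$ (depending on $\beta$) with $$|\mu^\beta(fg)-\mu^\beta(f)\mu^\beta(g)|\le C\,\|f\|_\infty\|g\|_\infty|S_f||S_g|\,e^{-m\,d(S_f,S_g)}$$ for all local $f,g$. Its magnetisation vanishes: $\mu^\beta(\sigma_x)=0$ for every $x\in\mathbb Z^2$. -/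

import Mathlib

open MeasureTheory Filter Topology Asymptotics
open scoped ENNReal

noncomputable section

namespace PlaquetteModel

/-- Sites of the lattice `ℤ²`. -/
abbrev Site : Type := ℤ × ℤ

/-- Spin configurations `σ ∈ {-1, 1}^{ℤ²}` (`ℤˣ = {1, -1}`), with the product σ-algebra. -/
abbrev Config : Type := Site → ℤˣ

/-- The σ-algebra on the two-point spin space is the discrete one. -/
theorem measurableSet_spin (s : Set ℤˣ) : MeasurableSet s :=
  ⟨Units.val '' s, MeasurableSet.of_discrete, Set.preimage_image_eq s Units.val_injective⟩

instance : DiscreteMeasurableSpace ℤˣ := ⟨measurableSet_spin⟩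

/-- The `ℓ¹`-distance on `ℤ²`. -/
def l1Dist (x y : Site) : ℕ := (x.1 - y.1).natAbs + (x.2 - y.2).natAbs

/-- The `ℓ¹`-distance of two sets of sites (it is only relevant for nonempty sets). -/
def setDist (A B : Set Site) : ℕ := sInf {n : ℕ | ∃ x ∈ A, ∃ y ∈ B, n = l1Dist x y}

/-- `σ^x`: the spin at `x` is flipped. -/
def flip (x : Site) (σ : Config) : Config := Function.update σ x (-σ x)

/-- `[σ]_V = ∏_{x ∈ V} σ_x`, as a real number. -/
def spinProd (σ : Config) (V : Finset Site) : ℝ := ∏ x ∈ V, (((σ x : ℤˣ) : ℤ) : ℝ)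

/-! ### Functions of the spins -/

/-- `f` is local if it depends on finitely many spins only. -/
def IsLocal (f : Config → ℝ) : Prop := ∃ V : Finset Site, DependsOn f (V : Set Site)

/-- The support `S_f`; for a local function it is the smallest set on whose spins `f` depends,
see `isLeast_spinSupport`. -/
def spinSupport (f : Config → ℝ) : Set Site := {x | ∃ σ : Config, f (flip x σ) ≠ f σ}

theorem isLeast_spinSupport {f : Config → ℝ} (hf : IsLocal f) :
    IsLeast {V : Set Site | DependsOn f V} (spinSupport f) := by
  constructor
  · obtain ⟨V, hV⟩ := hf
    have key : ∀ (W : Finset Site) (σ τ : Config), (∀ x ∈ spinSupport f, σ x = τ x) →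
        (∀ x, x ∉ W → σ x = τ x) → f σ = f τ := by
      intro W
      induction W using Finset.induction_on with
      | empty =>
        intro σ τ _ h
        have : σ = τ := funext fun x => h x (by simp)
        rw [this]
      | insert a W _ ih =>
        intro σ τ hS hW
        by_cases h : σ a = τ a
        · refine ih σ τ hS fun x hx => ?_
          by_cases hxa : x = a
          · rw [hxa, h]
          · exact hW x (by simp [hxa, hx])
        · have ha : a ∉ spinSupport f := fun h' => h (hS a h')
          have h1 : f (flip a σ) = f σ := by
            by_contra hne
            exact ha ⟨σ, hne⟩
          have h2 : τ a = -σ a := by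
            have := Int.units_ne_iff_eq_neg.mp h
            rw [this, neg_neg]
          rw [← h1]
          refine ih (flip a σ) τ (fun x hx => ?_) fun x hx => ?_
          · have hxa : x ≠ a := fun h' => ha (h' ▸ hx)
            simpa [flip, hxa] using hS x hx
          · by_cases hxa : x = a
            · subst hxa
              simp [flip, h2]
            · simpa [flip, hxa] using hW x (by simp [hxa, hx])
    intro σ τ h
    classical
    have h1 : f τ = f (fun x => if x ∈ V then τ x else σ x) := by
      refine hV fun x hx => ?_
      have hx' : x ∈ V := hx
      simp [hx']
    rw [h1]
    refine key V _ _ (fun x hx => ?_) fun x hx => ?_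
    · by_cases hxV : x ∈ V
      · simpa [hxV] using h x hx
      · simp [hxV]
    · simp [hx]
  · rintro V hV x ⟨σ, hσ⟩
    by_contra hx
    refine hσ (hV fun y hy => ?_)
    have : y ≠ x := fun h => hx (h ▸ hy)
    simp [flip, this]

/-- `‖f‖_∞`. -/
def supNorm (f : Config → ℝ) : ℝ := ⨆ σ : Config, |f σ|

/-! ### Plaquettes and finite-volume Gibbs measures -/

/-- The fundamental plaquette `{0,1}²` of the square plaquette model. -/
def squarePlaquette : Finset Site := {(0, 0), (1, 0), (0, 1), (1, 1)}

/-- The fundamental plaquette `{0, e₂, e₁ + e₂}` of the triangular plaquette model. -/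
def trianglePlaquette : Finset Site := {(0, 0), (0, 1), (1, 1)}

/-- The plaquette `P + z`. -/
def plaquette (P : Finset Site) (z : Site) : Finset Site := P.image (fun b => b + z)

/-- The base points `z` of the plaquettes `P + z` which meet `Λ`. -/
def basePoints (P Λ : Finset Site) : Finset Site := (Λ ×ˢ P).image (fun q => q.1 - q.2)

/-- `‖H‖ = |P| / 2`. -/
def hamNorm (P : Finset Site) : ℝ := (P.card : ℝ) / 2

/-- The configuration equal to `η` in `Λ` and to `τ` outside `Λ`. -/
def glue (Λ : Finset Site) (τ : Config) (η : Λ → ℤˣ) : Config :=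
  fun x => if h : x ∈ Λ then η ⟨x, h⟩ else τ x

/-- `exp ((β/2) ∑ [σ]_B)`, the sum running over the plaquettes `B` which meet `Λ`. -/
def boltzmann (P : Finset Site) (β : ℝ) (Λ : Finset Site) (σ : Config) : ℝ :=
  Real.exp (β / 2 * ∑ z ∈ basePoints P Λ, spinProd σ (plaquette P z))

/-- The partition function `Z_Λ^{β,τ}`. -/
def partitionFn (P : Finset Site) (β : ℝ) (Λ : Finset Site) (τ : Config) : ℝ :=
  ∑ η : Λ → ℤˣ, boltzmann P β Λ (glue Λ τ η)

/-- The probability which `μ_Λ^{β,τ}` gives to the configuration `η` in `Λ`. -/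
def gibbsProb (P : Finset Site) (β : ℝ) (Λ : Finset Site) (τ : Config) (η : Λ → ℤˣ) : ℝ :=
  boltzmann P β Λ (glue Λ τ η) / partitionFn P β Λ τ

/-- The expectation `μ_Λ^{β,τ}(f)`. -/
def gibbsExp (P : Finset Site) (β : ℝ) (Λ : Finset Site) (τ : Config) (f : Config → ℝ) : ℝ :=
  ∑ η : Λ → ℤˣ, gibbsProb P β Λ τ η * f (glue Λ τ η)

/-- The covariance `Cov_Λ^{β,τ}(f, g)`. -/
def gibbsCov (P : Finset Site) (β : ℝ) (Λ : Finset Site) (τ : Config) (f g : Config → ℝ) : ℝ :=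
  gibbsExp P β Λ τ (fun σ => f σ * g σ) - gibbsExp P β Λ τ f * gibbsExp P β Λ τ g

/-- `μ_Λ^{β,τ}` as a measure on the space of all configurations. -/
def gibbsMeasure (P : Finset Site) (β : ℝ) (Λ : Finset Site) (τ : Config) : Measure Config :=
  ∑ η : Λ → ℤˣ, ENNReal.ofReal (gibbsProb P β Λ τ η) • Measure.dirac (glue Λ τ η)

/-- Infinite-volume Gibbs measures: the probability measures which satisfy the
Dobrushin–Lanford–Ruelle equations for all finite volumes. -/
def IsGibbs (P : Finset Site) (β : ℝ) (μ : Measure Config) : Prop :=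
  IsProbabilityMeasure μ ∧
    ∀ (Λ : Finset Site) (A : Set Config), MeasurableSet A →
      μ A = ∫⁻ τ, gibbsMeasure P β Λ τ A ∂μ

/-! ### Strong mixing on regular volumes and the strong mixing scale -/

/-- The square `Q_ℓ + ℓ i`, where `Q_ℓ = {1, …, ℓ}²`. -/
def block (ℓ : ℕ) (i : Site) : Finset Site :=
  Finset.Icc ((ℓ : ℤ) * i.1 + 1) ((ℓ : ℤ) * i.1 + ℓ) ×ˢ
    Finset.Icc ((ℓ : ℤ) * i.2 + 1) ((ℓ : ℤ) * i.2 + ℓ)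

/-- `ℓ`-regular sets: finite unions of the (pairwise disjoint) squares `Q_ℓ + ℓ i`. -/
def IsRegular (ℓ : ℕ) (Λ : Finset Site) : Prop := ∃ I : Finset Site, Λ = I.biUnion (block ℓ)

/-- Strong mixing `SM(ℓ, C, m)`. The functions on the configurations in `Λ` are the functions
`f : Config → ℝ` which only depend on the spins in `Λ`. -/
def StrongMixing (P : Finset Site) (β : ℝ) (ℓ : ℕ) (C m : ℝ) : Prop :=
  ∀ Λ : Finset Site, IsRegular ℓ Λ → ∀ (τ : Config) (f g : Config → ℝ),
    DependsOn f (Λ : Set Site) → DependsOn g (Λ : Set Site) →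
      |gibbsCov P β Λ τ f g| ≤ C * supNorm f * supNorm g * (spinSupport f).ncard *
        (spinSupport g).ncard * Real.exp (-m * setDist (spinSupport f) (spinSupport g))

/-- `h_x(σ) = exp ((β/2) ∑_{B ∋ x} ([σ^x]_B - [σ]_B))`. -/
def flipWeight (P : Finset Site) (β : ℝ) (x : Site) (σ : Config) : ℝ :=
  Real.exp (β / 2 * ∑ z ∈ basePoints P {x},
    (spinProd (flip x σ) (plaquette P z) - spinProd σ (plaquette P z)))

/-- `φ(ℓ)`: the supremum of `|Cov_{Q_ℓ}^{β,τ}(h_x, h_y)|` over all `x, y ∉ Q_ℓ` with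
`d(x, y) ≥ ℓ/4` and all `τ`. -/
def mixPhi (P : Finset Site) (β : ℝ) (ℓ : ℕ) : ℝ≥0∞ :=
  ⨆ (x : Site) (y : Site) (_ : x ∉ block ℓ 0) (_ : y ∉ block ℓ 0)
    (_ : (ℓ : ℝ) / 4 ≤ (l1Dist x y : ℝ)) (τ : Config),
    ENNReal.ofReal |gibbsCov P β (block ℓ 0) τ (flipWeight P β x) (flipWeight P β y)|

/-- The finite-volume condition `e^{4β‖H‖} ℓ φ(ℓ) ≤ ε`. -/
def FiniteVolumeCondition (P : Finset Site) (ε β : ℝ) (ℓ : ℕ) : Prop :=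
  ENNReal.ofReal (Real.exp (4 * β * hamNorm P) * ℓ) * mixPhi P β ℓ ≤ ENNReal.ofReal ε

/-- The strong mixing scale: the smallest positive integer at which the finite-volume condition
with threshold `ε` holds. -/
def mixScale (P : Finset Site) (ε β : ℝ) : ℕ :=
  sInf {ℓ : ℕ | 1 ≤ ℓ ∧ FiniteVolumeCondition P ε β ℓ}

/-- Exponential decay of correlations of local functions. -/
def ExpDecay (μ : Measure Config) : Prop :=
  ∃ C : ℝ, 0 < C ∧ ∃ m : ℝ, 0 < m ∧ ∀ f g : Config → ℝ, IsLocal f → IsLocal g →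
    |∫ σ, f σ * g σ ∂μ - (∫ σ, f σ ∂μ) * ∫ σ, g σ ∂μ| ≤
      C * supNorm f * supNorm g * (spinSupport f).ncard *
        (spinSupport g).ncard * Real.exp (-m * setDist (spinSupport f) (spinSupport g))

end PlaquetteModel

end

open PlaquetteModel

/-!
# Strong mixing of the plaquette models at every positive temperature

In the high-temperature expansion with `t = tanh (β / 2)` the partition function of a volume `Λ` is,
up to a constant, the sum of `∏_{z ∈ A} t [τ]_{P + z}` over the sets `A` of plaquettes which cover
every site of `Λ` an even number of times (`partitionFn_eq`). As `t ≤ exp (-e^{-β})`, the parameter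
`t` is close to `1` at low temperature, and the expansion is useful only because these sets are
very rigid: the parity constraints propagate, so that in a square of side `ℓ` the set `A` is
determined by its intersection with one row and two columns (`square_determined`,
`triangle_determined`), and there are `m` disjoint choices of these lines. By the pigeonhole
principle one of them contains at most `3 |A| / m` points of `A`; so the number of sets is governed
by few of their points and the weight by all of them, and the sum over the nonempty sets of a block
is at most
`m ^ 3 ((1 + exp (-e^{-β} m / 12)) ^ (3 (ℓ + 1)) - 1)` with `m = ℓ / 16` (`sum_blockClasses_le`).
This is small as soon as `ℓ` is a large multiple of `(β + 1) e^β` (`exists_scale_bound`). In the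
triangular model the sets near one corner of each square are not rigid; these plaquettes are summed
exactly, which is harmless because the corners of different squares do not interact
(`CornerSystem`).

A regular volume thus becomes a dilute gas of blocks: the normalised sums over the sets which touch
given blocks factorise over blocks which are not adjacent, by exchanging two copies of the expansion
inside a region (`blockSum_mul_blockSum`), and they are exponentially small in the number of
blocks (`abs_blockWeight_le`). A cluster expansion for two copies shows that
`Z(τ^{xy}) Z(τ) - Z(τ^x) Z(τ^y)` only involves clusters of blocks from `x` to `y`
(`abs_polymerSum_mul_sub_le`), so it is at most `C e^{-d(x, y) / ℓ} Z(τ^x) Z(τ^y)`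
(`partitionFn_mul_sub_le`).

The expectation of `h_x` is proportional to `Z(τ^x) / Z(τ)` (`gibbsExp_flipWeight`), so this is a
bound on the influence of the spin at `x` on the expectation of `h_y` (`InfluenceBound`); in a single
block it gives the finite-volume condition. Since `Cov(h_y, G)` is both the response of `G` to a
flip at `y` and, by conditioning on the spins of which `G` is a function, controlled by the influence
of these spins on `h_y`, the bound passes from `h_y` to functions of the spins of one block, and
block by block to all functions (`InfluenceBound.abs_gibbsExp_flip_sub_le`). Conditioning on the
blocks which meet the support of `f` turns it into strong mixing (`InfluenceBound.strongMixing`).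

The same bound makes expectations of local functions insensitive to distant boundary conditions
(`InfluenceBound.boundaryInsensitive`). Existence, uniqueness and convergence to the
infinite-volume Gibbs measure follow by compactness and consistency; decay of correlations is the
limit of strong mixing; and the magnetisation vanishes because a family of spin flips which meets
every plaquette evenly is a symmetry (`exists_symmetry`).
-/

namespace PlaquetteModel

/-! ### Clusters and weights on an abstract adjacency structure -/

theorem sum_le_sum_of_injOn {ι κ : Type*} {s : Finset ι} {t : Finset κ} {f : ι → ℝ} {g : κ → ℝ}
    (i : ι → κ) (hi : ∀ a ∈ s, i a ∈ t) (inj : Set.InjOn i s) (hfg : ∀ a ∈ s, f a ≤ g (i a))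
    (hg : ∀ b ∈ t, 0 ≤ g b) : ∑ a ∈ s, f a ≤ ∑ b ∈ t, g b := by
  classical
  calc ∑ a ∈ s, f a ≤ ∑ a ∈ s, g (i a) := Finset.sum_le_sum hfg
    _ = ∑ b ∈ s.image i, g b := (Finset.sum_image inj).symm
    _ ≤ _ := Finset.sum_le_sum_of_subset_of_nonneg (Finset.image_subset_iff.2 hi)
        fun b hb _ => hg b hb

section Polymer

/-- `b` can be reached from `s` inside `C` by steps to neighbours (`nb u` lists the neighbours
of `u`). -/
def Reach {α : Type*} (nb : α → Finset α) (C : Finset α) (s b : α) : Prop :=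
  s ∈ C ∧ Relation.ReflTransGen (fun u v => v ∈ C ∧ v ∈ nb u) s b

/-- Every point of `C` can be reached inside `C` from a point of `S`. -/
def Rooted {α : Type*} (nb : α → Finset α) (S C : Finset α) : Prop :=
  ∀ b ∈ C, ∃ s ∈ S, Reach nb C s b

open Classical in
/-- The part of `X` that is connected to `S` inside `X`. -/
noncomputable def cluster {α : Type*} (nb : α → Finset α) (S X : Finset α) : Finset α :=
  X.filter fun b => ∃ s ∈ S, Reach nb X s b

set_option linter.unusedSectionVars false

variable {α : Type*} [DecidableEq α] {nb : α → Finset α}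

theorem Reach.mem {C : Finset α} {s b : α} (h : Reach nb C s b) : b ∈ C := by
  obtain ⟨hs, h⟩ := h
  induction h with
  | refl => exact hs
  | tail _ h _ => exact h.1

theorem Reach.mono {C C' : Finset α} (hC : C ⊆ C') {s b : α} (h : Reach nb C s b) :
    Reach nb C' s b :=
  ⟨hC h.1, Relation.ReflTransGen.mono (fun _ _ h => ⟨hC h.1, h.2⟩) _ _ h.2⟩

theorem Reach.step {C : Finset α} {s b c : α} (h : Reach nb C s b) (hc : c ∈ C)
    (hbc : c ∈ nb b) : Reach nb C s c :=
  ⟨h.1, h.2.tail ⟨hc, hbc⟩⟩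

/-- A path from `s` can be replaced by one which does not return to `s`. -/
theorem Reach.erase {C : Finset α} {s b r : α} (h : Reach nb C r b) :
    b = s ∨ ∃ s', (s' = r ∨ s' ∈ nb s) ∧ s' ≠ s ∧ Reach nb (C.erase s) s' b := by
  obtain ⟨hr, h⟩ := h
  induction h with
  | refl =>
    by_cases hrs : r = s
    · exact Or.inl hrs
    · exact Or.inr ⟨r, Or.inl rfl, hrs, Finset.mem_erase.2 ⟨hrs, hr⟩, .refl⟩
  | @tail u v _ huv ih =>
    by_cases hv : v = s
    · exact Or.inl hv
    right
    have hvC : v ∈ C.erase s := Finset.mem_erase.2 ⟨hv, huv.1⟩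
    rcases ih with rfl | ⟨s', h1, h2, h3⟩
    · exact ⟨v, Or.inr huv.2, hv, hvC, .refl⟩
    · exact ⟨s', h1, h2, h3.step hvC huv.2⟩

theorem Rooted.erase {S C : Finset α} (h : Rooted nb S C) (s : α) :
    Rooted nb (S.erase s ∪ nb s) (C.erase s) := by
  intro b hb
  obtain ⟨hbs, hbC⟩ := Finset.mem_erase.1 hb
  obtain ⟨r, hr, hrb⟩ := h b hbC
  rcases hrb.erase (s := s) with h | ⟨s', h1, h2, h3⟩
  · exact absurd h hbs
  · refine ⟨s', ?_, h3⟩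
    rcases h1 with rfl | h1
    · exact Finset.mem_union_left _ (Finset.mem_erase.2 ⟨h2, hr⟩)
    · exact Finset.mem_union_right _ h1

theorem Rooted.root_erase {S C : Finset α} {s : α} (h : Rooted nb S C) (hs : s ∉ C) :
    Rooted nb (S.erase s) C := fun b hb => by
  obtain ⟨r, hr, hrb⟩ := h b hb
  exact ⟨r, Finset.mem_erase.2 ⟨fun h => hs (h ▸ hrb.1), hr⟩, hrb⟩

theorem cluster_subset (S X : Finset α) : cluster nb S X ⊆ X := by
  classical
  exact Finset.filter_subset _ _

theorem mem_cluster {S X : Finset α} {b : α} :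
    b ∈ cluster nb S X ↔ ∃ s ∈ S, Reach nb X s b := by
  classical
  simp only [cluster, Finset.mem_filter, and_iff_right_iff_imp]
  rintro ⟨s, _, h⟩
  exact h.mem

theorem rooted_cluster (S X : Finset α) : Rooted nb S (cluster nb S X) := by
  intro b hb
  obtain ⟨s, hs, hX, h⟩ := mem_cluster.1 hb
  have hs' : s ∈ cluster nb S X := mem_cluster.2 ⟨s, hs, hX, .refl⟩
  refine ⟨s, hs, ?_⟩
  clear hb
  induction h with
  | refl => exact ⟨hs', .refl⟩
  | @tail u v huv hv ih => exact ih.step (mem_cluster.2 ⟨s, hs, hX, huv.tail hv⟩) hv.2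

theorem disjoint_sdiff_cluster (S X : Finset α) :
    Disjoint (X \ cluster nb S X) ((cluster nb S X).biUnion nb ∪ S) := by
  rw [Finset.disjoint_left]
  intro v hv hv'
  obtain ⟨hvX, hvC⟩ := Finset.mem_sdiff.1 hv
  rcases Finset.mem_union.1 hv' with h | h
  · obtain ⟨u, hu, huv⟩ := Finset.mem_biUnion.1 h
    obtain ⟨s, hs, h⟩ := mem_cluster.1 hu
    exact hvC (mem_cluster.2 ⟨s, hs, h.step hvX huv⟩)
  · exact hvC (mem_cluster.2 ⟨v, h, hvX, .refl⟩)

theorem cluster_union {S C Y : Finset α} (hC : Rooted nb S C)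
    (hY : Disjoint Y (C.biUnion nb ∪ S)) : cluster nb S (C ∪ Y) = C := by
  rw [Finset.disjoint_left] at hY
  apply Finset.Subset.antisymm
  · intro b hb
    obtain ⟨s, hs, hX, h⟩ := mem_cluster.1 hb
    clear hb
    induction h with
    | refl =>
      rcases Finset.mem_union.1 hX with h | h
      · exact h
      · exact absurd (Finset.mem_union_right _ hs) (hY h)
    | @tail u v huv hv ih =>
      rcases Finset.mem_union.1 hv.1 with h | h
      · exact h
      · exact absurd (Finset.mem_union_left _ (Finset.mem_biUnion.2 ⟨u, ih, hv.2⟩)) (hY h)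
  · intro b hb
    obtain ⟨s, hs, h⟩ := hC b hb
    exact mem_cluster.2 ⟨s, hs, h.mono Finset.subset_union_left⟩

open Classical in
/-- The subsets of `V` are the disjoint unions of a set `C` rooted in `S` and of a set `Y` which
touches neither `C` nor `S`. -/
theorem sum_powerset_eq_sum_rooted (hnb : ∀ a, a ∈ nb a) (S V : Finset α)
    (F : Finset α → ℝ) :
    ∑ X ∈ V.powerset, F X = ∑ C ∈ V.powerset.filter (Rooted nb S),
      ∑ Y ∈ (V \ (C.biUnion nb ∪ S)).powerset, F (C ∪ Y) := by
  rw [Finset.sum_sigma']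
  refine Finset.sum_bij' (fun X _ => ⟨cluster nb S X, X \ cluster nb S X⟩)
    (fun p _ => p.1 ∪ p.2) ?_ ?_ ?_ ?_ ?_
  · intro X hX
    rw [Finset.mem_powerset] at hX
    simp only [Finset.mem_sigma, Finset.mem_filter, Finset.mem_powerset]
    refine ⟨⟨(cluster_subset S X).trans hX, rooted_cluster S X⟩, ?_⟩
    intro y hy
    exact Finset.mem_sdiff.2 ⟨hX (Finset.mem_sdiff.1 hy).1,
      Finset.disjoint_left.1 (disjoint_sdiff_cluster S X) hy⟩
  · rintro ⟨C, Y⟩ h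
    simp only [Finset.mem_sigma, Finset.mem_filter, Finset.mem_powerset] at h ⊢
    exact Finset.union_subset h.1.1 (h.2.trans Finset.sdiff_subset)
  · intro X _
    exact Finset.union_sdiff_of_subset (cluster_subset S X)
  · rintro ⟨C, Y⟩ h
    simp only [Finset.mem_sigma, Finset.mem_filter, Finset.mem_powerset] at h
    have hY : Disjoint Y (C.biUnion nb ∪ S) :=
      Finset.disjoint_left.2 fun y hy => (Finset.mem_sdiff.1 (h.2 hy)).2
    have hCY : Disjoint C Y := Finset.disjoint_left.2 fun a ha hy =>
      Finset.disjoint_left.1 hY hy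
        (Finset.mem_union_left _ (Finset.mem_biUnion.2 ⟨a, ha, hnb a⟩))
    have h1 := cluster_union h.1.2 hY
    simp only [h1, Finset.union_sdiff_cancel_left hCY]
  · intro X _
    simp only [Finset.union_sdiff_of_subset (cluster_subset S X)]

open Classical in
/-- The generating function of the sets rooted in `S`, by exploration of one point at a time. -/
theorem sum_rooted_le {D : ℕ} (hD : ∀ a, (nb a).card ≤ D) {a : ℝ} (ha0 : 0 ≤ a)
    (ha : a * 2 ^ D ≤ 1) (V S : Finset α) :
    ∑ C ∈ V.powerset.filter (Rooted nb S), a ^ C.card ≤ 2 ^ (S ∩ V).card := by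
  induction V using Finset.strongInduction generalizing S with
  | H V ih =>
    by_cases hSV : S ∩ V = ∅
    · have : V.powerset.filter (Rooted nb S) ⊆ {∅} := by
        intro C hC
        obtain ⟨hCV, hC⟩ := Finset.mem_filter.1 hC
        rw [Finset.mem_powerset] at hCV
        rw [Finset.mem_singleton, Finset.eq_empty_iff_forall_notMem]
        intro b hb
        obtain ⟨s, hs, h⟩ := hC b hb
        have : s ∈ S ∩ V := Finset.mem_inter.2 ⟨hs, hCV h.1⟩
        simp [hSV] at this
      calc _ ≤ ∑ C ∈ ({∅} : Finset (Finset α)), a ^ C.card :=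
            Finset.sum_le_sum_of_subset_of_nonneg this fun _ _ _ => by positivity
        _ ≤ _ := by simp [hSV]
    · obtain ⟨s, hs⟩ := Finset.nonempty_iff_ne_empty.2 hSV
      obtain ⟨hsS, hsV⟩ := Finset.mem_inter.1 hs
      have hlt : V.erase s ⊂ V := Finset.erase_ssubset hsV
      have h1 := ih _ hlt (S.erase s)
      have h2 := ih _ hlt (S.erase s ∪ nb s)
      obtain ⟨n, hn⟩ : ∃ n, (S ∩ V).card = n + 1 :=
        ⟨(S ∩ V).card - 1, (Nat.succ_pred_eq_of_pos (Finset.card_pos.2 ⟨s, hs⟩)).symm⟩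
      have hc1 : (S.erase s ∩ V.erase s).card ≤ n := by
        have : S.erase s ∩ V.erase s = (S ∩ V).erase s := by
          ext x; simp only [Finset.mem_inter, Finset.mem_erase]; tauto
        rw [this, Finset.card_erase_of_mem hs, hn]; simp
      have hc2 : ((S.erase s ∪ nb s) ∩ V.erase s).card ≤ n + D := by
        rw [Finset.union_inter_distrib_right]
        refine (Finset.card_union_le _ _).trans (Nat.add_le_add hc1 ?_)
        exact (Finset.card_le_card Finset.inter_subset_left).trans (hD s)
      rw [← Finset.sum_filter_add_sum_filter_not _ (fun C => s ∈ C)]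
      have e1 : ∑ C ∈ (V.powerset.filter (Rooted nb S)).filter (fun C => s ∈ C), a ^ C.card ≤
          a * ∑ C ∈ (V.erase s).powerset.filter (Rooted nb (S.erase s ∪ nb s)), a ^ C.card := by
        rw [Finset.mul_sum]
        refine sum_le_sum_of_injOn (fun C => C.erase s) ?_ ?_ ?_ ?_
        · intro C hC
          simp only [Finset.mem_filter, Finset.mem_powerset] at hC ⊢
          exact ⟨Finset.erase_subset_erase _ hC.1.1, hC.1.2.erase s⟩
        · intro C hC C' hC' h
          simp only [Finset.coe_filter, Finset.mem_filter, Finset.mem_powerset,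
            Set.mem_ofPred_eq] at hC hC'
          rw [← Finset.insert_erase hC.2, ← Finset.insert_erase hC'.2]
          exact congrArg (insert s) h
        · intro C hC
          simp only [Finset.mem_filter] at hC
          rw [← Finset.card_erase_add_one hC.2, pow_succ, mul_comm]
        · intro C _
          positivity
      have e2 : ∑ C ∈ (V.powerset.filter (Rooted nb S)).filter (fun C => ¬ s ∈ C), a ^ C.card ≤
          ∑ C ∈ (V.erase s).powerset.filter (Rooted nb (S.erase s)), a ^ C.card := by
        refine Finset.sum_le_sum_of_subset_of_nonneg ?_ fun _ _ _ => by positivity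
        intro C hC
        simp only [Finset.mem_filter, Finset.mem_powerset] at hC ⊢
        exact ⟨Finset.subset_erase.2 ⟨hC.1.1, hC.2⟩, hC.1.2.root_erase hC.2⟩
      have p1 : (2 : ℝ) ^ (S.erase s ∩ V.erase s).card ≤ 2 ^ n :=
        pow_le_pow_right₀ (by norm_num) hc1
      have p2 : (2 : ℝ) ^ ((S.erase s ∪ nb s) ∩ V.erase s).card ≤ 2 ^ (n + D) :=
        pow_le_pow_right₀ (by norm_num) hc2
      have p3 : a * (2 : ℝ) ^ (n + D) ≤ 2 ^ n := by
        rw [pow_add, mul_left_comm]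
        exact mul_le_of_le_one_right (by positivity) ha
      rw [hn, pow_succ]
      have := mul_le_mul_of_nonneg_left (h2.trans p2) ha0
      linarith

/-- Weights of sets of blocks: multiplicative over sets that are not adjacent, and exponentially
small in the number of blocks. -/
structure PolymerWeight (nb : α → Finset α) (I : Finset α) (δ : ℝ) (W : Finset α → ℝ) : Prop where
  empty : W ∅ = 1
  union : ∀ X Y, X ⊆ I → Y ⊆ I → (∀ a ∈ X, ∀ b ∈ Y, b ∉ nb a) → W (X ∪ Y) = W X * W Y
  abs_le : ∀ X ⊆ I, |W X| ≤ δ ^ X.card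

/-- The partition function of the weights `W` in the volume `V`. -/
def polymerSum (W : Finset α → ℝ) (V : Finset α) : ℝ := ∑ X ∈ V.powerset, W X

/-- Two independent copies, regarded as weights of the set of all occupied blocks. -/
def pairWeight (W W' : Finset α → ℝ) (U : Finset α) : ℝ :=
  ∑ p ∈ (U.powerset ×ˢ U.powerset).filter (fun p => p.1 ∪ p.2 = U), W p.1 * W' p.2

theorem sum_pairWeight (W W' : Finset α → ℝ) (V : Finset α) :
    ∑ U ∈ V.powerset, pairWeight W W' U = polymerSum W V * polymerSum W' V := by
  rw [polymerSum, polymerSum, Finset.sum_mul_sum, ← Finset.sum_product']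
  rw [← Finset.sum_fiberwise_of_maps_to (s := V.powerset ×ˢ V.powerset) (t := V.powerset)
    (g := fun p => p.1 ∪ p.2)]
  · refine Finset.sum_congr rfl fun U hU => ?_
    refine Finset.sum_congr ?_ fun _ _ => rfl
    rw [Finset.mem_powerset] at hU
    ext p
    simp only [Finset.mem_filter, Finset.mem_product, Finset.mem_powerset]
    constructor
    · rintro ⟨⟨h1, h2⟩, h3⟩
      exact ⟨⟨h1.trans hU, h2.trans hU⟩, h3⟩
    · rintro ⟨_, rfl⟩
      exact ⟨⟨Finset.subset_union_left, Finset.subset_union_right⟩, rfl⟩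
  · intro p hp
    simp only [Finset.mem_product, Finset.mem_powerset] at hp ⊢
    exact Finset.union_subset hp.1 hp.2

theorem pairWeight_comm (W W' : Finset α → ℝ) (U : Finset α) :
    pairWeight W W' U = pairWeight W' W U := by
  refine Finset.sum_bij' (fun p _ => p.swap) (fun p _ => p.swap) ?_ ?_ ?_ ?_ ?_
  · intro p hp
    simp only [Finset.mem_filter, Finset.mem_product, Finset.mem_powerset, Prod.fst_swap,
      Prod.snd_swap] at hp ⊢
    rw [Finset.union_comm]
    tauto
  · intro p hp
    simp only [Finset.mem_filter, Finset.mem_product, Finset.mem_powerset, Prod.fst_swap,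
      Prod.snd_swap] at hp ⊢
    rw [Finset.union_comm]
    tauto
  · intro p _; simp
  · intro p _; simp
  · intro p _; simp [mul_comm]

theorem pairWeight_congr {W₁ W₂ W₁' W₂' : Finset α → ℝ} {U : Finset α}
    (h : ∀ X ⊆ U, W₁ X = W₂ X) (h' : ∀ X ⊆ U, W₁' X = W₂' X) :
    pairWeight W₁ W₁' U = pairWeight W₂ W₂' U := by
  refine Finset.sum_congr rfl fun p hp => ?_
  simp only [Finset.mem_filter, Finset.mem_product, Finset.mem_powerset] at hp
  rw [h _ hp.1.1, h' _ hp.1.2]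

theorem pairWeight_union {I : Finset α} {δ δ' : ℝ} {W W' : Finset α → ℝ}
    (hnb : ∀ a, a ∈ nb a)
    (hW : PolymerWeight nb I δ W) (hW' : PolymerWeight nb I δ' W') {X Y : Finset α}
    (hX : X ⊆ I) (hY : Y ⊆ I) (hXY : ∀ a ∈ X, ∀ b ∈ Y, b ∉ nb a) :
    pairWeight W W' (X ∪ Y) = pairWeight W W' X * pairWeight W W' Y := by
  have hdis : Disjoint X Y := Finset.disjoint_left.2 fun a ha hb => hXY a ha a hb (hnb a)
  rw [pairWeight, pairWeight, pairWeight, Finset.sum_mul_sum, ← Finset.sum_product']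
  refine Finset.sum_bij' (fun p _ => ((p.1 ∩ X, p.2 ∩ X), (p.1 ∩ Y, p.2 ∩ Y)))
    (fun q _ => (q.1.1 ∪ q.2.1, q.1.2 ∪ q.2.2)) ?_ ?_ ?_ ?_ ?_
  · intro p hp
    simp only [Finset.mem_filter, Finset.mem_product, Finset.mem_powerset] at hp ⊢
    refine ⟨⟨⟨Finset.inter_subset_right, Finset.inter_subset_right⟩, ?_⟩,
      ⟨Finset.inter_subset_right, Finset.inter_subset_right⟩, ?_⟩
    · rw [← Finset.union_inter_distrib_right, hp.2]
      exact Finset.inter_eq_right.2 Finset.subset_union_left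
    · rw [← Finset.union_inter_distrib_right, hp.2]
      exact Finset.inter_eq_right.2 Finset.subset_union_right
  · intro q hq
    simp only [Finset.mem_filter, Finset.mem_product, Finset.mem_powerset] at hq ⊢
    refine ⟨⟨Finset.union_subset_union hq.1.1.1 hq.2.1.1,
      Finset.union_subset_union hq.1.1.2 hq.2.1.2⟩, ?_⟩
    rw [Finset.union_union_union_comm, hq.1.2, hq.2.2]
  · intro p hp
    simp only [Finset.mem_filter, Finset.mem_product, Finset.mem_powerset] at hp
    refine Prod.ext ?_ ?_
    · simp only
      rw [← Finset.inter_union_distrib_left, Finset.inter_eq_left.2 hp.1.1]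
    · simp only
      rw [← Finset.inter_union_distrib_left, Finset.inter_eq_left.2 hp.1.2]
  · intro q hq
    simp only [Finset.mem_filter, Finset.mem_product, Finset.mem_powerset] at hq
    have key : ∀ A B : Finset α, A ⊆ X → B ⊆ Y → (A ∪ B) ∩ X = A ∧ (A ∪ B) ∩ Y = B := by
      intro A B hA hB
      rw [Finset.union_inter_distrib_right, Finset.union_inter_distrib_right,
        Finset.inter_eq_left.2 hA, Finset.inter_eq_left.2 hB,
        Finset.disjoint_iff_inter_eq_empty.1 (hdis.symm.mono_left hB),
        Finset.disjoint_iff_inter_eq_empty.1 (hdis.mono_left hA)]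
      simp
    obtain ⟨a1, a2⟩ := key _ _ hq.1.1.1 hq.2.1.1
    obtain ⟨b1, b2⟩ := key _ _ hq.1.1.2 hq.2.1.2
    simp only [a1, a2, b1, b2]
  · intro p hp
    simp only [Finset.mem_filter, Finset.mem_product, Finset.mem_powerset] at hp
    have key : ∀ (V : Finset α → ℝ) (η : ℝ), PolymerWeight nb I η V → ∀ A ⊆ X ∪ Y,
        V A = V (A ∩ X) * V (A ∩ Y) := by
      intro V η hV A hA
      rw [← hV.union _ _ (Finset.inter_subset_right.trans hX)
        (Finset.inter_subset_right.trans hY) (fun a ha b hb =>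
          hXY a (Finset.mem_inter.1 ha).2 b (Finset.mem_inter.1 hb).2),
        ← Finset.inter_union_distrib_left, Finset.inter_eq_left.2 hA]
    rw [key W δ hW _ hp.1.1, key W' δ' hW' _ hp.1.2]
    ring

theorem abs_pairWeight_le {I : Finset α} {δ : ℝ} {W W' : Finset α → ℝ} (hδ0 : 0 ≤ δ)
    (hδ1 : δ ≤ 1) (hW : PolymerWeight nb I δ W) (hW' : PolymerWeight nb I δ W') {U : Finset α}
    (hU : U ⊆ I) : |pairWeight W W' U| ≤ (4 * δ) ^ U.card := by
  calc |pairWeight W W' U| ≤ ∑ p ∈ (U.powerset ×ˢ U.powerset).filter (fun p => p.1 ∪ p.2 = U),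
        |W p.1 * W' p.2| := Finset.abs_sum_le_sum_abs _ _
    _ ≤ ∑ p ∈ (U.powerset ×ˢ U.powerset).filter (fun p => p.1 ∪ p.2 = U), δ ^ U.card := by
        refine Finset.sum_le_sum fun p hp => ?_
        simp only [Finset.mem_filter, Finset.mem_product, Finset.mem_powerset] at hp
        rw [abs_mul]
        calc |W p.1| * |W' p.2| ≤ δ ^ p.1.card * δ ^ p.2.card :=
              mul_le_mul (hW.abs_le _ (hp.1.1.trans hU)) (hW'.abs_le _ (hp.1.2.trans hU))
                (abs_nonneg _) (by positivity)
          _ = δ ^ (p.1.card + p.2.card) := (pow_add _ _ _).symm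
          _ ≤ δ ^ U.card := by
              refine pow_le_pow_of_le_one hδ0 hδ1 ?_
              rw [← hp.2]
              exact Finset.card_union_le _ _
    _ ≤ ∑ p ∈ U.powerset ×ˢ U.powerset, δ ^ U.card :=
        Finset.sum_le_sum_of_subset_of_nonneg (Finset.filter_subset _ _)
          fun _ _ _ => by positivity
    _ = (4 * δ) ^ U.card := by
        rw [Finset.sum_const, Finset.card_product, Finset.card_powerset, nsmul_eq_mul, mul_pow]
        push_cast
        rw [← mul_pow]
        norm_num

theorem card_biUnion_nb_le {D : ℕ} (hD : ∀ a, (nb a).card ≤ D) (C : Finset α) :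
    (C.biUnion nb).card ≤ D * C.card := by
  rw [mul_comm]
  exact Finset.card_biUnion_le_card_mul _ _ _ fun a _ => hD a

open Classical in
/-- Removing a block from the volume changes the partition function by a bounded factor. -/
theorem PolymerWeight.abs_polymerSum_sdiff_le {D : ℕ} (hnb : ∀ a, a ∈ nb a)
    (hD : ∀ a, (nb a).card ≤ D) {I : Finset α} {δ : ℝ} {W : Finset α → ℝ} (hδ0 : 0 ≤ δ)
    (hδ : δ * 4 ^ (D + 1) ≤ 1) (hW : PolymerWeight nb I δ W) (V : Finset α) (hV : V ⊆ I)
    (U : Finset α) : |polymerSum W (V \ U)| ≤ 2 ^ U.card * |polymerSum W V| := by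
  induction V using Finset.strongInduction generalizing U with
  | H V ih =>
    have key : ∀ b ∈ V, |polymerSum W (V.erase b)| ≤ 2 * |polymerSum W V| := by
      intro b hb
      have hlt : V.erase b ⊂ V := Finset.erase_ssubset hb
      set Z := polymerSum W (V.erase b) with hZ
      have e1 : polymerSum W V = ∑ C ∈ V.powerset.filter (Rooted nb {b}),
          W C * polymerSum W (V \ (C.biUnion nb ∪ {b})) := by
        rw [polymerSum, sum_powerset_eq_sum_rooted hnb {b} V]
        refine Finset.sum_congr rfl fun C hC => ?_
        simp only [Finset.mem_filter, Finset.mem_powerset] at hC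
        rw [polymerSum, Finset.mul_sum]
        refine Finset.sum_congr rfl fun Y hY => ?_
        rw [Finset.mem_powerset] at hY
        refine hW.union C Y (hC.1.trans hV) ((hY.trans Finset.sdiff_subset).trans hV) ?_
        intro a ha y hy hya
        exact (Finset.mem_sdiff.1 (hY hy)).2
          (Finset.mem_union_left _ (Finset.mem_biUnion.2 ⟨a, ha, hya⟩))
      have hmem : (∅ : Finset α) ∈ V.powerset.filter (Rooted nb {b}) := by
        simp [Rooted]
      rw [← Finset.add_sum_erase _ _ hmem] at e1
      have e2 : W ∅ * polymerSum W (V \ ((∅ : Finset α).biUnion nb ∪ {b})) = Z := by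
        simp [hW.empty, hZ, Finset.sdiff_singleton_eq_erase]
      rw [e2] at e1
      have e3 : |∑ C ∈ (V.powerset.filter (Rooted nb {b})).erase ∅,
          W C * polymerSum W (V \ (C.biUnion nb ∪ {b}))| ≤ |Z| / 2 := by
        have hcard : (({b} : Finset α) ∩ V).card ≤ 1 :=
          (Finset.card_le_card Finset.inter_subset_left).trans (by simp)
        have hT := sum_rooted_le hD (a := 1 / 2 ^ D) (by positivity)
          (by rw [one_div, inv_mul_cancel₀ (by positivity)]) V {b}
        have hT2 : ∑ C ∈ V.powerset.filter (Rooted nb {b}), (1 / 2 ^ D : ℝ) ^ C.card ≤ 2 :=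
          hT.trans ((pow_le_pow_right₀ (by norm_num) hcard).trans (by norm_num))
        calc _ ≤ ∑ C ∈ (V.powerset.filter (Rooted nb {b})).erase ∅,
              |W C * polymerSum W (V \ (C.biUnion nb ∪ {b}))| := Finset.abs_sum_le_sum_abs _ _
          _ ≤ ∑ C ∈ (V.powerset.filter (Rooted nb {b})).erase ∅,
              (1 / 4 * |Z|) * (1 / 2 ^ D) ^ C.card := by
              refine Finset.sum_le_sum fun C hC => ?_
              simp only [Finset.mem_filter, Finset.mem_powerset, Finset.mem_erase] at hC
              have hpos : C.card ≠ 0 := fun h => hC.1 (Finset.card_eq_zero.1 h)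
              have e4 : V \ (C.biUnion nb ∪ {b}) = V.erase b \ C.biUnion nb := by
                ext x
                simp only [Finset.mem_sdiff, Finset.mem_union, Finset.mem_singleton,
                  Finset.mem_erase]
                tauto
              have e5 : |polymerSum W (V.erase b \ C.biUnion nb)| ≤ 2 ^ (D * C.card) * |Z| :=
                (ih _ hlt ((Finset.erase_subset _ _).trans hV) _).trans
                  (mul_le_mul_of_nonneg_right
                    (pow_le_pow_right₀ (by norm_num) (card_biUnion_nb_le hD C)) (abs_nonneg _))
              rw [abs_mul, e4]
              calc |W C| * |polymerSum W (V.erase b \ C.biUnion nb)|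
                  ≤ δ ^ C.card * (2 ^ (D * C.card) * |Z|) :=
                    mul_le_mul (hW.abs_le C (hC.2.1.trans hV)) e5 (abs_nonneg _) (by positivity)
                _ = (δ * 2 ^ D) ^ C.card * |Z| := by rw [mul_pow, ← pow_mul]; ring
                _ ≤ (1 / 4 * (1 / 2 ^ D)) ^ C.card * |Z| := by
                    refine mul_le_mul_of_nonneg_right (pow_le_pow_left₀ (by positivity) ?_ _)
                      (abs_nonneg _)
                    rw [div_mul_div_comm, le_div_iff₀ (by positivity)]
                    have : (4 : ℝ) ^ (D + 1) = 2 ^ D * (2 ^ D * 4) := by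
                      rw [pow_succ, show (4 : ℝ) = 2 * 2 by norm_num, mul_pow]; ring
                    rw [this] at hδ
                    linarith
                _ ≤ (1 / 4 * |Z|) * (1 / 2 ^ D) ^ C.card := by
                    rw [mul_pow]
                    have : (1 / 4 : ℝ) ^ C.card ≤ 1 / 4 :=
                      pow_le_of_le_one (by norm_num) (by norm_num) hpos
                    have h3 : (0 : ℝ) ≤ (1 / 2 ^ D) ^ C.card * |Z| := by positivity
                    nlinarith
          _ ≤ ∑ C ∈ V.powerset.filter (Rooted nb {b}), (1 / 4 * |Z|) * (1 / 2 ^ D) ^ C.card :=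
              Finset.sum_le_sum_of_subset_of_nonneg (Finset.erase_subset _ _)
                fun _ _ _ => by positivity
          _ ≤ |Z| / 2 := by
              rw [← Finset.mul_sum]
              have := mul_le_mul_of_nonneg_left hT2 (show 0 ≤ 1 / 4 * |Z| by positivity)
              linarith
      have e6 := abs_sub_abs_le_abs_sub Z (-(∑ C ∈ (V.powerset.filter (Rooted nb {b})).erase ∅,
          W C * polymerSum W (V \ (C.biUnion nb ∪ {b}))))
      rw [sub_neg_eq_add, ← e1, abs_neg] at e6
      linarith
    by_cases hUV : U ∩ V = ∅
    · have : V \ U = V :=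
        Finset.sdiff_eq_self_of_disjoint (by
          rw [Finset.disjoint_iff_inter_eq_empty, Finset.inter_comm, hUV])
      rw [this]
      exact le_mul_of_one_le_left (abs_nonneg _) (one_le_pow₀ (by norm_num))
    · obtain ⟨b, hb⟩ := Finset.nonempty_iff_ne_empty.2 hUV
      obtain ⟨hbU, hbV⟩ := Finset.mem_inter.1 hb
      have e1 : V \ U = V.erase b \ U.erase b := by
        ext x
        simp only [Finset.mem_sdiff, Finset.mem_erase]
        constructor
        · rintro ⟨h1, h2⟩
          exact ⟨⟨fun h => h2 (h ▸ hbU), h1⟩, fun h => h2 h.2⟩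
        · rintro ⟨⟨h1, h2⟩, h3⟩
          exact ⟨h2, fun h => h3 ⟨h1, h⟩⟩
      have e2 := ih _ (Finset.erase_ssubset hbV) ((Finset.erase_subset _ _).trans hV) (U.erase b)
      rw [e1]
      refine e2.trans ?_
      rw [← Finset.card_erase_add_one hbU, pow_succ, mul_assoc]
      exact mul_le_mul_of_nonneg_left (key b hbV) (by positivity)

open Classical in
/-- **Decay of the truncated two-point function.** If the weights `W₁₀`, `W₀₁`, `W₁₁` are local
perturbations of `W₀₀` near `Nx`, near `Ny` and near both, then only the clusters which join `Nx`
to `Ny` contribute to `Z₁₁ Z₀₀ - Z₁₀ Z₀₁`: outside the cluster of `Nx` the two copies can be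
exchanged. -/
theorem abs_polymerSum_mul_sub_le {D : ℕ} (hnb : ∀ a, a ∈ nb a) (hD : ∀ a, (nb a).card ≤ D)
    {I : Finset α} {δ : ℝ} (hδ0 : 0 ≤ δ)
    (hδ : δ * (4 ^ (D + 1) * (2 ^ D * Real.exp 4)) ≤ 1) {W₀₀ W₁₀ W₀₁ W₁₁ : Finset α → ℝ}
    (h₀₀ : PolymerWeight nb I δ W₀₀) (h₁₀ : PolymerWeight nb I δ W₁₀)
    (h₀₁ : PolymerWeight nb I δ W₀₁) (h₁₁ : PolymerWeight nb I δ W₁₁) (Nx Ny : Finset α)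
    (hx0 : ∀ X ⊆ I, Disjoint X Nx → W₁₀ X = W₀₀ X) (hx1 : ∀ X ⊆ I, Disjoint X Nx → W₁₁ X = W₀₁ X)
    (hy0 : ∀ X ⊆ I, Disjoint X Ny → W₀₁ X = W₀₀ X) (hy1 : ∀ X ⊆ I, Disjoint X Ny → W₁₁ X = W₁₀ X)
    {κ : ℝ} (hκ : ∀ C ⊆ I, ∀ s ∈ Nx, ∀ b ∈ Ny, Reach nb C s b → κ ≤ 4 * C.card) :
    |polymerSum W₁₁ I * polymerSum W₀₀ I - polymerSum W₁₀ I * polymerSum W₀₁ I| ≤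
      2 * 8 ^ (Nx ∪ Ny).card * Real.exp (-κ) * |polymerSum W₁₀ I * polymerSum W₀₁ I| := by
  have hexp : (1 : ℝ) ≤ Real.exp 4 := Real.one_le_exp (by norm_num)
  have h2D : (1 : ℝ) ≤ 2 ^ D := one_le_pow₀ (by norm_num)
  have h4D : (1 : ℝ) ≤ 4 ^ (D + 1) := one_le_pow₀ (by norm_num)
  have hδ' : δ * 4 ^ (D + 1) ≤ 1 := by
    refine le_trans (mul_le_mul_of_nonneg_left ?_ hδ0) hδ
    exact le_mul_of_one_le_right (by positivity) (one_le_mul_of_one_le_of_one_le h2D hexp)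
  have hδ1 : δ ≤ 1 := le_trans (le_mul_of_one_le_right hδ0 h4D) hδ'
  set S := Nx ∪ Ny with hS
  set P := pairWeight W₁₁ W₀₀ with hP
  set Q := pairWeight W₁₀ W₀₁ with hQ
  have hPu : ∀ X Y, X ⊆ I → Y ⊆ I → (∀ a ∈ X, ∀ b ∈ Y, b ∉ nb a) → P (X ∪ Y) = P X * P Y :=
    fun X Y hX hY h => pairWeight_union hnb h₁₁ h₀₀ hX hY h
  have hQu : ∀ X Y, X ⊆ I → Y ⊆ I → (∀ a ∈ X, ∀ b ∈ Y, b ∉ nb a) → Q (X ∪ Y) = Q X * Q Y :=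
    fun X Y hX hY h => pairWeight_union hnb h₁₀ h₀₁ hX hY h
  -- away from `Ny` the two pair weights agree termwise, away from `Nx` after exchanging the copies
  have hPQy : ∀ X ⊆ I, Disjoint X Ny → P X = Q X := fun X hX hd =>
    pairWeight_congr (fun Y hY => hy1 Y (hY.trans hX) (hd.mono_left hY))
      (fun Y hY => (hy0 Y (hY.trans hX) (hd.mono_left hY)).symm)
  have hPQx : ∀ X ⊆ I, Disjoint X Nx → P X = Q X := fun X hX hd => by
    rw [hQ, pairWeight_comm]
    exact pairWeight_congr (fun Y hY => hx1 Y (hY.trans hX) (hd.mono_left hY))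
      (fun Y hY => (hx0 Y (hY.trans hX) (hd.mono_left hY)).symm)
  have hvanish : ∀ C ⊆ I, (¬ ∃ s ∈ Nx, ∃ b ∈ Ny, Reach nb C s b) → P C = Q C := by
    intro C hC hno
    have e := disjoint_sdiff_cluster (nb := nb) Nx C
    have hsub : cluster nb Nx C ⊆ C := cluster_subset Nx C
    have hadj : ∀ a ∈ cluster nb Nx C, ∀ b ∈ C \ cluster nb Nx C, b ∉ nb a := fun a ha b hb hba =>
      Finset.disjoint_left.1 e hb
        (Finset.mem_union_left _ (Finset.mem_biUnion.2 ⟨a, ha, hba⟩))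
    rw [← Finset.union_sdiff_of_subset hsub,
      hPu _ _ (hsub.trans hC) (Finset.sdiff_subset.trans hC) hadj,
      hQu _ _ (hsub.trans hC) (Finset.sdiff_subset.trans hC) hadj,
      hPQy _ (hsub.trans hC) ?_, hPQx _ (Finset.sdiff_subset.trans hC) ?_]
    · exact e.mono_right Finset.subset_union_right
    · rw [Finset.disjoint_left]
      intro b hb hbN
      obtain ⟨s, hs, h⟩ := mem_cluster.1 hb
      exact hno ⟨s, hs, b, hbN, h⟩
  have hmain : polymerSum W₁₁ I * polymerSum W₀₀ I - polymerSum W₁₀ I * polymerSum W₀₁ I =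
      ∑ C ∈ I.powerset.filter (Rooted nb S), (P C - Q C) *
        (polymerSum W₁₀ (I \ (C.biUnion nb ∪ S)) * polymerSum W₀₁ (I \ (C.biUnion nb ∪ S))) := by
    rw [← sum_pairWeight, ← sum_pairWeight, ← Finset.sum_sub_distrib,
      sum_powerset_eq_sum_rooted hnb S I]
    refine Finset.sum_congr rfl fun C hC => ?_
    simp only [Finset.mem_filter, Finset.mem_powerset] at hC
    rw [← sum_pairWeight, Finset.mul_sum]
    refine Finset.sum_congr rfl fun Y hY => ?_
    rw [Finset.mem_powerset] at hY
    have hYI : Y ⊆ I := hY.trans Finset.sdiff_subset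
    have hY' : ∀ y ∈ Y, y ∉ C.biUnion nb ∪ S := fun y hy => (Finset.mem_sdiff.1 (hY hy)).2
    have hadj : ∀ a ∈ C, ∀ b ∈ Y, b ∉ nb a := fun a ha b hb hba =>
      hY' b hb (Finset.mem_union_left _ (Finset.mem_biUnion.2 ⟨a, ha, hba⟩))
    have hYy : Disjoint Y Ny := Finset.disjoint_left.2 fun y hy h =>
      hY' y hy (Finset.mem_union_right _ (Finset.mem_union_right _ h))
    change P (C ∪ Y) - Q (C ∪ Y) = (P C - Q C) * Q Y
    rw [hPu C Y hC.1 hYI hadj, hQu C Y hC.1 hYI hadj, hPQy Y hYI hYy]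
    ring
  rw [hmain]
  set R := |polymerSum W₁₀ I * polymerSum W₀₁ I| with hR
  have hterm : ∀ C ∈ I.powerset.filter (Rooted nb S), |(P C - Q C) *
      (polymerSum W₁₀ (I \ (C.biUnion nb ∪ S)) * polymerSum W₀₁ (I \ (C.biUnion nb ∪ S)))| ≤
      (2 * 4 ^ S.card * Real.exp (-κ) * R) * (1 / 2 ^ D) ^ C.card := by
    intro C hC
    simp only [Finset.mem_filter, Finset.mem_powerset] at hC
    by_cases hno : ∃ s ∈ Nx, ∃ b ∈ Ny, Reach nb C s b
    · obtain ⟨s, hs, b, hb, h⟩ := hno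
      have hk := hκ C hC.1 s hs b hb h
      have hcard : (C.biUnion nb ∪ S).card ≤ D * C.card + S.card :=
        (Finset.card_union_le _ _).trans (Nat.add_le_add_right (card_biUnion_nb_le hD C) _)
      have hpow : (2 : ℝ) ^ (C.biUnion nb ∪ S).card ≤ 2 ^ (D * C.card + S.card) :=
        pow_le_pow_right₀ (by norm_num) hcard
      have z1 : |polymerSum W₁₀ (I \ (C.biUnion nb ∪ S))| ≤
          2 ^ (D * C.card + S.card) * |polymerSum W₁₀ I| :=
        (h₁₀.abs_polymerSum_sdiff_le hnb hD hδ0 hδ' I subset_rfl _).trans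
          (mul_le_mul_of_nonneg_right hpow (abs_nonneg _))
      have z2 : |polymerSum W₀₁ (I \ (C.biUnion nb ∪ S))| ≤
          2 ^ (D * C.card + S.card) * |polymerSum W₀₁ I| :=
        (h₀₁.abs_polymerSum_sdiff_le hnb hD hδ0 hδ' I subset_rfl _).trans
          (mul_le_mul_of_nonneg_right hpow (abs_nonneg _))
      have pq : |P C - Q C| ≤ 2 * (4 * δ) ^ C.card := by
        have := abs_sub (P C) (Q C)
        have p1 := abs_pairWeight_le hδ0 hδ1 h₁₁ h₀₀ hC.1
        have p2 := abs_pairWeight_le hδ0 hδ1 h₁₀ h₀₁ hC.1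
        change |P C| ≤ _ at p1
        change |Q C| ≤ _ at p2
        linarith
      rw [abs_mul, abs_mul]
      calc |P C - Q C| * (|polymerSum W₁₀ (I \ (C.biUnion nb ∪ S))| *
            |polymerSum W₀₁ (I \ (C.biUnion nb ∪ S))|)
          ≤ (2 * (4 * δ) ^ C.card) * ((2 ^ (D * C.card + S.card) * |polymerSum W₁₀ I|) *
            (2 ^ (D * C.card + S.card) * |polymerSum W₀₁ I|)) := by gcongr
        _ = (2 * 4 ^ S.card * R) * (δ * 4 ^ (D + 1)) ^ C.card := by
            rw [hR, abs_mul, show (4 : ℝ) = 2 * 2 by norm_num]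
            simp only [mul_pow, pow_add, pow_mul, pow_one]
            ring
        _ ≤ (2 * 4 ^ S.card * R) * (Real.exp (-4) * (1 / 2 ^ D)) ^ C.card := by
            have h4 : δ * 4 ^ (D + 1) ≤ Real.exp (-4) * (1 / 2 ^ D) := by
              rw [Real.exp_neg, ← one_div, one_div_mul_one_div, le_div_iff₀ (by positivity)]
              linarith
            exact mul_le_mul_of_nonneg_left (pow_le_pow_left₀ (by positivity) h4 _)
              (by positivity)
        _ = (2 * 4 ^ S.card * Real.exp (-(4 * C.card)) * R) * (1 / 2 ^ D) ^ C.card := by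
            rw [mul_pow, ← Real.exp_nat_mul]
            ring_nf
        _ ≤ _ := by gcongr
    · rw [hvanish C hC.1 hno, sub_self, zero_mul, abs_zero]
      positivity
  have hT := sum_rooted_le hD (a := 1 / 2 ^ D) (by positivity)
    (by rw [one_div, inv_mul_cancel₀ (by positivity)]) I S
  have hT' : ∑ C ∈ I.powerset.filter (Rooted nb S), (1 / 2 ^ D : ℝ) ^ C.card ≤ 2 ^ S.card :=
    hT.trans (pow_le_pow_right₀ (by norm_num) (Finset.card_le_card Finset.inter_subset_left))
  refine (Finset.abs_sum_le_sum_abs _ _).trans ((Finset.sum_le_sum hterm).trans ?_)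
  rw [← Finset.mul_sum]
  refine (mul_le_mul_of_nonneg_left hT' (by positivity)).trans_eq ?_
  rw [show (8 : ℝ) = 4 * 2 by norm_num, mul_pow]
  ring

end Polymer
/-! ### Spin flips and sums over configurations -/

@[simp] theorem flip_self (x : Site) (σ : Config) : flip x σ x = -σ x := by simp [flip]

theorem flip_of_ne {x y : Site} (h : y ≠ x) (σ : Config) : flip x σ y = σ y := by simp [flip, h]

@[simp] theorem flip_flip (x : Site) (σ : Config) : flip x (flip x σ) = σ := by
  funext y
  by_cases h : y = x
  · subst h; simp
  · simp [flip_of_ne h]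

theorem flip_comm (x y : Site) (σ : Config) : flip x (flip y σ) = flip y (flip x σ) := by
  by_cases hxy : x = y
  · rw [hxy]
  funext z
  by_cases hx : z = x
  · subst hx; simp [flip_of_ne hxy]
  · by_cases hy : z = y
    · subst hy; simp [flip_of_ne hx]
    · simp [flip_of_ne hx, flip_of_ne hy]

theorem mem_plaquette {P : Finset Site} {x z : Site} : x ∈ plaquette P z ↔ x - z ∈ P := by
  simp only [plaquette, Finset.mem_image]
  constructor
  · rintro ⟨b, hb, rfl⟩
    simpa using hb
  · intro h
    exact ⟨_, h, by simp⟩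

theorem mem_basePoints {P Λ : Finset Site} {z : Site} :
    z ∈ basePoints P Λ ↔ ∃ x ∈ Λ, x ∈ plaquette P z := by
  simp only [basePoints, Finset.mem_image, Finset.mem_product, mem_plaquette]
  constructor
  · rintro ⟨⟨x, b⟩, ⟨hx, hb⟩, rfl⟩
    exact ⟨x, hx, by simpa using hb⟩
  · rintro ⟨x, hx, h⟩
    exact ⟨(x, x - z), ⟨hx, h⟩, by simp⟩

theorem basePoints_mono {P Λ Λ' : Finset Site} (h : Λ ⊆ Λ') :
    basePoints P Λ ⊆ basePoints P Λ' := fun z hz => by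
  obtain ⟨x, hx, h'⟩ := mem_basePoints.1 hz
  exact mem_basePoints.2 ⟨x, h hx, h'⟩

theorem mem_basePoints_singleton {P : Finset Site} {x z : Site} :
    z ∈ basePoints P {x} ↔ x ∈ plaquette P z := by
  simp [mem_basePoints]

theorem spinProd_flip (x : Site) (σ : Config) (V : Finset Site) :
    spinProd (flip x σ) V = if x ∈ V then -spinProd σ V else spinProd σ V := by
  unfold spinProd
  split_ifs with h
  · rw [← Finset.mul_prod_erase _ _ h, ← Finset.mul_prod_erase _ _ h, flip_self]
    rw [Finset.prod_congr rfl fun y hy => by rw [flip_of_ne (Finset.ne_of_mem_erase hy)]]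
    push_cast
    ring
  · exact Finset.prod_congr rfl fun y hy => by
      have hyx : y ≠ x := fun h' => h (h' ▸ hy)
      rw [flip_of_ne hyx]

theorem spinProd_congr {σ τ : Config} {V : Finset Site} (h : ∀ x ∈ V, σ x = τ x) :
    spinProd σ V = spinProd τ V :=
  Finset.prod_congr rfl fun x hx => by rw [h x hx]

theorem spinProd_eq_or (σ : Config) (V : Finset Site) : spinProd σ V = 1 ∨ spinProd σ V = -1 := by
  unfold spinProd
  induction V using Finset.induction_on with
  | empty => simp
  | insert a s ha ih =>
    rw [Finset.prod_insert ha]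
    rcases Int.units_eq_one_or (σ a) with h | h <;> rcases ih with h' | h' <;> rw [h, h'] <;> simp

theorem abs_spinProd (σ : Config) (V : Finset Site) : |spinProd σ V| = 1 := by
  rcases spinProd_eq_or σ V with h | h <;> simp [h]

/-- The oscillation of `f` over configurations which agree outside `Λ` is at most the sum of its
oscillations under single spin flips. -/
theorem abs_sub_le_sum_flip {f : Config → ℝ} {Λ : Finset Site} {c : Site → ℝ} {Q : Config → Prop}
    (hQ : ∀ x ∈ Λ, ∀ σ, Q σ → Q (flip x σ))
    (h : ∀ x ∈ Λ, ∀ σ, Q σ → |f (flip x σ) - f σ| ≤ c x) (σ τ : Config) (hσ : Q σ)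
    (hστ : ∀ x, x ∉ Λ → σ x = τ x) : |f σ - f τ| ≤ ∑ x ∈ Λ, c x := by
  induction Λ using Finset.induction_on generalizing σ with
  | empty =>
    have : σ = τ := funext fun x => hστ x (by simp)
    simp [this]
  | insert a s ha ih =>
    have hc : 0 ≤ c a := (abs_nonneg _).trans (h a (by simp) σ hσ)
    have hQ' : ∀ x ∈ s, ∀ σ, Q σ → Q (flip x σ) := fun x hx => hQ x (by simp [hx])
    have h' : ∀ x ∈ s, ∀ σ, Q σ → |f (flip x σ) - f σ| ≤ c x := fun x hx => h x (by simp [hx])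
    rw [Finset.sum_insert ha]
    by_cases hat : σ a = τ a
    · have := ih hQ' h' σ hσ fun x hx => by
        by_cases hxa : x = a
        · rw [hxa, hat]
        · exact hστ x (by simp [hx, hxa])
      linarith
    · have h1 := ih hQ' h' (flip a σ) (hQ a (by simp) σ hσ) fun x hx => by
        by_cases hxa : x = a
        · subst hxa
          rw [flip_self, Int.units_ne_iff_eq_neg.mp hat, neg_neg]
        · rw [flip_of_ne hxa]
          exact hστ x (by simp [hx, hxa])
      have h2 := h a (by simp) σ hσ
      have h3 := abs_sub_le (f σ) (f (flip a σ)) (f τ)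
      rw [abs_sub_comm (f σ) (f (flip a σ))] at h3
      linarith

theorem eq_of_flip_invariant {f : Config → ℝ} {Λ : Finset Site}
    (h : ∀ x ∈ Λ, ∀ σ, f (flip x σ) = f σ) {σ τ : Config} (hστ : ∀ x, x ∉ Λ → σ x = τ x) :
    f σ = f τ := by
  have := abs_sub_le_sum_flip (f := f) (Λ := Λ) (c := fun _ => 0) (Q := fun _ => True)
    (fun _ _ _ _ => trivial) (fun x hx σ _ => by simp [h x hx σ]) σ τ trivial hστ
  simp only [Finset.sum_const_zero] at this
  exact sub_eq_zero.1 (abs_nonpos_iff.1 this)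

theorem glue_of_notMem {Λ : Finset Site} {x : Site} (h : x ∉ Λ) (τ : Config) (η : Λ → ℤˣ) :
    glue Λ τ η x = τ x := by simp [glue, h]

theorem glue_of_mem {Λ : Finset Site} {x : Site} (h : x ∈ Λ) (τ : Config) (η : Λ → ℤˣ) :
    glue Λ τ η x = η ⟨x, h⟩ := by simp [glue, h]

/-- The sum of `F` over all configurations which agree with `τ` outside `Λ`. -/
noncomputable def cfgSum (Λ : Finset Site) (τ : Config) (F : Config → ℝ) : ℝ :=
  ∑ η : Λ → ℤˣ, F (glue Λ τ η)

theorem cfgSum_flip {Λ : Finset Site} {x : Site} (hx : x ∈ Λ) (τ : Config) (F : Config → ℝ) :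
    cfgSum Λ τ (fun σ => F (flip x σ)) = cfgSum Λ τ F := by
  let e : (Λ → ℤˣ) → (Λ → ℤˣ) := fun η => Function.update η ⟨x, hx⟩ (-η ⟨x, hx⟩)
  have he : Function.Involutive e := fun η => by
    funext y
    by_cases hy : y = ⟨x, hx⟩
    · subst hy; simp [e]
    · simp [e, hy]
  refine Fintype.sum_equiv he.toPerm _ _ fun η => congrArg F ?_
  funext y
  by_cases hyx : y = x
  · subst hyx
    simp [glue_of_mem hx, e]
  · by_cases hy : y ∈ Λ
    · rw [flip_of_ne hyx, glue_of_mem hy, glue_of_mem hy]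
      have : (⟨y, hy⟩ : Λ) ≠ ⟨x, hx⟩ := fun h => hyx (congrArg Subtype.val h)
      simp [e, this]
    · rw [flip_of_ne hyx, glue_of_notMem hy, glue_of_notMem hy]

/-! ### The high-temperature expansion -/

/-- `∏_{z ∈ A} t [σ]_{P + z}`. -/
def plaqWeight (P : Finset Site) (t : ℝ) (σ : Config) (A : Finset Site) : ℝ :=
  ∏ z ∈ A, t * spinProd σ (plaquette P z)

/-- The sites of `Λ` are all covered an even number of times by the plaquettes with base points
in `A`. -/
def EvenOn (P Λ A : Finset Site) : Prop :=
  ∀ x ∈ Λ, Even (A.filter fun z => x ∈ plaquette P z).card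

open Classical in
/-- The sets of plaquettes which cover every site of `Λ` an even number of times; they index the
high-temperature expansion in `Λ`. -/
noncomputable def evenSets (P Λ : Finset Site) : Finset (Finset Site) :=
  (basePoints P Λ).powerset.filter (EvenOn P Λ)

theorem mem_evenSets {P Λ A : Finset Site} :
    A ∈ evenSets P Λ ↔ A ⊆ basePoints P Λ ∧ EvenOn P Λ A := by
  classical
  simp [evenSets]

theorem plaqWeight_flip (P : Finset Site) (t : ℝ) (σ : Config) (A : Finset Site) (x : Site) :
    plaqWeight P t (flip x σ) A =
      (-1) ^ (A.filter fun z => x ∈ plaquette P z).card * plaqWeight P t σ A := by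
  unfold plaqWeight
  rw [← Finset.prod_const, Finset.prod_filter, ← Finset.prod_mul_distrib]
  refine Finset.prod_congr rfl fun z _ => ?_
  rw [spinProd_flip]
  split_ifs <;> ring

theorem abs_plaqWeight {P : Finset Site} {t : ℝ} (ht : 0 ≤ t) (σ : Config) (A : Finset Site) :
    |plaqWeight P t σ A| = t ^ A.card := by
  unfold plaqWeight
  rw [Finset.abs_prod, Finset.prod_congr rfl fun z _ => by rw [abs_mul, abs_spinProd, mul_one],
    Finset.prod_const, abs_of_nonneg ht]

open Classical in
theorem cfgSum_plaqWeight (P Λ : Finset Site) (t : ℝ) (τ : Config) (A : Finset Site) :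
    cfgSum Λ τ (fun σ => plaqWeight P t σ A) =
      if EvenOn P Λ A then 2 ^ Λ.card * plaqWeight P t τ A else 0 := by
  split_ifs with h
  · have : ∀ η : Λ → ℤˣ, plaqWeight P t (glue Λ τ η) A = plaqWeight P t τ A := fun η =>
      eq_of_flip_invariant (Λ := Λ) (f := fun σ => plaqWeight P t σ A)
        (fun x hx σ => by rw [plaqWeight_flip, (h x hx).neg_one_pow, one_mul])
        (fun x hx => glue_of_notMem hx τ η)
    unfold cfgSum
    rw [Finset.sum_congr rfl fun η _ => this η, Finset.sum_const, nsmul_eq_mul]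
    simp [Finset.card_univ, Fintype.card_units_int]
  · unfold EvenOn at h
    push Not at h
    obtain ⟨x, hx, hodd⟩ := h
    have h1 := cfgSum_flip hx τ (fun σ => plaqWeight P t σ A)
    have h2 : cfgSum Λ τ (fun σ => plaqWeight P t (flip x σ) A) =
        -cfgSum Λ τ (fun σ => plaqWeight P t σ A) := by
      unfold cfgSum
      rw [← Finset.sum_neg_distrib]
      refine Finset.sum_congr rfl fun η _ => ?_
      simp only [plaqWeight_flip, (Nat.not_even_iff_odd.1 hodd).neg_one_pow]
      ring
    linarith

open Classical in
/-- Expansion of the plaquettes in `G`, with the plaquettes in `c` as observable. -/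
theorem cfgSum_prod_mul_plaqWeight (P Λ : Finset Site) (t : ℝ) (τ : Config) (G c : Finset Site)
    (hGc : Disjoint G c) :
    cfgSum Λ τ (fun σ => (∏ z ∈ G, (1 + t * spinProd σ (plaquette P z))) * plaqWeight P t σ c) =
      2 ^ Λ.card * ∑ A ∈ G.powerset.filter (fun A => EvenOn P Λ (A ∪ c)),
        plaqWeight P t τ (A ∪ c) := by
  have h1 : ∀ σ, (∏ z ∈ G, (1 + t * spinProd σ (plaquette P z))) * plaqWeight P t σ c =
      ∑ A ∈ G.powerset, plaqWeight P t σ (A ∪ c) := by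
    intro σ
    rw [Finset.prod_one_add, Finset.sum_mul]
    refine Finset.sum_congr rfl fun A hA => ?_
    rw [Finset.mem_powerset] at hA
    exact (Finset.prod_union (hGc.mono_left hA)).symm
  have h2 : cfgSum Λ τ (fun σ => (∏ z ∈ G, (1 + t * spinProd σ (plaquette P z))) *
      plaqWeight P t σ c) = ∑ A ∈ G.powerset, cfgSum Λ τ (fun σ => plaqWeight P t σ (A ∪ c)) := by
    unfold cfgSum
    rw [Finset.sum_comm]
    exact Finset.sum_congr rfl fun η _ => h1 _
  rw [h2, Finset.sum_filter, Finset.mul_sum]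
  refine Finset.sum_congr rfl fun A _ => ?_
  rw [cfgSum_plaqWeight]
  split_ifs <;> simp

open Classical in
/-- The partial sum of the high-temperature expansion over the sets whose part outside `F`
is `c`. -/
noncomputable def fiberSum (P Λ : Finset Site) (t : ℝ) (τ : Config) (F : Set Site)
    (c : Finset Site) : ℝ :=
  ∑ A ∈ (evenSets P Λ).filter (fun A => A.filter (fun z => z ∉ F) = c), plaqWeight P t τ A

open Classical in
/-- The partial sums are partition functions which retain the plaquettes in `F` only, with the
plaquettes in `c` as observable. -/
theorem cfgSum_eq_fiberSum {P Λ : Finset Site} (t : ℝ) (τ : Config) (F : Set Site)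
    {c : Finset Site} (hc : c ⊆ basePoints P Λ) (hcF : ∀ z ∈ c, z ∉ F) :
    cfgSum Λ τ (fun σ => (∏ z ∈ (basePoints P Λ).filter (· ∈ F),
      (1 + t * spinProd σ (plaquette P z))) * plaqWeight P t σ c) =
      2 ^ Λ.card * fiberSum P Λ t τ F c := by
  have hd : Disjoint ((basePoints P Λ).filter (· ∈ F)) c :=
    Finset.disjoint_left.2 fun z hz hzc => hcF z hzc (Finset.mem_filter.1 hz).2
  rw [cfgSum_prod_mul_plaqWeight _ _ _ _ _ _ hd]
  congr 1
  refine Finset.sum_bij' (fun A _ => A ∪ c) (fun A _ => A.filter (· ∈ F)) ?_ ?_ ?_ ?_ ?_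
  · intro A hA
    simp only [Finset.mem_filter, Finset.mem_powerset] at hA
    rw [Finset.mem_filter, mem_evenSets]
    refine ⟨⟨Finset.union_subset (hA.1.trans (Finset.filter_subset _ _)) hc, hA.2⟩, ?_⟩
    ext z
    simp only [Finset.mem_filter, Finset.mem_union]
    constructor
    · rintro ⟨h | h, hz⟩
      · exact absurd (Finset.mem_filter.1 (hA.1 h)).2 hz
      · exact h
    · intro h
      exact ⟨Or.inr h, hcF z h⟩
  · intro A hA
    rw [Finset.mem_filter, mem_evenSets] at hA
    simp only [Finset.mem_filter, Finset.mem_powerset]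
    refine ⟨fun z hz => ?_, ?_⟩
    · rw [Finset.mem_filter] at hz ⊢
      exact ⟨hA.1.1 hz.1, hz.2⟩
    · rw [← hA.2, Finset.filter_union_filter_not_eq]
      exact hA.1.2
  · intro A hA
    simp only [Finset.mem_filter, Finset.mem_powerset] at hA
    ext z
    simp only [Finset.mem_filter, Finset.mem_union]
    constructor
    · rintro ⟨h | h, hz⟩
      · exact h
      · exact absurd hz (hcF z h)
    · intro h
      exact ⟨Or.inl h, (Finset.mem_filter.1 (hA.1 h)).2⟩
  · intro A hA
    rw [Finset.mem_filter] at hA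
    rw [← hA.2, Finset.filter_union_filter_not_eq]
  · intro A _
    rfl

theorem one_add_mul_spinProd_pos {t : ℝ} (ht0 : 0 ≤ t) (ht1 : t < 1) (σ : Config)
    (V : Finset Site) : 0 < 1 + t * spinProd σ V := by
  rcases spinProd_eq_or σ V with h | h <;> rw [h] <;> linarith

theorem fiberSum_empty_pos {P Λ : Finset Site} {t : ℝ} (ht0 : 0 ≤ t) (ht1 : t < 1) (τ : Config)
    (F : Set Site) : 0 < fiberSum P Λ t τ F ∅ := by
  classical
  have h := cfgSum_eq_fiberSum (P := P) (Λ := Λ) t τ F (Finset.empty_subset _) (by simp)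
  have : 0 < cfgSum Λ τ (fun σ => (∏ z ∈ (basePoints P Λ).filter (· ∈ F),
      (1 + t * spinProd σ (plaquette P z))) * plaqWeight P t σ ∅) := by
    refine Finset.sum_pos (fun η _ => ?_) ⟨fun _ => 1, Finset.mem_univ _⟩
    simp only [plaqWeight, Finset.prod_empty, mul_one]
    exact Finset.prod_pos fun z _ => one_add_mul_spinProd_pos ht0 ht1 _ _
  rw [h] at this
  exact pos_of_mul_pos_right this (by positivity)

/-- Up to the factor `t ^ |c|`, the ratio `fiberSum c / fiberSum ∅` is an expectation of a
product of spins in the model which retains the plaquettes in `F` only. -/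
theorem abs_fiberSum_le {P Λ : Finset Site} {t : ℝ} (ht0 : 0 ≤ t) (ht1 : t < 1) (τ : Config)
    (F : Set Site) {c : Finset Site} (hc : c ⊆ basePoints P Λ) (hcF : ∀ z ∈ c, z ∉ F) :
    |fiberSum P Λ t τ F c| ≤ t ^ c.card * fiberSum P Λ t τ F ∅ := by
  classical
  have h := cfgSum_eq_fiberSum t τ F hc hcF
  have h0 := cfgSum_eq_fiberSum (P := P) (Λ := Λ) t τ F (Finset.empty_subset _) (by simp)
  have h2 : (0 : ℝ) < 2 ^ Λ.card := by positivity
  have h1 : |2 ^ Λ.card * fiberSum P Λ t τ F c| ≤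
      t ^ c.card * (2 ^ Λ.card * fiberSum P Λ t τ F ∅) := by
    rw [← h, ← h0]
    unfold cfgSum
    rw [Finset.mul_sum]
    refine (Finset.abs_sum_le_sum_abs _ _).trans (Finset.sum_le_sum fun η _ => ?_)
    have hp : 0 < ∏ z ∈ (basePoints P Λ).filter (· ∈ F),
        (1 + t * spinProd (glue Λ τ η) (plaquette P z)) :=
      Finset.prod_pos fun z _ => one_add_mul_spinProd_pos ht0 ht1 _ _
    rw [abs_mul, abs_plaqWeight ht0, abs_of_pos hp]
    simp only [plaqWeight, Finset.prod_empty, mul_one]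
    rw [mul_comm]
  rw [abs_mul, abs_of_pos h2] at h1
  nlinarith

/-- The high-temperature parameter `t = tanh (β / 2)`. -/
noncomputable def htParam (β : ℝ) : ℝ := Real.tanh (β / 2)

theorem exp_mul_spinProd (β : ℝ) (σ : Config) (V : Finset Site) :
    Real.exp (β / 2 * spinProd σ V) = Real.cosh (β / 2) * (1 + htParam β * spinProd σ V) := by
  have hc : Real.cosh (β / 2) ≠ 0 := (Real.cosh_pos _).ne'
  have e1 := Real.cosh_add_sinh (β / 2)
  have e2 := Real.cosh_sub_sinh (β / 2)
  unfold htParam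
  rw [Real.tanh_eq_sinh_div_cosh]
  rcases spinProd_eq_or σ V with h | h <;> rw [h]
  · rw [mul_one, ← e1]; field_simp
  · rw [mul_neg_one, ← e2]; field_simp; ring

/-- The high-temperature expansion of the partition function. -/
theorem partitionFn_eq (P : Finset Site) (β : ℝ) (Λ : Finset Site) (τ : Config) :
    partitionFn P β Λ τ = Real.cosh (β / 2) ^ (basePoints P Λ).card * 2 ^ Λ.card *
      ∑ A ∈ evenSets P Λ, plaqWeight P (htParam β) τ A := by
  classical
  have h := cfgSum_prod_mul_plaqWeight P Λ (htParam β) τ (basePoints P Λ) ∅ (by simp)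
  simp only [plaqWeight, Finset.prod_empty, mul_one, Finset.union_empty] at h
  have h1 : partitionFn P β Λ τ = Real.cosh (β / 2) ^ (basePoints P Λ).card *
      cfgSum Λ τ (fun σ => ∏ z ∈ basePoints P Λ,
        (1 + htParam β * spinProd σ (plaquette P z))) := by
    unfold partitionFn cfgSum boltzmann
    rw [Finset.mul_sum]
    refine Finset.sum_congr rfl fun η _ => ?_
    rw [Finset.mul_sum, Real.exp_sum, ← Finset.prod_const, ← Finset.prod_mul_distrib]
    exact Finset.prod_congr rfl fun z _ => exp_mul_spinProd _ _ _
  rw [h1, h, mul_assoc]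
  rfl

theorem htParam_pos {β : ℝ} (hβ : 0 < β) : 0 < htParam β := by
  unfold htParam
  rw [Real.tanh_eq_sinh_div_cosh]
  exact div_pos (Real.sinh_pos_iff.2 (by linarith)) (Real.cosh_pos _)

/-- Combines `tanh (β / 2) ≤ 1 - e^{-β}` with `1 - u ≤ e^{-u}`. -/
theorem htParam_le {β : ℝ} (hβ : 0 < β) : htParam β ≤ Real.exp (-Real.exp (-β)) := by
  unfold htParam
  have h1 : Real.tanh (β / 2) ≤ 1 - Real.exp (-β) := by
    rw [Real.tanh_eq_sinh_div_cosh, div_le_iff₀ (Real.cosh_pos _), Real.sinh_eq, Real.cosh_eq]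
    have e : Real.exp (-β) = Real.exp (-(β / 2)) * Real.exp (-(β / 2)) := by
      rw [← Real.exp_add]; ring_nf
    have e2 : Real.exp (-(β / 2)) * Real.exp (β / 2) = 1 := by
      rw [← Real.exp_add]; simp
    have h3 := Real.exp_pos (-(β / 2))
    have h5 : Real.exp (-(β / 2)) ≤ 1 := Real.exp_le_one_iff.2 (by linarith)
    rw [e]
    generalize Real.exp (-(β / 2)) = a at *
    generalize Real.exp (β / 2) = b at *
    have : a * a * b = a := by rw [mul_assoc, e2, mul_one]
    have h4 : a * a * a ≤ a := by nlinarith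
    nlinarith
  have h2 := Real.add_one_le_exp (-Real.exp (-β))
  linarith

theorem htParam_lt_one (β : ℝ) : htParam β < 1 := Real.tanh_lt_one _

/-! ### Decomposition of the expansion into blocks -/

/-- The blocks at sup-distance at most `2` of the block `i`. -/
noncomputable def nearBlocks (i : Site) : Finset Site :=
  Finset.Icc (i.1 - 2) (i.1 + 2) ×ˢ Finset.Icc (i.2 - 2) (i.2 + 2)

theorem mem_nearBlocks {i k : Site} :
    k ∈ nearBlocks i ↔ (i.1 - 2 ≤ k.1 ∧ k.1 ≤ i.1 + 2) ∧ i.2 - 2 ≤ k.2 ∧ k.2 ≤ i.2 + 2 := by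
  simp [nearBlocks]

theorem card_nearBlocks (i : Site) : (nearBlocks i).card ≤ 25 := by
  rw [nearBlocks, Finset.card_product, Int.card_Icc, Int.card_Icc]
  have : ∀ a : ℤ, (a + 2 + 1 - (a - 2)).toNat = 5 := fun a => by
    have : a + 2 + 1 - (a - 2) = 5 := by ring
    rw [this]; rfl
  rw [this, this]

theorem Reach.near {C : Finset Site} {s b : Site} (h : Reach nearBlocks C s b) :
    |s.1 - b.1| ≤ 2 * (C.card : ℤ) ∧ |s.2 - b.2| ≤ 2 * (C.card : ℤ) := by
  induction C using Finset.strongInduction generalizing s with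
  | H C ih =>
    rcases h.erase (s := s) with rfl | ⟨s', h1, h2, h3⟩
    · simp
    · obtain ⟨i1, i2⟩ := ih _ (Finset.erase_ssubset h.1) h3
      have hc := Finset.card_erase_add_one h.1
      have h4 := mem_nearBlocks.1 (h1.resolve_left h2)
      rw [abs_le] at *
      rw [abs_le] at *
      omega

theorem mem_block {ℓ : ℕ} {i x : Site} : x ∈ block ℓ i ↔
    ((ℓ : ℤ) * i.1 + 1 ≤ x.1 ∧ x.1 ≤ ℓ * i.1 + ℓ) ∧
      ((ℓ : ℤ) * i.2 + 1 ≤ x.2 ∧ x.2 ≤ ℓ * i.2 + ℓ) := by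
  simp [block]

/-- A system of sets `F j` of plaquettes, one for each block, which are summed exactly in the
high-temperature expansion because the parity constraints in the block do not determine them.
Plaquettes of `F j` only meet blocks near to `j`, and no site lies in plaquettes of two different
`F j`. As `P` has diameter one, a plaquette meets at most four blocks. -/
structure CornerSystem (P : Finset Site) (ℓ : ℕ) (F : Site → Set Site) : Prop where
  one_le : 1 ≤ ℓ
  subset_box : ∀ b ∈ P, (0 ≤ b.1 ∧ b.1 ≤ 1) ∧ 0 ≤ b.2 ∧ b.2 ≤ 1
  near : ∀ j k z, z ∈ F j → z ∈ basePoints P (block ℓ k) →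
    (j.1 - 1 ≤ k.1 ∧ k.1 ≤ j.1 + 1) ∧ j.2 - 1 ≤ k.2 ∧ k.2 ≤ j.2 + 1
  separated : ∀ x z z' j j', x ∈ plaquette P z → x ∈ plaquette P z' → z ∈ F j → z' ∈ F j' → j = j'

/-- The union of the blocks with index in `I`. -/
noncomputable def blockUnion (ℓ : ℕ) (I : Finset Site) : Finset Site := I.biUnion (block ℓ)

theorem mem_blockUnion {ℓ : ℕ} {I : Finset Site} {x : Site} :
    x ∈ blockUnion ℓ I ↔ ∃ i ∈ I, x ∈ block ℓ i := by simp [blockUnion]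

theorem mem_basePoints_blockUnion {P : Finset Site} {ℓ : ℕ} {I : Finset Site} {z : Site} :
    z ∈ basePoints P (blockUnion ℓ I) ↔ ∃ i ∈ I, z ∈ basePoints P (block ℓ i) := by
  simp only [mem_basePoints, mem_blockUnion]
  constructor
  · rintro ⟨x, ⟨i, hi, hx⟩, h⟩
    exact ⟨i, hi, x, hx, h⟩
  · rintro ⟨i, hi, x, hx, h⟩
    exact ⟨x, ⟨i, hi, hx⟩, h⟩

open Classical in
/-- The blocks of `I` which are touched by the part of `A` outside the corners. -/
noncomputable def touched (P : Finset Site) (ℓ : ℕ) (F : Site → Set Site) (I A : Finset Site) :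
    Finset Site :=
  I.filter fun i => ∃ z ∈ A, z ∉ ⋃ j, F j ∧ z ∈ basePoints P (block ℓ i)

theorem mem_touched {P : Finset Site} {ℓ : ℕ} {F : Site → Set Site} {I A : Finset Site}
    {i : Site} : i ∈ touched P ℓ F I A ↔
      i ∈ I ∧ ∃ z ∈ A, z ∉ ⋃ j, F j ∧ z ∈ basePoints P (block ℓ i) := by
  classical
  simp [touched]

theorem touched_subset {P : Finset Site} {ℓ : ℕ} {F : Site → Set Site} {I A : Finset Site} :
    touched P ℓ F I A ⊆ I := fun _ h => (mem_touched.1 h).1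

open Classical in
/-- The sum of the weights `∏_{z ∈ A} u z` over the sets `A` of the high-temperature expansion which
touch exactly the blocks in `X`. -/
noncomputable def blockSum (P : Finset Site) (ℓ : ℕ) (F : Site → Set Site) (I : Finset Site)
    (u : Site → ℝ) (X : Finset Site) : ℝ :=
  ∑ A ∈ (evenSets P (blockUnion ℓ I)).filter (fun A => touched P ℓ F I A = X), ∏ z ∈ A, u z

open Classical in
/-- The set which equals `A` in `R` and `B` outside `R`. -/
noncomputable def splice (R : Set Site) (A B : Finset Site) : Finset Site :=
  A.filter (· ∈ R) ∪ B.filter (· ∉ R)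

theorem mem_splice {R : Set Site} {A B : Finset Site} {z : Site} :
    z ∈ splice R A B ↔ (z ∈ A ∧ z ∈ R) ∨ (z ∈ B ∧ z ∉ R) := by
  classical
  simp [splice]

theorem splice_splice (R : Set Site) (A B : Finset Site) :
    splice R (splice R A B) (splice R B A) = A := by
  ext z
  simp only [mem_splice]
  tauto

section Swap

variable {P : Finset Site} {ℓ : ℕ} {F : Site → Set Site}

/-- The plaquettes of the blocks in `S` and of the corners in `J`. -/
def region (P : Finset Site) (ℓ : ℕ) (F : Site → Set Site) (S J : Set Site) : Set Site :=
  {z | (∃ i ∈ S, z ∈ basePoints P (block ℓ i)) ∨ ∃ j ∈ J, z ∈ F j}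

theorem splice_mem_evenSets (hF : CornerSystem P ℓ F) {I : Finset Site} {S J : Set Site}
    (h1 : ∀ i ∈ S, ∀ j, ∀ z ∈ F j, z ∈ basePoints P (block ℓ i) → j ∈ J) {X Y A B : Finset Site}
    (h2 : ∀ k ∈ X ∪ Y, k ∉ S → ∀ z ∈ basePoints P (block ℓ k), z ∉ region P ℓ F S J)
    (hA : A ∈ evenSets P (blockUnion ℓ I)) (hB : B ∈ evenSets P (blockUnion ℓ I))
    (hAX : touched P ℓ F I A = X) (hBY : touched P ℓ F I B = Y) :
    splice (region P ℓ F S J) A B ∈ evenSets P (blockUnion ℓ I) := by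
  classical
  set R := region P ℓ F S J with hR
  rw [mem_evenSets] at hA hB ⊢
  refine ⟨fun z hz => ?_, fun x hx => ?_⟩
  · rcases mem_splice.1 hz with h | h
    · exact hA.1 h.1
    · exact hB.1 h.1
  have key : (∀ z ∈ A ∪ B, x ∈ plaquette P z → z ∈ R) ∨
      (∀ z ∈ A ∪ B, x ∈ plaquette P z → z ∉ R) := by
    obtain ⟨k, hkI, hxk⟩ := mem_blockUnion.1 hx
    have hzk : ∀ z, x ∈ plaquette P z → z ∈ basePoints P (block ℓ k) := fun z hz =>
      mem_basePoints.2 ⟨x, hxk, hz⟩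
    by_cases hkS : k ∈ S
    · exact Or.inl fun z _ hz => Or.inl ⟨k, hkS, hzk z hz⟩
    by_cases hkX : k ∈ X ∪ Y
    · exact Or.inr fun z _ hz => h2 k hkX hkS z (hzk z hz)
    -- only corner plaquettes meet `x`, and they belong to a single corner
    have hcorner : ∀ z ∈ A ∪ B, x ∈ plaquette P z → ∃ j, z ∈ F j := by
      intro z hz hxz
      by_contra hno
      have hno' : z ∉ ⋃ j, F j := by simpa using hno
      apply hkX
      rcases Finset.mem_union.1 hz with h | h
      · exact Finset.mem_union_left _ (hAX ▸ mem_touched.2 ⟨hkI, z, h, hno', hzk z hxz⟩)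
      · exact Finset.mem_union_right _ (hBY ▸ mem_touched.2 ⟨hkI, z, h, hno', hzk z hxz⟩)
    by_cases hex : ∃ z ∈ A ∪ B, x ∈ plaquette P z ∧ z ∈ R
    · obtain ⟨z₀, hz₀, hxz₀, hzR⟩ := hex
      obtain ⟨j₀, hj₀⟩ := hcorner z₀ hz₀ hxz₀
      have hjJ : j₀ ∈ J := by
        rcases hzR with ⟨i, hi, hzi⟩ | ⟨j, hj, hzj⟩
        · exact h1 i hi j₀ z₀ hj₀ hzi
        · rwa [hF.separated x z₀ z₀ j₀ j hxz₀ hxz₀ hj₀ hzj]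
      refine Or.inl fun z hz hxz => ?_
      obtain ⟨j, hj⟩ := hcorner z hz hxz
      have : j = j₀ := hF.separated x z z₀ j j₀ hxz hxz₀ hj hj₀
      exact Or.inr ⟨j, this ▸ hjJ, hj⟩
    · push Not at hex
      exact Or.inr hex
  rcases key with h | h
  · have : (splice R A B).filter (fun z => x ∈ plaquette P z) =
        A.filter (fun z => x ∈ plaquette P z) := by
      ext z
      simp only [Finset.mem_filter, mem_splice]
      have := h z
      simp only [Finset.mem_union] at this
      tauto
    rw [this]
    exact hA.2 x hx
  · have : (splice R A B).filter (fun z => x ∈ plaquette P z) =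
        B.filter (fun z => x ∈ plaquette P z) := by
      ext z
      simp only [Finset.mem_filter, mem_splice]
      have := h z
      simp only [Finset.mem_union] at this
      tauto
    rw [this]
    exact hB.2 x hx

open Classical in
theorem touched_splice {I : Finset Site} {S J : Set Site} {X Y A B : Finset Site}
    (h2 : ∀ k ∈ X ∪ Y, k ∉ S → ∀ z ∈ basePoints P (block ℓ k), z ∉ region P ℓ F S J)
    (hAX : touched P ℓ F I A = X) (hBY : touched P ℓ F I B = Y) :
    touched P ℓ F I (splice (region P ℓ F S J) A B) =
      X.filter (· ∈ S) ∪ Y.filter (· ∉ S) := by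
  ext i
  simp only [Finset.mem_union, Finset.mem_filter]
  by_cases hiS : i ∈ S
  · simp only [hiS, and_true, not_true, and_false, or_false]
    rw [← hAX, mem_touched, mem_touched]
    refine and_congr_right fun _ => exists_congr fun z => ?_
    have : z ∈ basePoints P (block ℓ i) → z ∈ region P ℓ F S J := fun h => Or.inl ⟨i, hiS, h⟩
    rw [mem_splice]
    tauto
  · simp only [hiS, and_false, false_or, not_false_eq_true, and_true]
    by_cases hiX : i ∈ X ∪ Y
    · rw [← hBY, mem_touched, mem_touched]
      refine and_congr_right fun _ => exists_congr fun z => ?_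
      have := h2 i hiX hiS z
      rw [mem_splice]
      tauto
    · rw [Finset.mem_union, not_or] at hiX
      simp only [hiX.2, iff_false]
      rw [mem_touched]
      rintro ⟨hiI, z, hz, hzF, hzi⟩
      rcases mem_splice.1 hz with h | h
      · exact hiX.1 (hAX ▸ mem_touched.2 ⟨hiI, z, h.1, hzF, hzi⟩)
      · exact hiX.2 (hBY ▸ mem_touched.2 ⟨hiI, z, h.1, hzF, hzi⟩)

open Classical in
theorem prod_splice (R : Set Site) (u v : Site → ℝ) (A B : Finset Site) :
    (∏ z ∈ splice R A B, (if z ∈ R then u z else v z)) *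
      (∏ z ∈ splice R B A, (if z ∈ R then v z else u z)) =
      (∏ z ∈ A, u z) * ∏ z ∈ B, v z := by
  have key : ∀ (u v : Site → ℝ) (A B : Finset Site),
      ∏ z ∈ splice R A B, (if z ∈ R then u z else v z) =
        (∏ z ∈ A.filter (· ∈ R), u z) * ∏ z ∈ B.filter (· ∉ R), v z := by
    intro u v A B
    have hd : Disjoint (A.filter (· ∈ R)) (B.filter (· ∉ R)) :=
      Finset.disjoint_left.2 fun z hz hz' =>
        (Finset.mem_filter.1 hz').2 (Finset.mem_filter.1 hz).2
    rw [splice, Finset.prod_union hd]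
    congr 1
    · exact Finset.prod_congr rfl fun z hz => if_pos (Finset.mem_filter.1 hz).2
    · exact Finset.prod_congr rfl fun z hz => if_neg (Finset.mem_filter.1 hz).2
  rw [key, key, ← Finset.prod_filter_mul_prod_filter_not A (· ∈ R) u,
    ← Finset.prod_filter_mul_prod_filter_not B (· ∈ R) v]
  ring

open Classical in
/-- Two copies of the expansion can be exchanged in a region which is separated from the rest. -/
theorem blockSum_mul_blockSum (hF : CornerSystem P ℓ F) (I : Finset Site) {S J : Set Site}
    (h1 : ∀ i ∈ S, ∀ j, ∀ z ∈ F j, z ∈ basePoints P (block ℓ i) → j ∈ J) {X Y : Finset Site}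
    (h2 : ∀ k ∈ X ∪ Y, k ∉ S → ∀ z ∈ basePoints P (block ℓ k), z ∉ region P ℓ F S J)
    (u v : Site → ℝ) :
    blockSum P ℓ F I u X * blockSum P ℓ F I v Y =
      blockSum P ℓ F I (fun z => if z ∈ region P ℓ F S J then u z else v z)
          (X.filter (· ∈ S) ∪ Y.filter (· ∉ S)) *
        blockSum P ℓ F I (fun z => if z ∈ region P ℓ F S J then v z else u z)
          (Y.filter (· ∈ S) ∪ X.filter (· ∉ S)) := by
  set R := region P ℓ F S J with hR
  set X' := X.filter (· ∈ S) ∪ Y.filter (· ∉ S) with hX'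
  set Y' := Y.filter (· ∈ S) ∪ X.filter (· ∉ S) with hY'
  have hXX : X'.filter (· ∈ S) ∪ Y'.filter (· ∉ S) = X := by
    ext i; simp only [hX', hY', Finset.mem_union, Finset.mem_filter]; tauto
  have hYY : Y'.filter (· ∈ S) ∪ X'.filter (· ∉ S) = Y := by
    ext i; simp only [hX', hY', Finset.mem_union, Finset.mem_filter]; tauto
  have hXY : X' ∪ Y' = X ∪ Y := by
    ext i; simp only [hX', hY', Finset.mem_union, Finset.mem_filter]; tauto
  have h2' : ∀ k ∈ Y ∪ X, k ∉ S → ∀ z ∈ basePoints P (block ℓ k), z ∉ R := by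
    rw [Finset.union_comm]; exact h2
  have h2X : ∀ k ∈ X' ∪ Y', k ∉ S → ∀ z ∈ basePoints P (block ℓ k), z ∉ R := by
    rw [hXY]; exact h2
  have h2Y : ∀ k ∈ Y' ∪ X', k ∉ S → ∀ z ∈ basePoints P (block ℓ k), z ∉ R := by
    rw [Finset.union_comm, hXY]; exact h2
  unfold blockSum
  rw [Finset.sum_mul_sum, Finset.sum_mul_sum, ← Finset.sum_product', ← Finset.sum_product']
  refine Finset.sum_bij' (fun p _ => (splice R p.1 p.2, splice R p.2 p.1))
    (fun p _ => (splice R p.1 p.2, splice R p.2 p.1)) ?_ ?_ ?_ ?_ ?_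
  · rintro ⟨A, B⟩ h
    simp only [Finset.mem_product, Finset.mem_filter] at h ⊢
    obtain ⟨⟨hA, hAX⟩, hB, hBY⟩ := h
    exact ⟨⟨splice_mem_evenSets hF h1 h2 hA hB hAX hBY, touched_splice h2 hAX hBY⟩,
      splice_mem_evenSets hF h1 h2' hB hA hBY hAX, touched_splice h2' hBY hAX⟩
  · rintro ⟨A, B⟩ h
    simp only [Finset.mem_product, Finset.mem_filter] at h ⊢
    obtain ⟨⟨hA, hAX⟩, hB, hBY⟩ := h
    exact ⟨⟨splice_mem_evenSets hF h1 h2X hA hB hAX hBY, (touched_splice h2X hAX hBY).trans hXX⟩,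
      splice_mem_evenSets hF h1 h2Y hB hA hBY hAX, (touched_splice h2Y hBY hAX).trans hYY⟩
  · rintro ⟨A, B⟩ _
    simp only [splice_splice]
  · rintro ⟨A, B⟩ _
    simp only [splice_splice]
  · rintro ⟨A, B⟩ _
    exact (prod_splice R u v A B).symm

theorem blockSum_congr {I : Finset Site} {u v : Site → ℝ}
    (h : ∀ z ∈ basePoints P (blockUnion ℓ I), u z = v z) (X : Finset Site) :
    blockSum P ℓ F I u X = blockSum P ℓ F I v X := by
  classical
  refine Finset.sum_congr rfl fun A hA => Finset.prod_congr rfl fun z hz => h z ?_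
  exact (mem_evenSets.1 (Finset.mem_filter.1 hA).1).1 hz

theorem mem_corner_of_touched_eq_empty {I A : Finset Site}
    (hA : A ⊆ basePoints P (blockUnion ℓ I)) (h : touched P ℓ F I A = ∅) {z : Site} (hz : z ∈ A) :
    ∃ j, z ∈ F j := by
  by_contra hno
  obtain ⟨i, hi, hzi⟩ := mem_basePoints_blockUnion.1 (hA hz)
  have : i ∈ touched P ℓ F I A := mem_touched.2 ⟨hi, z, hz, by simpa using hno, hzi⟩
  simp [h] at this

theorem blockSum_empty_congr {I : Finset Site} {u v : Site → ℝ}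
    (h : ∀ j, ∀ z ∈ F j, u z = v z) :
    blockSum P ℓ F I u ∅ = blockSum P ℓ F I v ∅ := by
  classical
  refine Finset.sum_congr rfl fun A hA => Finset.prod_congr rfl fun z hz => ?_
  obtain ⟨h1, h2⟩ := Finset.mem_filter.1 hA
  obtain ⟨j, hj⟩ := mem_corner_of_touched_eq_empty (mem_evenSets.1 h1).1 h2 hz
  exact h j z hj

theorem block_coords (hF : CornerSystem P ℓ F) {i z : Site} (h : z ∈ basePoints P (block ℓ i)) :
    ((ℓ : ℤ) * i.1 ≤ z.1 ∧ z.1 ≤ ℓ * i.1 + ℓ) ∧ ((ℓ : ℤ) * i.2 ≤ z.2 ∧ z.2 ≤ ℓ * i.2 + ℓ) := by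
  obtain ⟨x, hx, hxz⟩ := mem_basePoints.1 h
  have h1 := hF.subset_box _ (mem_plaquette.1 hxz)
  have h2 := mem_block.1 hx
  simp only [Prod.fst_sub, Prod.snd_sub] at h1
  omega

theorem index_near {ℓ : ℕ} (hℓ : 1 ≤ ℓ) {a b c : ℤ} (h1 : (ℓ : ℤ) * a ≤ c) (h2 : c ≤ ℓ * a + ℓ)
    (h3 : (ℓ : ℤ) * b ≤ c) (h4 : c ≤ ℓ * b + ℓ) : a - 1 ≤ b ∧ b ≤ a + 1 := by
  have hℓ' : (0 : ℤ) < ℓ := by exact_mod_cast hℓ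
  constructor
  · have : (ℓ : ℤ) * a ≤ ℓ * (b + 1) := by linarith
    have := le_of_mul_le_mul_left this hℓ'
    omega
  · have : (ℓ : ℤ) * b ≤ ℓ * (a + 1) := by linarith
    have := le_of_mul_le_mul_left this hℓ'
    omega

theorem blocks_near (hF : CornerSystem P ℓ F) {i k z : Site} (hi : z ∈ basePoints P (block ℓ i))
    (hk : z ∈ basePoints P (block ℓ k)) :
    (i.1 - 1 ≤ k.1 ∧ k.1 ≤ i.1 + 1) ∧ i.2 - 1 ≤ k.2 ∧ k.2 ≤ i.2 + 1 := by
  have h1 := block_coords hF hi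
  have h2 := block_coords hF hk
  exact ⟨index_near hF.one_le h1.1.1 h1.1.2 h2.1.1 h2.1.2,
    index_near hF.one_le h1.2.1 h1.2.2 h2.2.1 h2.2.2⟩

/-- The corners which are near to one of the blocks in `S`. -/
def nearCorners (S : Set Site) : Set Site :=
  {j | ∃ i ∈ S, (j.1 - 1 ≤ i.1 ∧ i.1 ≤ j.1 + 1) ∧ j.2 - 1 ≤ i.2 ∧ i.2 ≤ j.2 + 1}

theorem region_far (hF : CornerSystem P ℓ F) {S : Set Site} {k : Site}
    (hk : ∀ i ∈ S, k ∉ nearBlocks i) {z : Site} (hz : z ∈ basePoints P (block ℓ k)) :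
    z ∉ region P ℓ F S (nearCorners S) := by
  rintro (⟨i, hi, h⟩ | ⟨j, ⟨i, hi, hij⟩, h⟩)
  · have := blocks_near hF h hz
    exact hk i hi (mem_nearBlocks.2 (by omega))
  · have := hF.near j k z h hz
    exact hk i hi (mem_nearBlocks.2 (by omega))

/-- The weights of the high-temperature expansion, normalised by the contribution of the
corners. -/
noncomputable def blockWeight (P : Finset Site) (ℓ : ℕ) (F : Site → Set Site) (I : Finset Site)
    (u : Site → ℝ) (X : Finset Site) : ℝ :=
  blockSum P ℓ F I u X / blockSum P ℓ F I u ∅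

theorem blockWeight_union (hF : CornerSystem P ℓ F) (I : Finset Site) {u : Site → ℝ}
    (hu : blockSum P ℓ F I u ∅ ≠ 0) {X Y : Finset Site}
    (hXY : ∀ a ∈ X, ∀ b ∈ Y, b ∉ nearBlocks a) :
    blockWeight P ℓ F I u (X ∪ Y) = blockWeight P ℓ F I u X * blockWeight P ℓ F I u Y := by
  classical
  have hdis : ∀ y ∈ Y, y ∉ X := fun y hy hyX =>
    hXY y hyX y hy (mem_nearBlocks.2 (by omega))
  obtain ⟨S, hS⟩ : ∃ S : Set Site, ∀ a, a ∈ S ↔ a ∈ X := ⟨{a | a ∈ X}, fun _ => Iff.rfl⟩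
  have h := blockSum_mul_blockSum hF I (S := S) (J := nearCorners S) (X := X) (Y := Y)
    (fun i hi j z hz hzi => ⟨i, hi, hF.near j i z hz hzi⟩)
    (fun k hk hkX z hz => region_far hF (fun i hi => hXY i ((hS i).1 hi) k
      ((Finset.mem_union.1 hk).resolve_left fun h => hkX ((hS k).2 h))) hz) u u
  simp only [ite_self] at h
  have e1 : X.filter (· ∈ S) ∪ Y.filter (· ∉ S) = X ∪ Y := by
    ext a
    have := hdis a
    simp only [Finset.mem_union, Finset.mem_filter, hS]
    tauto
  have e2 : Y.filter (· ∈ S) ∪ X.filter (· ∉ S) = ∅ := by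
    rw [Finset.eq_empty_iff_forall_notMem]
    intro a
    have := hdis a
    simp only [Finset.mem_union, Finset.mem_filter, hS]
    tauto
  rw [e1, e2] at h
  unfold blockWeight
  rw [div_mul_div_comm, h]
  field_simp

/-- A change of the plaquette weights near a site affects only the weights of sets of blocks
which come close to this site. -/
theorem blockWeight_local (hF : CornerSystem P ℓ F) (I : Finset Site) {u v : Site → ℝ}
    (hu : blockSum P ℓ F I u ∅ ≠ 0) (hv : blockSum P ℓ F I v ∅ ≠ 0) {S : Set Site}
    (huv : ∀ i, i ∉ S → ∀ z ∈ basePoints P (block ℓ i), u z = v z)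
    {X : Finset Site} (hX : ∀ k ∈ X, ∀ i ∈ S, k ∉ nearBlocks i) :
    blockWeight P ℓ F I u X = blockWeight P ℓ F I v X := by
  classical
  have h := blockSum_mul_blockSum hF I (S := S) (J := nearCorners S) (X := X) (Y := ∅)
    (fun i hi j z hz hzi => ⟨i, hi, hF.near j i z hz hzi⟩)
    (fun k hk _ z hz => region_far hF (hX k (by simpa using hk)) hz) u v
  have hXS : ∀ k ∈ X, k ∉ S := fun k hk hkS => hX k hk k hkS (mem_nearBlocks.2 (by omega))
  have e1 : X.filter (· ∈ S) ∪ (∅ : Finset Site).filter (· ∉ S) = ∅ := by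
    rw [Finset.eq_empty_iff_forall_notMem]
    intro a
    have := hXS a
    simp only [Finset.mem_union, Finset.mem_filter]
    simp
    tauto
  have e2 : (∅ : Finset Site).filter (· ∈ S) ∪ X.filter (· ∉ S) = X := by
    ext a
    have := hXS a
    simp only [Finset.mem_union, Finset.mem_filter]
    simp
    tauto
  rw [e1, e2] at h
  have hR : ∀ z ∈ basePoints P (blockUnion ℓ I), z ∉ region P ℓ F S (nearCorners S) →
      u z = v z := by
    intro z hz hzR
    obtain ⟨i, _, hzi⟩ := mem_basePoints_blockUnion.1 hz
    exact huv i (fun hiS => hzR (Or.inl ⟨i, hiS, hzi⟩)) z hzi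
  rw [blockSum_congr (u := fun z => if z ∈ region P ℓ F S (nearCorners S) then u z else v z)
      (v := u) (fun z hz => by split_ifs with hh; rfl; exact (hR z hz hh).symm),
    blockSum_congr (u := fun z => if z ∈ region P ℓ F S (nearCorners S) then v z else u z)
      (v := v) (fun z hz => by split_ifs with hh; rfl; exact hR z hz hh)] at h
  unfold blockWeight
  rw [div_eq_div_iff hu hv, h, mul_comm]

/-- The contribution of the corners factorises if no corner is close to both sites. -/
theorem blockSum_empty_mul (hF : CornerSystem P ℓ F) (I : Finset Site) {u₀₀ u₁₀ u₀₁ u₁₁ : Site → ℝ}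
    {A B : Set Site} (hA : ∀ z, z ∉ A → u₁₀ z = u₀₀ z ∧ u₁₁ z = u₀₁ z)
    (hB : ∀ z, z ∉ B → u₀₁ z = u₀₀ z ∧ u₁₁ z = u₁₀ z)
    (hAB : ∀ j, ∀ z ∈ F j, ∀ z' ∈ F j, z ∈ A → z' ∉ B) :
    blockSum P ℓ F I u₁₁ ∅ * blockSum P ℓ F I u₀₀ ∅ =
      blockSum P ℓ F I u₁₀ ∅ * blockSum P ℓ F I u₀₁ ∅ := by
  classical
  have h := blockSum_mul_blockSum hF I (S := ∅) (J := {j | ∃ z ∈ F j, z ∈ A}) (X := ∅) (Y := ∅)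
    (by simp) (by simp) u₁₁ u₀₀
  simp only [Finset.filter_empty, Finset.empty_union] at h
  have hR : ∀ j, ∀ z ∈ F j,
      (z ∈ region P ℓ F ∅ {j | ∃ z ∈ F j, z ∈ A} → z ∉ B) ∧
      (z ∉ region P ℓ F ∅ {j | ∃ z ∈ F j, z ∈ A} → z ∉ A) := by
    intro j z hz
    constructor
    · rintro (⟨i, hi, _⟩ | ⟨j', ⟨z', hz', hz'A⟩, hzj'⟩)
      · exact absurd hi (Set.notMem_empty i)
      · exact hAB j' z' hz' z hzj' hz'A
    · intro hzR hzA
      exact hzR (Or.inr ⟨j, ⟨z, hz, hzA⟩, hz⟩)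
  rw [h]
  congr 1
  · refine blockSum_empty_congr fun j z hz => ?_
    split_ifs with hh
    · exact (hB z ((hR j z hz).1 hh)).2
    · exact ((hA z ((hR j z hz).2 hh)).1).symm
  · refine blockSum_empty_congr fun j z hz => ?_
    split_ifs with hh
    · exact ((hB z ((hR j z hz).1 hh)).1).symm
    · exact (hA z ((hR j z hz).2 hh)).2

end Swap

/-! ### Bounds on the block weights -/

section WeightBound

variable {P : Finset Site} {ℓ : ℕ} {F : Site → Set Site}

open Classical in
/-- The part of `A` outside the corners. -/
noncomputable def offCorners (F : Site → Set Site) (A : Finset Site) : Finset Site :=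
  A.filter fun z => z ∉ ⋃ j, F j

theorem mem_offCorners {A : Finset Site} {z : Site} :
    z ∈ offCorners F A ↔ z ∈ A ∧ z ∉ ⋃ j, F j := by
  classical
  simp only [offCorners, Finset.mem_filter]

open Classical in
/-- The sets of plaquettes of one block which occur in the expansion, up to the corners. -/
noncomputable def blockClasses (P : Finset Site) (ℓ : ℕ) (F : Site → Set Site) (i : Site) :
    Finset (Finset Site) :=
  (evenSets P (block ℓ i)).image (offCorners F)

theorem touched_offCorners (I A : Finset Site) :
    touched P ℓ F I (offCorners F A) = touched P ℓ F I A := by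
  ext i
  simp only [mem_touched, mem_offCorners]
  refine and_congr_right fun _ => exists_congr fun z => ?_
  tauto

/-- The weights `t [τ]_{P + z}` of single plaquettes. -/
noncomputable def siteWeight (P : Finset Site) (t : ℝ) (τ : Config) (z : Site) : ℝ :=
  t * spinProd τ (plaquette P z)

open Classical in
theorem blockSum_eq_sum_fiberSum (I : Finset Site) (t : ℝ) (τ : Config) (X : Finset Site) :
    blockSum P ℓ F I (siteWeight P t τ) X =
      ∑ c ∈ ((evenSets P (blockUnion ℓ I)).image (offCorners F)).filter
        (fun c => touched P ℓ F I c = X), fiberSum P (blockUnion ℓ I) t τ (⋃ j, F j) c := by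
  unfold blockSum
  rw [← Finset.sum_fiberwise_of_maps_to (g := offCorners F)
    (t := ((evenSets P (blockUnion ℓ I)).image (offCorners F)).filter
        (fun c => touched P ℓ F I c = X))]
  · refine Finset.sum_congr rfl fun c hc => ?_
    unfold fiberSum
    refine Finset.sum_congr ?_ fun _ _ => rfl
    ext A
    simp only [Finset.mem_filter] at hc ⊢
    constructor
    · rintro ⟨⟨h1, _⟩, h2⟩
      exact ⟨h1, h2⟩
    · rintro ⟨h1, h2⟩
      refine ⟨⟨h1, ?_⟩, h2⟩
      rw [← hc.2, ← touched_offCorners]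
      exact congrArg _ h2
  · intro A hA
    simp only [Finset.mem_filter] at hA ⊢
    exact ⟨Finset.mem_image_of_mem _ hA.1, by rw [touched_offCorners, hA.2]⟩

theorem blockSum_empty_eq (I : Finset Site) (t : ℝ) (τ : Config) :
    blockSum P ℓ F I (siteWeight P t τ) ∅ = fiberSum P (blockUnion ℓ I) t τ (⋃ j, F j) ∅ := by
  classical
  unfold blockSum fiberSum
  refine Finset.sum_congr ?_ fun _ _ => rfl
  ext A
  simp only [Finset.mem_filter]
  refine and_congr_right fun hA => ⟨fun h => ?_, fun h => ?_⟩
  · rw [Finset.eq_empty_iff_forall_notMem]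
    intro z hz
    obtain ⟨hzA, hzF⟩ := Finset.mem_filter.1 hz
    obtain ⟨j, hj⟩ := mem_corner_of_touched_eq_empty (mem_evenSets.1 hA).1 h hzA
    exact hzF (Set.mem_iUnion.2 ⟨j, hj⟩)
  · rw [Finset.eq_empty_iff_forall_notMem]
    intro i hi
    obtain ⟨_, z, hzA, hzF, _⟩ := mem_touched.1 hi
    have : z ∈ A.filter (fun z => z ∉ ⋃ j, F j) := Finset.mem_filter.2 ⟨hzA, hzF⟩
    simp only [h, Finset.notMem_empty] at this

theorem blockSum_empty_pos {t : ℝ} (ht0 : 0 ≤ t) (ht1 : t < 1) (I : Finset Site) (τ : Config) :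
    0 < blockSum P ℓ F I (siteWeight P t τ) ∅ := by
  rw [blockSum_empty_eq]
  exact fiberSum_empty_pos ht0 ht1 τ _

open Classical in
/-- A plaquette meets at most four blocks. -/
theorem card_blocks_le (hF : CornerSystem P ℓ F) (X : Finset Site) (z : Site) :
    (X.filter fun i => z ∈ basePoints P (block ℓ i)).card ≤ 4 := by
  have hℓ : (0 : ℤ) < ℓ := by exact_mod_cast hF.one_le
  have hsub : (X.filter fun i => z ∈ basePoints P (block ℓ i)) ⊆
      ({z.1 / ℓ - 1, z.1 / ℓ} : Finset ℤ) ×ˢ ({z.2 / ℓ - 1, z.2 / ℓ} : Finset ℤ) := by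
    intro i hi
    have h := block_coords hF (Finset.mem_filter.1 hi).2
    have key : ∀ a c : ℤ, (ℓ : ℤ) * a ≤ c → c ≤ ℓ * a + ℓ → a = c / ℓ - 1 ∨ a = c / ℓ := by
      intro a c h1 h2
      have h3 : a ≤ c / ℓ := (Int.le_ediv_iff_mul_le hℓ).2 (by linarith)
      have h4 : (ℓ : ℤ) * (c / ℓ) ≤ c := Int.mul_ediv_self_le hℓ.ne'
      have h5 : (ℓ : ℤ) * (c / ℓ) ≤ ℓ * (a + 1) := by linarith
      have := le_of_mul_le_mul_left h5 hℓ
      omega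
    rw [Finset.mem_product, Finset.mem_insert, Finset.mem_singleton, Finset.mem_insert,
      Finset.mem_singleton]
    exact ⟨key _ _ h.1.1 h.1.2, key _ _ h.2.1 h.2.2⟩
  refine (Finset.card_le_card hsub).trans ?_
  rw [Finset.card_product]
  exact Nat.mul_le_mul Finset.card_le_two Finset.card_le_two

open Classical in
theorem inter_block_mem_blockClasses {I A : Finset Site} {i : Site}
    (hA : A ∈ evenSets P (blockUnion ℓ I)) (hi : i ∈ I) :
    (offCorners F A).filter (fun z => z ∈ basePoints P (block ℓ i)) ∈ blockClasses P ℓ F i := by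
  refine Finset.mem_image.2 ⟨A.filter (fun z => z ∈ basePoints P (block ℓ i)), ?_, ?_⟩
  · rw [mem_evenSets]
    refine ⟨fun z hz => (Finset.mem_filter.1 hz).2, fun x hx => ?_⟩
    have := (mem_evenSets.1 hA).2 x (mem_blockUnion.2 ⟨i, hi, hx⟩)
    rw [Finset.filter_filter]
    rwa [Finset.filter_congr (q := fun z => x ∈ plaquette P z)]
    intro z _
    exact ⟨fun h => h.2, fun h => ⟨mem_basePoints.2 ⟨x, hx, h⟩, h⟩⟩
  · ext z
    simp only [mem_offCorners, Finset.mem_filter]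
    tauto

open Classical in
theorem sum_classes_le (hF : CornerSystem P ℓ F) {t s δ : ℝ} (ht0 : 0 ≤ t)
    (hs0 : 0 ≤ s) (hs1 : s ≤ 1) (hts : t ≤ s ^ 4)
    (hδ : ∀ i, ∑ c ∈ (blockClasses P ℓ F i).erase ∅, s ^ c.card ≤ δ) {I X : Finset Site}
    (hX : X ⊆ I) {T : Finset (Finset Site)}
    (hTm : ∀ c ∈ T, ∃ A ∈ evenSets P (blockUnion ℓ I), offCorners F A = c ∧
      touched P ℓ F I c = X) : ∑ c ∈ T, t ^ c.card ≤ δ ^ X.card := by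
  calc ∑ c ∈ T, t ^ c.card
      ≤ ∑ p ∈ X.pi (fun i => (blockClasses P ℓ F i).erase ∅),
          ∏ i ∈ X.attach, s ^ (p i.1 i.2).card := by
        refine sum_le_sum_of_injOn
          (fun c => fun i _ => c.filter (fun z => z ∈ basePoints P (block ℓ i))) ?_ ?_ ?_ ?_
        · intro c hc
          obtain ⟨A, hA, rfl, hcX⟩ := hTm c hc
          rw [Finset.mem_pi]
          intro i hi
          refine Finset.mem_erase.2 ⟨?_, inter_block_mem_blockClasses hA (hX hi)⟩
          rw [← hcX, mem_touched] at hi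
          obtain ⟨_, z, hz, _, hzi⟩ := hi
          exact Finset.ne_empty_of_mem (Finset.mem_filter.2 ⟨hz, hzi⟩)
        · have key : ∀ c ∈ T, ∀ z, z ∈ c ↔ ∃ i, ∃ _ : i ∈ X,
              z ∈ c.filter (fun z => z ∈ basePoints P (block ℓ i)) := by
            intro c hc z
            obtain ⟨A, hA, rfl, hcX⟩ := hTm c hc
            constructor
            · intro hz
              obtain ⟨hzA, hzF⟩ := mem_offCorners.1 hz
              obtain ⟨i, hi, hzi⟩ := mem_basePoints_blockUnion.1 ((mem_evenSets.1 hA).1 hzA)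
              exact ⟨i, hcX ▸ mem_touched.2 ⟨hi, z, hz, hzF, hzi⟩,
                Finset.mem_filter.2 ⟨hz, hzi⟩⟩
            · rintro ⟨i, _, h⟩
              exact (Finset.mem_filter.1 h).1
          intro c hc c' hc' h
          ext z
          rw [key c hc, key c' hc']
          refine exists_congr fun i => exists_congr fun hi => ?_
          have := congrFun (congrFun h i) hi
          simp only at this
          rw [this]
        · intro c hc
          rw [Finset.prod_attach X (fun i => s ^ (c.filter
            (fun z => z ∈ basePoints P (block ℓ i))).card), Finset.prod_pow_eq_pow_sum]
          have hcount : ∑ i ∈ X, (c.filter (fun z => z ∈ basePoints P (block ℓ i))).card ≤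
              4 * c.card := by
            simp only [Finset.card_filter]
            rw [Finset.sum_comm, mul_comm, ← smul_eq_mul, ← Finset.sum_const]
            refine Finset.sum_le_sum fun z _ => ?_
            rw [← Finset.card_filter]
            exact card_blocks_le hF X z
          calc t ^ c.card ≤ (s ^ 4) ^ c.card := pow_le_pow_left₀ ht0 hts _
            _ = s ^ (4 * c.card) := (pow_mul _ _ _).symm
            _ ≤ _ := pow_le_pow_of_le_one hs0 hs1 hcount
        · intro p _
          positivity
    _ = ∏ i ∈ X, ∑ c ∈ (blockClasses P ℓ F i).erase ∅, s ^ c.card :=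
        by rw [Finset.prod_sum]
    _ ≤ ∏ i ∈ X, δ := Finset.prod_le_prod (fun i _ => Finset.sum_nonneg fun _ _ => by positivity)
        fun i _ => hδ i
    _ = δ ^ X.card := Finset.prod_const _

/-- The weight of a set of blocks is at most the product of the generating functions of the
single blocks. Since each plaquette is shared by at most four blocks, `t` has to be replaced by a
fourth root `s`. -/
theorem abs_blockWeight_le (hF : CornerSystem P ℓ F) {t s δ : ℝ} (ht0 : 0 ≤ t) (ht1 : t < 1)
    (hs0 : 0 ≤ s) (hs1 : s ≤ 1) (hts : t ≤ s ^ 4)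
    (hδ : ∀ i, ∑ c ∈ (blockClasses P ℓ F i).erase ∅, s ^ c.card ≤ δ) (I : Finset Site)
    (τ : Config) {X : Finset Site} (hX : X ⊆ I) :
    |blockWeight P ℓ F I (siteWeight P t τ) X| ≤ δ ^ X.card := by
  classical
  have hpos := blockSum_empty_pos (P := P) (ℓ := ℓ) (F := F) ht0 ht1 I τ
  unfold blockWeight
  rw [abs_div, abs_of_pos hpos, div_le_iff₀ hpos, blockSum_eq_sum_fiberSum]
  have hTm : ∀ c ∈ ((evenSets P (blockUnion ℓ I)).image (offCorners F)).filter
      (fun c => touched P ℓ F I c = X), ∃ A ∈ evenSets P (blockUnion ℓ I),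
        offCorners F A = c ∧ touched P ℓ F I c = X := by
    intro c hc
    obtain ⟨h1, h2⟩ := Finset.mem_filter.1 hc
    obtain ⟨A, hA, rfl⟩ := Finset.mem_image.1 h1
    exact ⟨A, hA, rfl, h2⟩
  have hsum := sum_classes_le hF ht0 hs0 hs1 hts hδ hX hTm
  have hpos' := fiberSum_empty_pos (P := P) (Λ := blockUnion ℓ I) ht0 ht1 τ (⋃ j, F j)
  rw [blockSum_empty_eq]
  refine (Finset.abs_sum_le_sum_abs _ _).trans
    (le_trans ?_ (mul_le_mul_of_nonneg_right hsum hpos'.le))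
  rw [Finset.sum_mul]
  refine Finset.sum_le_sum fun c hc => ?_
  obtain ⟨A, hA, rfl, _⟩ := hTm c hc
  exact abs_fiberSum_le ht0 ht1 τ _
    (fun z hz => (mem_evenSets.1 hA).1 (mem_offCorners.1 hz).1)
    (fun z hz => (mem_offCorners.1 hz).2)

theorem polymerWeight_blockWeight (hF : CornerSystem P ℓ F) {t s δ : ℝ} (ht0 : 0 ≤ t)
    (ht1 : t < 1) (hs0 : 0 ≤ s) (hs1 : s ≤ 1) (hts : t ≤ s ^ 4)
    (hδ : ∀ i, ∑ c ∈ (blockClasses P ℓ F i).erase ∅, s ^ c.card ≤ δ) (I : Finset Site)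
    (τ : Config) :
    PolymerWeight nearBlocks I δ (blockWeight P ℓ F I (siteWeight P t τ)) where
  empty := div_self (blockSum_empty_pos ht0 ht1 I τ).ne'
  union _ _ _ _ h := blockWeight_union hF I (blockSum_empty_pos ht0 ht1 I τ).ne' h
  abs_le _ hX := abs_blockWeight_le hF ht0 ht1 hs0 hs1 hts hδ I τ hX

/-! ### Decay of the truncated partition functions -/

theorem partitionFn_pos (P : Finset Site) (β : ℝ) (Λ : Finset Site) (τ : Config) :
    0 < partitionFn P β Λ τ :=
  Finset.sum_pos (fun _ _ => Real.exp_pos _) ⟨fun _ => 1, Finset.mem_univ _⟩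

theorem partitionFn_eq_polymerSum {β : ℝ} (hβ : 0 < β) (F : Site → Set Site) (I : Finset Site)
    (τ : Config) :
    partitionFn P β (blockUnion ℓ I) τ =
      (Real.cosh (β / 2) ^ (basePoints P (blockUnion ℓ I)).card * 2 ^ (blockUnion ℓ I).card) *
        (blockSum P ℓ F I (siteWeight P (htParam β) τ) ∅ *
          polymerSum (blockWeight P ℓ F I (siteWeight P (htParam β) τ)) I) := by
  classical
  rw [partitionFn_eq]
  congr 1
  have h0 := (blockSum_empty_pos (P := P) (ℓ := ℓ) (F := F) (htParam_pos hβ).le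
    (htParam_lt_one β) I τ).ne'
  unfold polymerSum blockWeight
  rw [← Finset.sum_div, mul_div_cancel₀ _ h0]
  unfold blockSum
  rw [Finset.sum_fiberwise_of_maps_to]
  · rfl
  · intro A _
    exact Finset.mem_powerset.2 touched_subset

/-- A bound on the truncated polymer partition functions carries over to the partition functions
of the spin model. -/
theorem partitionFn_mul_sub_le_of_polymerSum (hF : CornerSystem P ℓ F) {β : ℝ} (hβ : 0 < β)
    (I : Finset Site) (τ : Config) {x y : Site}
    (hxy : ∀ j, ∀ z ∈ F j, ∀ z' ∈ F j, x ∈ plaquette P z → y ∉ plaquette P z') {ε : ℝ}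
    (h : |polymerSum (blockWeight P ℓ F I (siteWeight P (htParam β) (flip x (flip y τ)))) I *
          polymerSum (blockWeight P ℓ F I (siteWeight P (htParam β) τ)) I -
        polymerSum (blockWeight P ℓ F I (siteWeight P (htParam β) (flip x τ))) I *
          polymerSum (blockWeight P ℓ F I (siteWeight P (htParam β) (flip y τ))) I| ≤
      ε * |polymerSum (blockWeight P ℓ F I (siteWeight P (htParam β) (flip x τ))) I *
          polymerSum (blockWeight P ℓ F I (siteWeight P (htParam β) (flip y τ))) I|) :
    |partitionFn P β (blockUnion ℓ I) (flip x (flip y τ)) * partitionFn P β (blockUnion ℓ I) τ -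
        partitionFn P β (blockUnion ℓ I) (flip x τ) * partitionFn P β (blockUnion ℓ I) (flip y τ)| ≤
      ε * (partitionFn P β (blockUnion ℓ I) (flip x τ) *
        partitionFn P β (blockUnion ℓ I) (flip y τ)) := by
  have hw : ∀ (x : Site) (σ : Config) (z : Site), z ∉ {z | x ∈ plaquette P z} →
      siteWeight P (htParam β) (flip x σ) z = siteWeight P (htParam β) σ z := by
    intro x σ z hz
    have hz' : x ∉ plaquette P z := hz
    simp only [siteWeight, spinProd_flip, if_neg hz']
  have hq := blockSum_empty_mul hF I (u₀₀ := siteWeight P (htParam β) τ)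
    (u₁₀ := siteWeight P (htParam β) (flip x τ)) (u₀₁ := siteWeight P (htParam β) (flip y τ))
    (u₁₁ := siteWeight P (htParam β) (flip x (flip y τ))) (A := {z | x ∈ plaquette P z})
    (B := {z | y ∈ plaquette P z}) (fun z hz => ⟨hw x τ z hz, hw x (flip y τ) z hz⟩)
    (fun z hz => ⟨hw y τ z hz, by rw [flip_comm]; exact hw y (flip x τ) z hz⟩) hxy
  have hpos : ∀ σ, 0 < partitionFn P β (blockUnion ℓ I) σ := partitionFn_pos P β _
  refine le_of_le_of_eq (b := ε * |partitionFn P β (blockUnion ℓ I) (flip x τ) *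
    partitionFn P β (blockUnion ℓ I) (flip y τ)|) ?_
    (by rw [abs_of_pos (mul_pos (hpos (flip x τ)) (hpos (flip y τ)))])
  simp only [partitionFn_eq_polymerSum hβ F]
  have hp1 := blockSum_empty_pos (P := P) (ℓ := ℓ) (F := F) (htParam_pos hβ).le
    (htParam_lt_one β) I (flip x τ)
  have hp2 := blockSum_empty_pos (P := P) (ℓ := ℓ) (F := F) (htParam_pos hβ).le
    (htParam_lt_one β) I (flip y τ)
  have hcp : 0 < Real.cosh (β / 2) ^ (basePoints P (blockUnion ℓ I)).card *
      (2 : ℝ) ^ (blockUnion ℓ I).card := by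
    have := Real.cosh_pos (β / 2)
    positivity
  generalize Real.cosh (β / 2) ^ (basePoints P (blockUnion ℓ I)).card *
      (2 : ℝ) ^ (blockUnion ℓ I).card = c at *
  generalize blockSum P ℓ F I (siteWeight P (htParam β) τ) ∅ = b00 at *
  generalize blockSum P ℓ F I (siteWeight P (htParam β) (flip x τ)) ∅ = b10 at *
  generalize blockSum P ℓ F I (siteWeight P (htParam β) (flip y τ)) ∅ = b01 at *
  generalize blockSum P ℓ F I (siteWeight P (htParam β) (flip x (flip y τ))) ∅ = b11 at *
  generalize polymerSum (blockWeight P ℓ F I (siteWeight P (htParam β) τ)) I = p00 at *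
  generalize polymerSum (blockWeight P ℓ F I (siteWeight P (htParam β) (flip x τ))) I = p10 at *
  generalize polymerSum (blockWeight P ℓ F I (siteWeight P (htParam β) (flip y τ))) I = p01 at *
  generalize polymerSum (blockWeight P ℓ F I
    (siteWeight P (htParam β) (flip x (flip y τ)))) I = p11 at *
  have e1 : c * (b11 * p11) * (c * (b00 * p00)) - c * (b10 * p10) * (c * (b01 * p01)) =
      (c * c * (b10 * b01)) * (p11 * p00 - p10 * p01) := by
    linear_combination c * c * p11 * p00 * hq
  have e2 : c * (b10 * p10) * (c * (b01 * p01)) = (c * c * (b10 * b01)) * (p10 * p01) := by ring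
  have hcc : 0 < c * c * (b10 * b01) := by positivity
  rw [e1, e2, abs_mul (c * c * (b10 * b01)), abs_mul (c * c * (b10 * b01)), abs_of_pos hcc]
  have := mul_le_mul_of_nonneg_left h hcc.le
  linarith

/-- The blocks whose weights may depend on the spin at `x`. -/
noncomputable def siteBlocks (ℓ : ℕ) (x : Site) : Finset Site :=
  Finset.Icc (x.1 / ℓ - 4) (x.1 / ℓ + 4) ×ˢ Finset.Icc (x.2 / ℓ - 4) (x.2 / ℓ + 4)

theorem mem_siteBlocks {ℓ : ℕ} {x k : Site} : k ∈ siteBlocks ℓ x ↔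
    (x.1 / ℓ - 4 ≤ k.1 ∧ k.1 ≤ x.1 / ℓ + 4) ∧ x.2 / ℓ - 4 ≤ k.2 ∧ k.2 ≤ x.2 / ℓ + 4 := by
  simp [siteBlocks]

theorem card_siteBlocks (ℓ : ℕ) (x : Site) : (siteBlocks ℓ x).card ≤ 81 := by
  rw [siteBlocks, Finset.card_product, Int.card_Icc, Int.card_Icc]
  have : ∀ a : ℤ, (a + 4 + 1 - (a - 4)).toNat = 9 := fun a => by
    have : a + 4 + 1 - (a - 4) = 9 := by ring
    rw [this]; rfl
  rw [this, this]

theorem siteBlocks_of_near (hF : CornerSystem P ℓ F) {x z i k : Site} (hxz : x ∈ plaquette P z)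
    (hzi : z ∈ basePoints P (block ℓ i)) (hk : k ∈ nearBlocks i) : k ∈ siteBlocks ℓ x := by
  have hℓ : (0 : ℤ) < ℓ := by exact_mod_cast hF.one_le
  have h1 := block_coords hF hzi
  have h2 := hF.subset_box _ (mem_plaquette.1 hxz)
  simp only [Prod.fst_sub, Prod.snd_sub] at h2
  have key : ∀ a c d : ℤ, (ℓ : ℤ) * a ≤ c → c ≤ ℓ * a + ℓ → 0 ≤ d - c → d - c ≤ 1 →
      d / ℓ - 2 ≤ a ∧ a ≤ d / ℓ := by
    intro a c d h1 h2 h3 h4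
    have h5 : a ≤ d / ℓ := (Int.le_ediv_iff_mul_le hℓ).2 (by linarith)
    have h6 : (ℓ : ℤ) * (d / ℓ) ≤ d := Int.mul_ediv_self_le hℓ.ne'
    have h7 : (ℓ : ℤ) * (d / ℓ) ≤ ℓ * (a + 2) := by linarith
    exact ⟨by linarith [le_of_mul_le_mul_left h7 hℓ], h5⟩
  have k1 := key _ _ _ h1.1.1 h1.1.2 h2.1.1 h2.1.2
  have k2 := key _ _ _ h1.2.1 h1.2.2 h2.2.1 h2.2.2
  have h3 := mem_nearBlocks.1 hk
  rw [mem_siteBlocks]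
  omega

theorem blockWeight_flip (hF : CornerSystem P ℓ F) {t : ℝ} (ht0 : 0 ≤ t) (ht1 : t < 1)
    (I : Finset Site) (σ : Config) {x : Site} {X : Finset Site}
    (hX : Disjoint X (siteBlocks ℓ x)) :
    blockWeight P ℓ F I (siteWeight P t (flip x σ)) X =
      blockWeight P ℓ F I (siteWeight P t σ) X := by
  refine blockWeight_local hF I (blockSum_empty_pos ht0 ht1 I _).ne'
    (blockSum_empty_pos ht0 ht1 I _).ne'
    (S := {i | ∃ z, x ∈ plaquette P z ∧ z ∈ basePoints P (block ℓ i)}) ?_ ?_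
  · intro i hi z hz
    have : x ∉ plaquette P z := fun h => hi ⟨z, h, hz⟩
    simp only [siteWeight, spinProd_flip, if_neg this]
  · rintro k hk i ⟨z, hxz, hzi⟩ hki
    exact Finset.disjoint_left.1 hX hk (siteBlocks_of_near hF hxz hzi hki)

theorem l1Dist_le_of_reach (hℓ : 1 ≤ ℓ) {C : Finset Site} {x y s b : Site}
    (hs : s ∈ siteBlocks ℓ x) (hb : b ∈ siteBlocks ℓ y) (h : Reach nearBlocks C s b) :
    (l1Dist x y : ℝ) ≤ ℓ * (4 * C.card + 18) := by
  have hℓ' : (0 : ℤ) < ℓ := by exact_mod_cast hℓ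
  obtain ⟨n1, n2⟩ := h.near
  rw [mem_siteBlocks] at hs hb
  have key : ∀ a c u v : ℤ, a / ℓ - 4 ≤ u → u ≤ a / ℓ + 4 → c / ℓ - 4 ≤ v → v ≤ c / ℓ + 4 →
      |u - v| ≤ 2 * (C.card : ℤ) → |a - c| ≤ ℓ * (2 * C.card + 9) := by
    intro a c u v h1 h2 h3 h4 h5
    have a1 : (ℓ : ℤ) * (a / ℓ) ≤ a := Int.mul_ediv_self_le hℓ'.ne'
    have a2 : a < ℓ * (a / ℓ) + ℓ := by
      have := Int.lt_mul_ediv_self_add (x := a) hℓ'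
      linarith
    have c1 : (ℓ : ℤ) * (c / ℓ) ≤ c := Int.mul_ediv_self_le hℓ'.ne'
    have c2 : c < ℓ * (c / ℓ) + ℓ := by
      have := Int.lt_mul_ediv_self_add (x := c) hℓ'
      linarith
    rw [abs_le] at h5 ⊢
    have e1 : a / ℓ - c / ℓ ≤ 2 * (C.card : ℤ) + 8 := by linarith
    have e2 : c / ℓ - a / ℓ ≤ 2 * (C.card : ℤ) + 8 := by linarith
    have m1 := mul_le_mul_of_nonneg_left e1 hℓ'.le
    have m2 := mul_le_mul_of_nonneg_left e2 hℓ'.le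
    constructor <;> linarith
  have k1 := key x.1 y.1 s.1 b.1 hs.1.1 hs.1.2 hb.1.1 hb.1.2 n1
  have k2 := key x.2 y.2 s.2 b.2 hs.2.1 hs.2.2 hb.2.1 hb.2.2 n2
  have : ((l1Dist x y : ℕ) : ℤ) ≤ ℓ * (4 * C.card + 18) := by
    unfold l1Dist
    push_cast
    linarith
  exact_mod_cast this

/-- **Key estimate.** The influence of two distant boundary spins on the partition function of a
regular volume factorises up to an error which is exponentially small in their distance. -/
theorem partitionFn_mul_sub_le (hF : CornerSystem P ℓ F) {β s δ : ℝ} (hβ : 0 < β)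
    (hs0 : 0 ≤ s) (hs1 : s ≤ 1) (hts : htParam β ≤ s ^ 4) (hδ0 : 0 ≤ δ)
    (hδ : ∀ i, ∑ c ∈ (blockClasses P ℓ F i).erase ∅, s ^ c.card ≤ δ)
    (hδ' : δ * (4 ^ (25 + 1) * (2 ^ 25 * Real.exp 4)) ≤ 1)
    (I : Finset Site) (τ : Config) {x y : Site}
    (hxy : ∀ j, ∀ z ∈ F j, ∀ z' ∈ F j, x ∈ plaquette P z → y ∉ plaquette P z') :
    |partitionFn P β (blockUnion ℓ I) (flip x (flip y τ)) * partitionFn P β (blockUnion ℓ I) τ -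
        partitionFn P β (blockUnion ℓ I) (flip x τ) * partitionFn P β (blockUnion ℓ I) (flip y τ)| ≤
      2 * 8 ^ 162 * Real.exp (18 - l1Dist x y / ℓ) * (partitionFn P β (blockUnion ℓ I) (flip x τ) *
        partitionFn P β (blockUnion ℓ I) (flip y τ)) := by
  have ht0 := (htParam_pos hβ).le
  have ht1 := htParam_lt_one β
  have hℓ : (0 : ℝ) < ℓ := by exact_mod_cast hF.one_le
  refine partitionFn_mul_sub_le_of_polymerSum hF hβ I τ hxy ?_
  have hpw := polymerWeight_blockWeight hF ht0 ht1 hs0 hs1 hts hδ I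
  refine (abs_polymerSum_mul_sub_le (fun a => mem_nearBlocks.2 (by omega)) card_nearBlocks hδ0 hδ'
    (hpw τ) (hpw _) (hpw _) (hpw _) (siteBlocks ℓ x) (siteBlocks ℓ y)
    (fun X _ hX => blockWeight_flip hF ht0 ht1 I τ hX)
    (fun X _ hX => blockWeight_flip hF ht0 ht1 I (flip y τ) hX)
    (fun X _ hX => blockWeight_flip hF ht0 ht1 I τ hX)
    (fun X _ hX => by rw [flip_comm]; exact blockWeight_flip hF ht0 ht1 I (flip x τ) hX)
    (κ := l1Dist x y / ℓ - 18) ?_).trans ?_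
  · intro C _ s hs b hb h
    have := l1Dist_le_of_reach hF.one_le hs hb h
    rw [← div_le_iff₀' hℓ] at this
    linarith
  · have hcard : (siteBlocks ℓ x ∪ siteBlocks ℓ y).card ≤ 162 :=
      (Finset.card_union_le _ _).trans
        (Nat.add_le_add (card_siteBlocks ℓ x) (card_siteBlocks ℓ y))
    have : (8 : ℝ) ^ (siteBlocks ℓ x ∪ siteBlocks ℓ y).card ≤ 8 ^ 162 :=
      pow_le_pow_right₀ (by norm_num) hcard
    rw [neg_sub]
    gcongr

/-- The same factorisation in a single block, in terms of the generating function of the block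
only. -/
theorem partitionFn_mul_sub_le_single (hF : CornerSystem P ℓ F) {β s δ : ℝ} (hβ : 0 < β)
    (hs0 : 0 ≤ s) (hs1 : s ≤ 1) (hts : htParam β ≤ s ^ 4) (hδ0 : 0 ≤ δ)
    (hδ : ∀ i, ∑ c ∈ (blockClasses P ℓ F i).erase ∅, s ^ c.card ≤ δ) (hδ' : δ ≤ 1 / 4)
    (i : Site) (τ : Config) {x y : Site}
    (hxy : ∀ j, ∀ z ∈ F j, ∀ z' ∈ F j, x ∈ plaquette P z → y ∉ plaquette P z') :
    |partitionFn P β (block ℓ i) (flip x (flip y τ)) * partitionFn P β (block ℓ i) τ -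
        partitionFn P β (block ℓ i) (flip x τ) * partitionFn P β (block ℓ i) (flip y τ)| ≤
      24 * δ * (partitionFn P β (block ℓ i) (flip x τ) *
        partitionFn P β (block ℓ i) (flip y τ)) := by
  have ht0 := (htParam_pos hβ).le
  have ht1 := htParam_lt_one β
  have hb : block ℓ i = blockUnion ℓ {i} := by simp [blockUnion]
  rw [hb]
  refine partitionFn_mul_sub_le_of_polymerSum hF hβ {i} τ hxy ?_
  have hpw := polymerWeight_blockWeight hF ht0 ht1 hs0 hs1 hts hδ {i}
  have hsum : ∀ σ, ∃ a, |a| ≤ δ ∧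
      polymerSum (blockWeight P ℓ F {i} (siteWeight P (htParam β) σ)) {i} = 1 + a := by
    intro σ
    refine ⟨blockWeight P ℓ F {i} (siteWeight P (htParam β) σ) {i}, ?_, ?_⟩
    · have := (hpw σ).abs_le {i} subset_rfl
      simpa using this
    · have := (hpw σ).empty
      unfold polymerSum
      rw [← insert_empty_eq, Finset.sum_powerset_insert (Finset.notMem_empty i)]
      simp [this]
  obtain ⟨a, ha, ea⟩ := hsum (flip x (flip y τ))
  obtain ⟨b, hb', eb⟩ := hsum τ
  obtain ⟨c, hc, ec⟩ := hsum (flip x τ)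
  obtain ⟨d, hd, ed⟩ := hsum (flip y τ)
  rw [ea, eb, ec, ed]
  rw [abs_le] at ha hb' hc hd
  have hcd : 1 / 2 ≤ (1 + c) * (1 + d) := by nlinarith
  rw [abs_of_nonneg (a := (1 + c) * (1 + d)) (by linarith)]
  have hab : |a * b| ≤ δ := by rw [abs_le]; constructor <;> nlinarith
  have hcd' : |c * d| ≤ δ := by rw [abs_le]; constructor <;> nlinarith
  rw [abs_le] at hab hcd'
  have h1 : |(1 + a) * (1 + b) - (1 + c) * (1 + d)| ≤ 12 * δ := by
    rw [abs_le]; constructor <;> nlinarith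
  refine h1.trans ?_
  nlinarith

end WeightBound
/-! ### Propagation of zeros along lines -/

theorem spread {N : ℤ → Prop} {lo hi k : ℤ} (h0 : N k)
    (right : ∀ i, k < i → i ≤ hi → N (i - 1) → N i)
    (left : ∀ i, lo < i → i ≤ k → N i → N (i - 1)) : ∀ i, lo ≤ i → i ≤ hi → N i := by
  have h1 : ∀ n : ℕ, k + n ≤ hi → N (k + n) := by
    intro n
    induction n with
    | zero => intro _; simpa using h0
    | succ n ih =>
      intro h
      push_cast at h
      refine right _ (by push_cast; omega) (by push_cast; omega) ?_
      have := ih (by omega)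
      convert this using 1
      push_cast; ring
  have h2 : ∀ n : ℕ, lo ≤ k - n → N (k - n) := by
    intro n
    induction n with
    | zero => intro _; simpa using h0
    | succ n ih =>
      intro h
      push_cast at h
      have := left _ (by omega) (by omega) (ih (by omega))
      convert this using 1
      push_cast; ring
  intro i hlo hhi
  rcases le_total k i with h | h
  · obtain ⟨n, rfl⟩ := Int.le.dest h
    exact h1 n hhi
  · obtain ⟨n, hn⟩ := Int.le.dest h
    have : i = k - n := by omega
    rw [this]
    exact h2 n (by omega)

/-- In the triangular model a solution of the parity constraints in a block which vanishes on a
row and on two columns vanishes, except possibly in a corner where the rows and the columns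
do not determine it. -/
theorem triangle_propagate {ℓ m j₀ i₀ i₁ : ℤ} (a : ℤ → ℤ → Prop)
    (T1 : ∀ i j, 1 ≤ i → i ≤ ℓ → 1 ≤ j → j ≤ ℓ → ¬a i (j - 1) → ¬a (i - 1) (j - 1) → ¬a i j)
    (T2 : ∀ i j, 1 ≤ i → i ≤ ℓ → 1 ≤ j → j ≤ ℓ → ¬a i j → ¬a (i - 1) (j - 1) → ¬a i (j - 1))
    (T3 : ∀ i j, 1 ≤ i → i ≤ ℓ → 1 ≤ j → j ≤ ℓ → ¬a i j → ¬a i (j - 1) → ¬a (i - 1) (j - 1))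
    (hm : 4 * m ≤ ℓ) (hj₀ : 1 ≤ j₀) (hj₀' : j₀ ≤ m) (hi₀ : 1 ≤ i₀) (hi₀' : i₀ ≤ m)
    (hi₁ : m + 1 ≤ i₁) (hi₁' : i₁ ≤ 2 * m)
    (hrow : ∀ i, 0 ≤ i → i ≤ ℓ → ¬a i j₀)
    (hcol₀ : ∀ j, 1 ≤ j → j ≤ ℓ → j - i₀ ≤ ℓ - m → ¬a i₀ j)
    (hcol₁ : ∀ j, 0 ≤ j → j ≤ ℓ → ¬a i₁ j) :
    ∀ i j, 0 ≤ i → i ≤ ℓ → 0 ≤ j → j ≤ ℓ → j - i ≤ ℓ - m → ¬a i j := by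
  have s1 : ∀ j, 0 ≤ j → j ≤ j₀ → ∀ i, 0 ≤ i → i ≤ ℓ → ¬a i j := by
    refine spread (N := fun j => ∀ i, 0 ≤ i → i ≤ ℓ → ¬a i j) hrow
      (fun j h1 h2 => by omega) ?_
    intro j hj hj' hN
    refine spread (N := fun i => ¬a i (j - 1)) (hcol₁ (j - 1) (by omega) (by omega)) ?_ ?_
    · intro i h1 h2 h3
      exact T2 i j (by omega) h2 (by omega) (by omega) (hN i (by omega) h2) h3
    · intro i h1 h2 h3
      exact T3 i j (by omega) (by omega) (by omega) (by omega) (hN i (by omega) (by omega)) h3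
  have s2 : ∀ j, j₀ ≤ j → j ≤ ℓ → ∀ i, i₀ ≤ i → i ≤ ℓ → j - i ≤ ℓ - m → ¬a i j := by
    refine spread (N := fun j => ∀ i, i₀ ≤ i → i ≤ ℓ → j - i ≤ ℓ - m → ¬a i j)
      (fun i h1 h2 _ => hrow i (by omega) h2) ?_ (fun j h1 h2 => by omega)
    intro j hj hj' hN i h1 h2 h3
    by_cases hi : i = i₀
    · subst hi
      exact hcol₀ j (by omega) hj' h3
    · exact T1 i j (by omega) h2 (by omega) hj' (hN i h1 h2 (by omega))
        (hN (i - 1) (by omega) (by omega) (by omega))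
  have s4 : ∀ i, 0 ≤ i → i ≤ i₀ → ∀ j, 0 ≤ j → j ≤ ℓ → j - i ≤ ℓ - m → ¬a i j := by
    refine spread (k := i₀) (N := fun i => ∀ j, 0 ≤ j → j ≤ ℓ → j - i ≤ ℓ - m → ¬a i j) ?_
      (fun i h1 h2 => by omega) ?_
    · intro j h1 h2 h3
      by_cases hj : j = 0
      · exact s1 j h1 (by omega) i₀ (by omega) (by omega)
      · exact hcol₀ j (by omega) h2 h3
    · intro i h1 h2 hN j h3 h4 h5
      have := T3 i (j + 1) (by omega) (by omega) (by omega) (by omega)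
        (hN (j + 1) (by omega) (by omega) (by omega))
      simp only [add_sub_cancel_right] at this
      exact this (hN j h3 h4 (by omega))
  intro i j h1 h2 h3 h4 h5
  rcases le_total i i₀ with h | h
  · exact s4 i h1 h j h3 h4 h5
  · rcases le_total j j₀ with h' | h'
    · exact s1 j h3 h' i h1 h2
    · exact s2 j h' h4 i h h2 h5

/-- In the square model a solution of the parity constraints in a block which vanishes on a row
and on a column vanishes. -/
theorem square_propagate {ℓ j₀ i₀ : ℤ} (a : ℤ → ℤ → Prop)
    (T1 : ∀ i j, 1 ≤ i → i ≤ ℓ → 1 ≤ j → j ≤ ℓ →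
      ¬a (i - 1) j → ¬a i (j - 1) → ¬a (i - 1) (j - 1) → ¬a i j)
    (T2 : ∀ i j, 1 ≤ i → i ≤ ℓ → 1 ≤ j → j ≤ ℓ →
      ¬a i j → ¬a (i - 1) j → ¬a (i - 1) (j - 1) → ¬a i (j - 1))
    (T3 : ∀ i j, 1 ≤ i → i ≤ ℓ → 1 ≤ j → j ≤ ℓ →
      ¬a i j → ¬a (i - 1) j → ¬a i (j - 1) → ¬a (i - 1) (j - 1))
    (T4 : ∀ i j, 1 ≤ i → i ≤ ℓ → 1 ≤ j → j ≤ ℓ →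
      ¬a i j → ¬a i (j - 1) → ¬a (i - 1) (j - 1) → ¬a (i - 1) j)
    (hj₀ : 0 ≤ j₀) (hj₀' : j₀ ≤ ℓ) (hi₀ : 0 ≤ i₀) (hi₀' : i₀ ≤ ℓ)
    (hrow : ∀ i, 0 ≤ i → i ≤ ℓ → ¬a i j₀) (hcol : ∀ j, 0 ≤ j → j ≤ ℓ → ¬a i₀ j) :
    ∀ j, 0 ≤ j → j ≤ ℓ → ∀ i, 0 ≤ i → i ≤ ℓ → ¬a i j := by
  refine spread (N := fun j => ∀ i, 0 ≤ i → i ≤ ℓ → ¬a i j) hrow ?_ ?_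
  · intro j h1 h2 hN
    refine spread (N := fun i => ¬a i j) (hcol j (by omega) h2) ?_ ?_
    · intro i h3 h4 h5
      exact T1 i j (by omega) h4 (by omega) h2 h5 (hN i (by omega) h4)
        (hN (i - 1) (by omega) (by omega))
    · intro i h3 h4 h5
      exact T4 i j (by omega) (by omega) (by omega) h2 h5 (hN i (by omega) (by omega))
        (hN (i - 1) (by omega) (by omega))
  · intro j h1 h2 hN
    refine spread (N := fun i => ¬a i (j - 1)) (hcol (j - 1) (by omega) (by omega)) ?_ ?_
    · intro i h3 h4 h5
      exact T2 i j (by omega) h4 (by omega) (by omega) (hN i (by omega) h4)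
        (hN (i - 1) (by omega) (by omega)) h5
    · intro i h3 h4 h5
      exact T3 i j (by omega) (by omega) (by omega) (by omega) (hN i (by omega) (by omega))
        (hN (i - 1) (by omega) (by omega)) h5

theorem EvenOn.notMem {P Λ A : Finset Site} (h : EvenOn P Λ A) {x z₀ : Site} (hx : x ∈ Λ)
    (hz₀ : x ∈ plaquette P z₀) (huniq : ∀ z ∈ A, x ∈ plaquette P z → z = z₀) : z₀ ∉ A := by
  intro hmem
  have h1 := h x hx
  have : A.filter (fun z => x ∈ plaquette P z) = {z₀} := by
    ext z
    simp only [Finset.mem_filter, Finset.mem_singleton]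
    constructor
    · rintro ⟨h2, h3⟩
      exact huniq z h2 h3
    · rintro rfl
      exact ⟨hmem, hz₀⟩
  rw [this] at h1
  simp at h1

/-! ### The generating function of a single block -/

theorem exists_card_fiber_le {K : Finset ℤ} (hK : K.Nonempty) (f : Site → ℤ) (c : Finset Site) :
    ∃ k ∈ K, K.card * (c.filter fun z => f z = k).card ≤ c.card := by
  obtain ⟨k, hk, hmin⟩ := Finset.exists_min_image K
    (fun k => (c.filter fun z => f z = k).card) hK
  refine ⟨k, hk, ?_⟩
  calc K.card * (c.filter fun z => f z = k).card
      ≤ ∑ k' ∈ K, (c.filter fun z => f z = k').card := by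
        rw [← smul_eq_mul]
        exact Finset.card_nsmul_le_sum _ _ _ hmin
    _ = (K.biUnion fun k' => c.filter fun z => f z = k').card := by
        rw [Finset.card_biUnion]
        intro k₁ _ k₂ _ hne
        refine Finset.disjoint_left.2 fun z h1 h2 => hne ?_
        rw [← (Finset.mem_filter.1 h1).2, (Finset.mem_filter.1 h2).2]
    _ ≤ c.card := Finset.card_le_card (Finset.biUnion_subset.2 fun _ _ => Finset.filter_subset _ _)

/-- A row and two columns through the block `i`. -/
noncomputable def blockLines (P : Finset Site) (ℓ : ℕ) (i : Site) (ω : ℤ × ℤ × ℤ) : Finset Site :=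
  (basePoints P (block ℓ i)).filter fun z =>
    z.2 - ℓ * i.2 = ω.1 ∨ z.1 - ℓ * i.1 = ω.2.1 ∨ z.1 - ℓ * i.1 = ω.2.2

/-- The indices of the triples of lines. -/
noncomputable def lineIndex (m : ℕ) : Finset (ℤ × ℤ × ℤ) :=
  Finset.Icc 1 (m : ℤ) ×ˢ Finset.Icc 1 (m : ℤ) ×ˢ Finset.Icc (m + 1 : ℤ) (2 * m)

theorem mem_lineIndex {m : ℕ} {ω : ℤ × ℤ × ℤ} : ω ∈ lineIndex m ↔
    (1 ≤ ω.1 ∧ ω.1 ≤ m) ∧ (1 ≤ ω.2.1 ∧ ω.2.1 ≤ m) ∧ ((m : ℤ) + 1 ≤ ω.2.2 ∧ ω.2.2 ≤ 2 * m) := by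
  simp [lineIndex]

theorem card_lineIndex (m : ℕ) : (lineIndex m).card = m ^ 3 := by
  simp only [lineIndex, Finset.card_product, Int.card_Icc]
  have h1 : ((m : ℤ) + 1 - 1).toNat = m := by omega
  have h2 : (2 * (m : ℤ) + 1 - (m + 1)).toNat = m := by omega
  rw [h1, h2]
  ring

theorem evenOn_symmDiff {P Λ A B : Finset Site} (hA : EvenOn P Λ A) (hB : EvenOn P Λ B) :
    EvenOn P Λ (symmDiff A B) := by
  intro x hx
  set p := fun z => x ∈ plaquette P z with hp
  have h1 : ((symmDiff A B).filter p).card + 2 * ((A ∩ B).filter p).card =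
      (A.filter p).card + (B.filter p).card := by
    have e1 : (symmDiff A B).filter p = (A.filter p \ B.filter p) ∪ (B.filter p \ A.filter p) := by
      ext z
      simp only [Finset.mem_filter, Finset.mem_symmDiff, Finset.mem_union, Finset.mem_sdiff]
      tauto
    have e2 : (A ∩ B).filter p = A.filter p ∩ B.filter p := Finset.filter_inter_distrib _ _ _
    rw [e1, e2, Finset.card_union_of_disjoint]
    · have a1 := Finset.card_sdiff_add_card_inter (A.filter p) (B.filter p)
      have a2 := Finset.card_sdiff_add_card_inter (B.filter p) (A.filter p)
      rw [Finset.inter_comm] at a2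
      omega
    · exact disjoint_sdiff_sdiff
  have h2 := (hA x hx).add (hB x hx)
  rw [← h1] at h2
  exact (Nat.even_add.1 h2).2 (even_two_mul _)

section BlockBound

variable {P : Finset Site} {ℓ : ℕ} {F : Site → Set Site}

theorem exists_lineIndex {m : ℕ} (hm : 1 ≤ m) (i : Site) (c : Finset Site) :
    ∃ ω ∈ lineIndex m, m * (c ∩ blockLines P ℓ i ω).card ≤ 3 * c.card := by
  have c1 : (Finset.Icc 1 (m : ℤ)).card = m := by rw [Int.card_Icc]; omega
  have c2 : (Finset.Icc (m + 1 : ℤ) (2 * m)).card = m := by rw [Int.card_Icc]; omega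
  have n1 : (Finset.Icc 1 (m : ℤ)).Nonempty := Finset.card_pos.1 (by rw [c1]; omega)
  have n2 : (Finset.Icc (m + 1 : ℤ) (2 * m)).Nonempty := Finset.card_pos.1 (by rw [c2]; omega)
  obtain ⟨k₁, hk₁, b₁⟩ := exists_card_fiber_le n1 (fun z => z.2 - ℓ * i.2) c
  obtain ⟨k₂, hk₂, b₂⟩ := exists_card_fiber_le n1 (fun z => z.1 - ℓ * i.1) c
  obtain ⟨k₃, hk₃, b₃⟩ := exists_card_fiber_le n2 (fun z => z.1 - ℓ * i.1) c
  rw [c1] at b₁ b₂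
  rw [c2] at b₃
  refine ⟨(k₁, k₂, k₃), by simp only [lineIndex, Finset.mem_product]; exact ⟨hk₁, hk₂, hk₃⟩, ?_⟩
  have hcard : (c ∩ blockLines P ℓ i (k₁, k₂, k₃)).card ≤
      (c.filter fun z => z.2 - ℓ * i.2 = k₁).card + (c.filter fun z => z.1 - ℓ * i.1 = k₂).card +
        (c.filter fun z => z.1 - ℓ * i.1 = k₃).card := by
    refine (Finset.card_le_card ?_).trans ((Finset.card_union_le _ _).trans
      (Nat.add_le_add_right (Finset.card_union_le _ _) _))
    intro z hz
    obtain ⟨hz1, hz2⟩ := Finset.mem_inter.1 hz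
    have := (Finset.mem_filter.1 hz2).2
    simp only [Finset.mem_union, Finset.mem_filter]
    tauto
  refine (Nat.mul_le_mul_left m hcard).trans ?_
  rw [mul_add, mul_add]
  omega

theorem eq_of_inter_blockLines_eq {i : Site} {w : ℤ × ℤ × ℤ}
    (hdet : ∀ A ∈ evenSets P (block ℓ i),
      (∀ z ∈ offCorners F A, z ∉ blockLines P ℓ i w) → offCorners F A = ∅)
    {c c' : Finset Site} (hc : c ∈ blockClasses P ℓ F i) (hc' : c' ∈ blockClasses P ℓ F i)
    (h : c ∩ blockLines P ℓ i w = c' ∩ blockLines P ℓ i w) : c = c' := by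
  obtain ⟨A, hA, rfl⟩ := Finset.mem_image.1 hc
  obtain ⟨A', hA', rfl⟩ := Finset.mem_image.1 hc'
  rw [mem_evenSets] at hA hA'
  have hAA : symmDiff A A' ∈ evenSets P (block ℓ i) := by
    refine mem_evenSets.2 ⟨fun z hz => ?_, evenOn_symmDiff hA.2 hA'.2⟩
    rcases Finset.mem_symmDiff.1 hz with h | h
    · exact hA.1 h.1
    · exact hA'.1 h.1
  have hoff : ∀ z, z ∈ offCorners F (symmDiff A A') ↔
      (z ∈ offCorners F A ∧ z ∉ offCorners F A') ∨ (z ∈ offCorners F A' ∧ z ∉ offCorners F A) := by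
    intro z
    simp only [mem_offCorners, Finset.mem_symmDiff]
    by_cases h1 : z ∈ A <;> by_cases h2 : z ∈ A' <;> simp [h1, h2]
  have h1 : ∀ z ∈ blockLines P ℓ i w, z ∈ offCorners F A ↔ z ∈ offCorners F A' := by
    intro z hz
    have := Finset.ext_iff.1 h z
    rwa [Finset.mem_inter, Finset.mem_inter, and_iff_left hz, and_iff_left hz] at this
  have h0 := hdet _ hAA (fun z hz hzl => by
    rcases (hoff z).1 hz with ⟨h2, h3⟩ | ⟨h2, h3⟩
    · exact h3 ((h1 z hzl).1 h2)
    · exact h3 ((h1 z hzl).2 h2))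
  ext z
  have h2 : ¬ _ := fun h => Finset.notMem_empty z (h0 ▸ (hoff z).2 h)
  constructor
  · intro h3
    by_contra h4
    exact h2 (Or.inl ⟨h3, h4⟩)
  · intro h3
    by_contra h4
    exact h2 (Or.inr ⟨h3, h4⟩)

theorem card_blockLines_le (hF : CornerSystem P ℓ F) (i : Site) (w : ℤ × ℤ × ℤ) :
    (blockLines P ℓ i w).card ≤ 3 * (ℓ + 1) := by
  have hsub : blockLines P ℓ i w ⊆
      (Finset.Icc ((ℓ : ℤ) * i.1) (ℓ * i.1 + ℓ) ×ˢ {ℓ * i.2 + w.1} ∪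
        {ℓ * i.1 + w.2.1} ×ˢ Finset.Icc ((ℓ : ℤ) * i.2) (ℓ * i.2 + ℓ)) ∪
        {ℓ * i.1 + w.2.2} ×ˢ Finset.Icc ((ℓ : ℤ) * i.2) (ℓ * i.2 + ℓ) := by
    intro z hz
    obtain ⟨h1, h2⟩ := Finset.mem_filter.1 hz
    have h3 := block_coords hF h1
    simp only [Finset.mem_union, Finset.mem_product, Finset.mem_Icc, Finset.mem_singleton]
    rcases h2 with h | h | h
    · exact Or.inl (Or.inl ⟨h3.1, by omega⟩)
    · exact Or.inl (Or.inr ⟨by omega, h3.2⟩)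
    · exact Or.inr ⟨by omega, h3.2⟩
  have hI : ∀ b : ℤ, (Finset.Icc b (b + ℓ)).card = ℓ + 1 := by
    intro b; rw [Int.card_Icc]; omega
  refine (Finset.card_le_card hsub).trans ((Finset.card_union_le _ _).trans ?_)
  refine (Nat.add_le_add_right (Finset.card_union_le _ _) _).trans ?_
  simp only [Finset.card_product, hI, Finset.card_singleton]
  omega

theorem sum_powerset_erase_empty (U : Finset Site) (u : ℝ) :
    ∑ D ∈ U.powerset.erase ∅, u ^ D.card = (1 + u) ^ U.card - 1 := by
  have h1 := Finset.add_sum_erase U.powerset (fun D => u ^ D.card)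
    (Finset.empty_mem_powerset _)
  have h2 := Finset.sum_pow_mul_eq_add_pow u 1 U
  simp only [one_pow, mul_one] at h2
  rw [h2] at h1
  simp only [Finset.card_empty, pow_zero] at h1
  rw [add_comm 1 u, ← h1]
  ring

/-- Sets which are determined by their intersections with the triples of lines have a small
generating function: by the pigeonhole principle one of the triples contains few points. -/
theorem sum_blockClasses_le (hF : CornerSystem P ℓ F) {m : ℕ} (hm : 1 ≤ m) {i : Site}
    (hdet : ∀ A ∈ evenSets P (block ℓ i), ∀ ω ∈ lineIndex m,
      (∀ z ∈ offCorners F A, z ∉ blockLines P ℓ i ω) → offCorners F A = ∅) {a : ℝ} (ha : 0 ≤ a) :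
    ∑ c ∈ (blockClasses P ℓ F i).erase ∅, Real.exp (-a) ^ c.card ≤
      m ^ 3 * ((1 + Real.exp (-(a * m / 3))) ^ (3 * (ℓ + 1)) - 1) := by
  set u := Real.exp (-(a * m / 3)) with hu
  have hu0 : 0 < u := Real.exp_pos _
  choose ω hω hωc using exists_lineIndex (P := P) (ℓ := ℓ) hm i
  have step1 : ∑ c ∈ (blockClasses P ℓ F i).erase ∅, Real.exp (-a) ^ c.card ≤
      ∑ p ∈ (lineIndex m).sigma (fun w => (blockLines P ℓ i w).powerset.erase ∅),
        u ^ p.2.card := by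
    refine sum_le_sum_of_injOn
      (fun c => (⟨ω c, c ∩ blockLines P ℓ i (ω c)⟩ : (_ : ℤ × ℤ × ℤ) × Finset Site)) ?_ ?_ ?_ ?_
    · intro c hc
      obtain ⟨hc0, hcm⟩ := Finset.mem_erase.1 hc
      refine Finset.mem_sigma.2 ⟨hω c, Finset.mem_erase.2 ⟨fun h => hc0 ?_,
        Finset.mem_powerset.2 Finset.inter_subset_right⟩⟩
      obtain ⟨A, hA, rfl⟩ := Finset.mem_image.1 hcm
      refine hdet A hA _ (hω (offCorners F A)) fun z hz hzl => ?_
      have : z ∈ offCorners F A ∩ blockLines P ℓ i (ω (offCorners F A)) :=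
        Finset.mem_inter.2 ⟨hz, hzl⟩
      simp only at h
      rw [h] at this
      exact absurd this (Finset.notMem_empty z)
    · intro c hc c' hc' h
      rw [Finset.mem_coe, Finset.mem_erase] at hc hc'
      simp only [Sigma.mk.injEq, heq_eq_eq] at h
      refine eq_of_inter_blockLines_eq (w := ω c) (fun A hA => hdet A hA _ (hω c)) hc.2 hc'.2 ?_
      rw [h.2, h.1]
    · intro c _
      rw [hu, ← Real.exp_nat_mul, ← Real.exp_nat_mul]
      refine Real.exp_le_exp.2 ?_
      have : (m : ℝ) * (c ∩ blockLines P ℓ i (ω c)).card ≤ 3 * c.card := by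
        exact_mod_cast hωc c
      simp only
      nlinarith
    · intro p _
      positivity
  refine step1.trans ?_
  rw [Finset.sum_sigma]
  calc ∑ w ∈ lineIndex m, ∑ D ∈ (blockLines P ℓ i w).powerset.erase ∅, u ^ D.card
      ≤ ∑ w ∈ lineIndex m, ((1 + u) ^ (3 * (ℓ + 1)) - 1) := by
        refine Finset.sum_le_sum fun w _ => ?_
        rw [sum_powerset_erase_empty]
        exact sub_le_sub_right
          (pow_le_pow_right₀ (by linarith) (card_blockLines_le hF i w)) _
    _ = _ := by
        rw [Finset.sum_const, card_lineIndex, nsmul_eq_mul]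
        push_cast
        ring

end BlockBound

/-! ### The two models -/

theorem cornerSystem_square {ℓ : ℕ} (hℓ : 1 ≤ ℓ) :
    CornerSystem squarePlaquette ℓ (fun _ => ∅) where
  one_le := hℓ
  subset_box := by decide
  near _ _ _ h := absurd h (Set.notMem_empty _)
  separated _ _ _ _ _ _ _ h := absurd h (Set.notMem_empty _)

/-- The corners of the triangular model: a triangle with legs of length `m` at the corner
`(0, ℓ)` of each block. -/
def triangleCorner (ℓ m : ℕ) (j : Site) : Set Site :=
  {z | ℓ * j.1 ≤ z.1 ∧ z.2 ≤ ℓ * j.2 + ℓ ∧ (ℓ : ℤ) - m < (z.2 - ℓ * j.2) - (z.1 - ℓ * j.1)}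

theorem cornerSystem_triangle {ℓ m : ℕ} (hm : 1 ≤ m) (hℓ : 4 * m ≤ ℓ) :
    CornerSystem trianglePlaquette ℓ (triangleCorner ℓ m) := by
  have hℓ1 : 1 ≤ ℓ := by omega
  have hbox : ∀ b ∈ trianglePlaquette, (0 ≤ b.1 ∧ b.1 ≤ 1) ∧ 0 ≤ b.2 ∧ b.2 ≤ 1 := by decide
  refine ⟨hℓ1, hbox, ?_, ?_⟩
  · rintro j k z ⟨h1, h2, h3⟩ hz
    obtain ⟨x, hx, hxz⟩ := mem_basePoints.1 hz
    have h4 := hbox _ (mem_plaquette.1 hxz)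
    have h5 := mem_block.1 hx
    simp only [Prod.fst_sub, Prod.snd_sub] at h4
    exact ⟨index_near hℓ1 (c := z.1) h1 (by omega) (by omega) (by omega),
      index_near hℓ1 (c := z.2) (by omega) (by omega) (by omega) (by omega)⟩
  · rintro x z z' j j' hz hz' ⟨h1, h2, h3⟩ ⟨h1', h2', h3'⟩
    have h4 := hbox _ (mem_plaquette.1 hz)
    have h4' := hbox _ (mem_plaquette.1 hz')
    simp only [Prod.fst_sub, Prod.snd_sub] at h4 h4'
    have key : ∀ a b : ℤ, (ℓ : ℤ) * a < ℓ * b + ℓ → (ℓ : ℤ) * b < ℓ * a + ℓ → a = b := by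
      intro a b h h'
      have hp : (0 : ℤ) < ℓ := by exact_mod_cast hℓ1
      have e1 : (ℓ : ℤ) * a < ℓ * (b + 1) := by linarith
      have e2 : (ℓ : ℤ) * b < ℓ * (a + 1) := by linarith
      have := lt_of_mul_lt_mul_left e1 hp.le
      have := lt_of_mul_lt_mul_left e2 hp.le
      omega
    exact Prod.ext (key _ _ (by omega) (by omega)) (key _ _ (by omega) (by omega))

theorem mem_plaquette_square {x z : Site} : x ∈ plaquette squarePlaquette z ↔
    z = x ∨ z = (x.1 - 1, x.2) ∨ z = (x.1, x.2 - 1) ∨ z = (x.1 - 1, x.2 - 1) := by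
  rw [mem_plaquette, squarePlaquette]
  simp only [Finset.mem_insert, Finset.mem_singleton, Prod.ext_iff, Prod.fst_sub, Prod.snd_sub]
  omega

theorem mem_plaquette_triangle {x z : Site} : x ∈ plaquette trianglePlaquette z ↔
    z = x ∨ z = (x.1, x.2 - 1) ∨ z = (x.1 - 1, x.2 - 1) := by
  rw [mem_plaquette, trianglePlaquette]
  simp only [Finset.mem_insert, Finset.mem_singleton, Prod.ext_iff, Prod.fst_sub, Prod.snd_sub]
  omega

/-- A set of the expansion in a block which avoids a row and a column of the block is empty. -/
theorem square_determined {ℓ m : ℕ} (hℓ : 4 * m ≤ ℓ) (i : Site) :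
    ∀ A ∈ evenSets squarePlaquette (block ℓ i), ∀ ω ∈ lineIndex m,
      (∀ z ∈ offCorners (fun _ => ∅) A, z ∉ blockLines squarePlaquette ℓ i ω) →
        offCorners (fun _ => ∅) A = ∅ := by
  intro A hA ω hω h
  have hoff : offCorners (fun _ => ∅) A = A := by
    ext z; simp [mem_offCorners]
  rw [hoff] at h ⊢
  obtain ⟨hAb, hA⟩ := mem_evenSets.1 hA
  have hω' := mem_lineIndex.1 hω
  set a : ℤ → ℤ → Prop := fun p q => (((ℓ : ℤ) * i.1 + p, (ℓ : ℤ) * i.2 + q) : Site) ∈ A with ha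
  have hline : ∀ p q : ℤ, (q = ω.1 ∨ p = ω.2.1 ∨ p = ω.2.2) → ¬a p q := by
    intro p q hpq hm
    refine h _ hm (Finset.mem_filter.2 ⟨hAb hm, ?_⟩)
    simp only
    omega
  have hx : ∀ p q : ℤ, 1 ≤ p → p ≤ ℓ → 1 ≤ q → q ≤ ℓ →
      (((ℓ : ℤ) * i.1 + p, (ℓ : ℤ) * i.2 + q) : Site) ∈ block ℓ i := by
    intro p q h1 h2 h3 h4
    rw [mem_block]
    simp only
    omega
  have key := square_propagate (ℓ := ℓ) (j₀ := ω.1) (i₀ := ω.2.1) a ?_ ?_ ?_ ?_ (by omega)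
    (by omega) (by omega) (by omega) (fun p _ _ => hline p _ (by omega))
    (fun q _ _ => hline _ q (by omega))
  · rw [Finset.eq_empty_iff_forall_notMem]
    intro z hz
    have hc := block_coords (cornerSystem_square (by omega)) (hAb hz)
    have := key (z.2 - ℓ * i.2) (by omega) (by omega) (z.1 - ℓ * i.1) (by omega) (by omega)
    apply this
    simp only [ha, add_sub_cancel]
    exact hz
  all_goals
    intro p q h1 h2 h3 h4 n1 n2 n3
    refine hA.notMem (hx p q h1 h2 h3 h4) ?_ ?_
    · rw [mem_plaquette_square]
      simp [Prod.mk.injEq, add_sub_assoc]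
    · intro z hz hxz
      rw [mem_plaquette_square] at hxz
      simp only [ha, add_sub_assoc'] at n1 n2 n3
      rcases hxz with rfl | rfl | rfl | rfl <;>
        first
        | exact absurd hz n1
        | exact absurd hz n2
        | exact absurd hz n3
        | simp only [add_sub_assoc]

/-- A set of the expansion in a block which avoids a row and two columns of the block, apart from the
corners, lies in the corners. -/
theorem triangle_determined {ℓ m : ℕ} (hm : 1 ≤ m) (hℓ : 4 * m ≤ ℓ) (i : Site) :
    ∀ A ∈ evenSets trianglePlaquette (block ℓ i), ∀ ω ∈ lineIndex m,
      (∀ z ∈ offCorners (triangleCorner ℓ m) A, z ∉ blockLines trianglePlaquette ℓ i ω) →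
        offCorners (triangleCorner ℓ m) A = ∅ := by
  intro A hA ω hω h
  obtain ⟨hAb, hA⟩ := mem_evenSets.1 hA
  have hω' := mem_lineIndex.1 hω
  have hℓp : (0 : ℤ) < ℓ := by omega
  set a : ℤ → ℤ → Prop := fun p q => (((ℓ : ℤ) * i.1 + p, (ℓ : ℤ) * i.2 + q) : Site) ∈ A with ha
  -- a point of the block lies only in its own corner or on the two sides shared with neighbours
  have hcorner : ∀ p q : ℤ, 0 ≤ p → p ≤ ℓ → 0 ≤ q → q ≤ ℓ →
      ((ℓ * i.1 + p, ℓ * i.2 + q) : Site) ∈ ⋃ j, triangleCorner ℓ m j →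
      ((p < m ∨ p = ℓ) ∧ ((ℓ : ℤ) - m < q ∨ q = 0)) ∧
        (p < ℓ → 0 < q → (ℓ : ℤ) - m < q - p) := by
    intro p q h1 h2 h3 h4 hmem
    obtain ⟨k, hk1, hk2, hk3⟩ := Set.mem_iUnion.1 hmem
    simp only at hk1 hk2 hk3
    obtain ⟨u, hu⟩ : ∃ u, k.1 = i.1 + u := ⟨k.1 - i.1, by ring⟩
    obtain ⟨v, hv⟩ : ∃ v, k.2 = i.2 + v := ⟨k.2 - i.2, by ring⟩
    rw [hu, hv] at hk3
    rw [hu] at hk1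
    rw [hv] at hk2
    have e1 : (ℓ : ℤ) * u ≤ p := by linarith
    have e2 : q ≤ ℓ * v + ℓ := by linarith
    have e3 : (ℓ : ℤ) - m < q - ℓ * v - p + ℓ * u := by linarith
    have u1 : u < 2 := by
      by_contra hc
      have : (ℓ : ℤ) * 2 ≤ ℓ * u := mul_le_mul_of_nonneg_left (by omega) hℓp.le
      omega
    have u0 : -1 < u := by
      by_contra hc
      have : (ℓ : ℤ) * u ≤ ℓ * (-1) := mul_le_mul_of_nonneg_left (by omega) hℓp.le
      omega
    have v1 : v < 1 := by
      by_contra hc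
      have : (ℓ : ℤ) * 1 ≤ ℓ * v := mul_le_mul_of_nonneg_left (by omega) hℓp.le
      omega
    have v0 : -2 < v := by
      by_contra hc
      have : (ℓ : ℤ) * v ≤ ℓ * (-2) := mul_le_mul_of_nonneg_left (by omega) hℓp.le
      omega
    obtain rfl | rfl : u = 0 ∨ u = 1 := by omega
    all_goals
      obtain rfl | rfl : v = 0 ∨ v = -1 := by omega
      all_goals
        simp only [mul_zero, mul_one, mul_neg] at e1 e2 e3
        omega
  have hline : ∀ p q : ℤ, 0 ≤ p → p ≤ ℓ → 0 ≤ q → q ≤ ℓ → (q = ω.1 ∨ p = ω.2.1 ∨ p = ω.2.2) →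
      ((ℓ * i.1 + p, ℓ * i.2 + q) : Site) ∉ ⋃ j, triangleCorner ℓ m j → ¬a p q := by
    intro p q _ _ _ _ hpq hc hmem
    refine h _ (mem_offCorners.2 ⟨hmem, hc⟩) (Finset.mem_filter.2 ⟨hAb hmem, ?_⟩)
    simp only
    omega
  have hx : ∀ p q : ℤ, 1 ≤ p → p ≤ ℓ → 1 ≤ q → q ≤ ℓ →
      (((ℓ : ℤ) * i.1 + p, (ℓ : ℤ) * i.2 + q) : Site) ∈ block ℓ i := by
    intro p q h1 h2 h3 h4
    rw [mem_block]
    simp only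
    omega
  have key := triangle_propagate (ℓ := ℓ) (m := m) (j₀ := ω.1) (i₀ := ω.2.1) (i₁ := ω.2.2) a
    ?_ ?_ ?_ (by omega) (by omega) (by omega) (by omega) (by omega) (by omega) (by omega)
    (fun p h1 h2 => hline p _ h1 h2 (by omega) (by omega) (by omega) fun hc => by
      have := hcorner p ω.1 h1 h2 (by omega) (by omega) hc
      omega)
    (fun q h1 h2 h3 => hline _ q (by omega) (by omega) (by omega) h2 (by omega) fun hc => by
      have := hcorner ω.2.1 q (by omega) (by omega) (by omega) h2 hc
      omega)
    (fun q h1 h2 => hline _ q (by omega) (by omega) h1 h2 (by omega) fun hc => by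
      have := hcorner ω.2.2 q (by omega) (by omega) h1 h2 hc
      omega)
  · rw [Finset.eq_empty_iff_forall_notMem]
    intro z hz
    obtain ⟨hzA, hzF⟩ := mem_offCorners.1 hz
    have hc := block_coords (cornerSystem_triangle hm hℓ) (hAb hzA)
    have hd : (z.2 - ℓ * i.2) - (z.1 - ℓ * i.1) ≤ (ℓ : ℤ) - m := by
      by_contra hcon
      exact hzF (Set.mem_iUnion.2 ⟨i, hc.1.1, hc.2.2, by omega⟩)
    have := key (z.1 - ℓ * i.1) (z.2 - ℓ * i.2) (by omega) (by omega) (by omega) (by omega) hd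
    apply this
    simp only [ha, add_sub_cancel]
    exact hzA
  all_goals
    intro p q h1 h2 h3 h4 n1 n2
    refine hA.notMem (hx p q h1 h2 h3 h4) ?_ ?_
    · rw [mem_plaquette_triangle]
      simp [Prod.mk.injEq, add_sub_assoc]
    · intro z hz hxz
      rw [mem_plaquette_triangle] at hxz
      simp only [ha, add_sub_assoc'] at n1 n2
      rcases hxz with rfl | rfl | rfl <;>
        first
        | exact absurd hz n1
        | exact absurd hz n2
        | simp only [add_sub_assoc]

/-! ### The scale on which the blocks decouple -/

/-- The scale `⌈K (β + 1) e^β⌉`. -/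
noncomputable def scale (K β : ℝ) : ℕ := ⌈K * (β + 1) * Real.exp β⌉₊

theorem le_scale (K β : ℝ) : K * (β + 1) * Real.exp β ≤ scale K β := Nat.le_ceil _

theorem scale_le {K β : ℝ} (hK : 1 ≤ K) (hβ : 0 < β) :
    (scale K β : ℝ) ≤ 2 * K * ((β + 1) * Real.exp β) := by
  have h1 : 1 ≤ Real.exp β := Real.one_le_exp hβ.le
  have h2 : 1 ≤ (β + 1) * Real.exp β := by nlinarith
  have h3 : 1 ≤ K * (β + 1) * Real.exp β := by nlinarith
  have := (Nat.ceil_lt_add_one (by linarith : 0 ≤ K * (β + 1) * Real.exp β)).le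
  unfold scale
  linarith

theorem sixteen_le_scale {K β : ℝ} (hK : 16 ≤ K) (hβ : 0 < β) : 16 ≤ scale K β := by
  have h1 : 1 ≤ Real.exp β := Real.one_le_exp hβ.le
  have h2 : 1 ≤ (β + 1) * Real.exp β := by nlinarith
  have h3 : 16 ≤ K * (β + 1) * Real.exp β := by nlinarith
  exact_mod_cast h3.trans (le_scale K β)

theorem scale_le_exp {K β : ℝ} (hK : 1 ≤ K) (hβ : 0 < β) :
    (scale K β : ℝ) ≤ 2 * K * Real.exp (2 * (β + 1)) := by
  refine (scale_le hK hβ).trans ?_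
  have h1 : β + 1 ≤ Real.exp β := Real.add_one_le_exp β
  have h2 : (β + 1) * Real.exp β ≤ Real.exp (2 * (β + 1)) := by
    calc (β + 1) * Real.exp β ≤ Real.exp β * Real.exp β := by gcongr
      _ = Real.exp (2 * β) := by rw [← Real.exp_add]; ring_nf
      _ ≤ _ := Real.exp_le_exp.2 (by linarith)
  gcongr

theorem isBigO_scale {K : ℝ} (hK : 1 ≤ K) :
    (fun β : ℝ => (scale K β : ℝ)) =O[atTop] (fun β : ℝ => β * Real.exp β) := by
  refine IsBigO.of_bound (4 * K) ?_
  filter_upwards [eventually_ge_atTop 1] with β hβ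
  rw [Real.norm_of_nonneg (Nat.cast_nonneg _), Real.norm_of_nonneg (by positivity)]
  refine (scale_le hK (by linarith)).trans ?_
  have h : (β + 1) * Real.exp β ≤ 2 * (β * Real.exp β) := by
    nlinarith [Real.exp_pos β]
  nlinarith

theorem exists_pow_mul_exp_le {ε : ℝ} (hε : 0 < ε) (K₀ : ℝ) :
    ∃ K : ℝ, K₀ ≤ K ∧ K ^ 5 * Real.exp (-(K / 768)) ≤ ε := by
  have h : Tendsto (fun K : ℝ => 768 ^ 5 * ((K / 768) ^ 5 * Real.exp (-(K / 768)))) atTop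
      (𝓝 (768 ^ 5 * 0)) :=
    ((Real.tendsto_pow_mul_exp_neg_atTop_nhds_zero 5).comp
      (tendsto_id.atTop_div_const (by norm_num : (0 : ℝ) < 768))).const_mul _
  rw [mul_zero] at h
  obtain ⟨K, h1, h2⟩ := ((eventually_ge_atTop K₀).and (h.eventually_le_const hε)).exists
  refine ⟨K, h1, ?_⟩
  calc K ^ 5 * Real.exp (-(K / 768)) = 768 ^ 5 * ((K / 768) ^ 5 * Real.exp (-(K / 768))) := by ring
    _ ≤ ε := h2

/-- On the scale `⌈K (β + 1) e^β⌉` the bound for the sum over the nonempty classes of a block is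
smaller than any given multiple of `e^{-cβ} / ℓ`, uniformly in `β`. -/
theorem exists_scale_bound {ε : ℝ} (hε : 0 < ε) {c : ℝ} (hc : 0 ≤ c) :
    ∃ K : ℝ, 16 ≤ K ∧ ∀ β : ℝ, 0 < β →
      (((scale K β / 16 : ℕ) : ℝ) ^ 3 *
        ((1 + Real.exp (-(Real.exp (-β) / 4 * ((scale K β / 16 : ℕ) : ℝ) / 3))) ^
          (3 * (scale K β + 1)) - 1)) * (scale K β * Real.exp (c * β)) ≤ ε := by
  obtain ⟨K, hK0, hK⟩ := exists_pow_mul_exp_le (ε := min ε 1 / 384) (by positivity)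
    (max 16 (768 * (10 + c)))
  have hK16 : 16 ≤ K := (le_max_left _ _).trans hK0
  have hKc : 768 * (10 + c) ≤ K := (le_max_right _ _).trans hK0
  refine ⟨K, hK16, fun β hβ => ?_⟩
  have hl16 := sixteen_le_scale hK16 hβ
  have hle := scale_le_exp (by linarith : (1 : ℝ) ≤ K) hβ
  have hge := le_scale K β
  set ℓ := scale K β with hℓ
  have hl1 : (1 : ℝ) ≤ ℓ := by exact_mod_cast (by omega : 1 ≤ ℓ)
  have hm1 : ((ℓ / 16 : ℕ) : ℝ) ≤ ℓ := by exact_mod_cast Nat.div_le_self _ _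
  have hm2 : (ℓ : ℝ) / 32 ≤ ((ℓ / 16 : ℕ) : ℝ) := by
    have : ℓ ≤ 32 * (ℓ / 16) := by omega
    have : (ℓ : ℝ) ≤ 32 * ((ℓ / 16 : ℕ) : ℝ) := by exact_mod_cast this
    linarith
  set m : ℝ := ((ℓ / 16 : ℕ) : ℝ) with hm
  have hm0 : 0 ≤ m := Nat.cast_nonneg _
  set u := Real.exp (-(Real.exp (-β) / 4 * m / 3)) with hu
  have hexp : K * (β + 1) / 384 ≤ Real.exp (-β) / 4 * m / 3 := by
    have h1 : Real.exp (-β) * (K * (β + 1) * Real.exp β) = K * (β + 1) := by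
      rw [Real.exp_neg]; field_simp
    have h2 : Real.exp (-β) * (K * (β + 1) * Real.exp β / 32) ≤ Real.exp (-β) * m := by
      gcongr; linarith
    have h3 : Real.exp (-β) * (K * (β + 1) * Real.exp β / 32) = K * (β + 1) / 32 := by
      linear_combination h1 / 32
    linarith
  have hu0 : 0 < u := Real.exp_pos _
  have hu1 : u ≤ Real.exp (-(K * (β + 1) / 384)) := Real.exp_le_exp.2 (by linarith)
  -- the quantity which dominates everything
  have hmain : 12 * (ℓ : ℝ) ^ 5 * u * Real.exp (c * β) ≤ min ε 1 := by
    calc 12 * (ℓ : ℝ) ^ 5 * u * Real.exp (c * β)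
        ≤ 12 * (2 * K * Real.exp (2 * (β + 1))) ^ 5 * Real.exp (-(K * (β + 1) / 384)) *
          Real.exp (c * (β + 1)) := by
          gcongr; linarith
      _ = 384 * K ^ 5 * Real.exp (5 * (2 * (β + 1)) + -(K * (β + 1) / 384) + c * (β + 1)) := by
          rw [Real.exp_add, Real.exp_add, mul_pow, mul_pow, ← Real.exp_nat_mul]
          push_cast; ring
      _ ≤ 384 * K ^ 5 * Real.exp (-(K / 768)) := by
          gcongr
          have h2 : 768 * (10 + c) * (β + 1) ≤ K * (β + 1) := by gcongr
          have h3 : K * 1 ≤ K * (β + 1) := by gcongr; linarith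
          linarith
      _ ≤ min ε 1 := by linarith
  have hec : 1 ≤ Real.exp (c * β) := Real.one_le_exp (by positivity)
  have hv : ((3 * (ℓ + 1) : ℕ) : ℝ) * u ≤ 6 * ℓ * u := by
    push_cast; nlinarith
  have hv1 : 6 * ℓ * u ≤ 1 := by
    refine le_trans ?_ (hmain.trans (min_le_right _ _))
    calc 6 * ℓ * u = 6 * ℓ * u * 1 := by ring
      _ ≤ 6 * ℓ ^ 5 * u * Real.exp (c * β) := by
          gcongr; exact le_self_pow₀ hl1 (by norm_num)
      _ ≤ _ := by
          have : 0 ≤ (ℓ : ℝ) ^ 5 * u * Real.exp (c * β) := by positivity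
          linarith
  have hpow : (1 + u) ^ (3 * (ℓ + 1)) - 1 ≤ 2 * (6 * ℓ * u) := by
    have h1 : (1 + u) ^ (3 * (ℓ + 1)) ≤ Real.exp (6 * ℓ * u) := by
      calc (1 + u) ^ (3 * (ℓ + 1)) ≤ Real.exp u ^ (3 * (ℓ + 1)) := by
            gcongr; linarith [Real.add_one_le_exp u]
        _ = Real.exp (((3 * (ℓ + 1) : ℕ) : ℝ) * u) := (Real.exp_nat_mul _ _).symm
        _ ≤ _ := Real.exp_le_exp.2 hv
    have h0 : 0 ≤ 6 * ℓ * u := by positivity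
    have h2 := Real.abs_exp_sub_one_le (x := 6 * ℓ * u) (by rwa [abs_of_nonneg h0])
    rw [abs_of_nonneg h0] at h2
    linarith [le_abs_self (Real.exp (6 * ℓ * u) - 1)]
  calc m ^ 3 * ((1 + u) ^ (3 * (ℓ + 1)) - 1) * (ℓ * Real.exp (c * β))
      ≤ (ℓ : ℝ) ^ 3 * (2 * (6 * ℓ * u)) * (ℓ * Real.exp (c * β)) := by
        have hp0 : 0 ≤ (1 + u) ^ (3 * (ℓ + 1)) - 1 :=
          sub_nonneg.2 (one_le_pow₀ (by linarith))
        gcongr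
    _ = 12 * (ℓ : ℝ) ^ 5 * u * Real.exp (c * β) := by ring
    _ ≤ ε := hmain.trans (min_le_left _ _)

/-- Corners of size `ℓ / 16` are small enough for two sites at distance at least `ℓ / 4` not to
meet plaquettes of the same corner. -/
theorem exists_cornerSystem {P : Finset Site} (hP : P = squarePlaquette ∨ P = trianglePlaquette)
    {ℓ : ℕ} (hℓ : 16 ≤ ℓ) : ∃ F : Site → Set Site, CornerSystem P ℓ F ∧
      (∀ (i : Site) (a : ℝ), 0 ≤ a → ∑ c ∈ (blockClasses P ℓ F i).erase ∅, Real.exp (-a) ^ c.card ≤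
        ((ℓ / 16 : ℕ) : ℝ) ^ 3 *
          ((1 + Real.exp (-(a * ((ℓ / 16 : ℕ) : ℝ) / 3))) ^ (3 * (ℓ + 1)) - 1)) ∧
      ∀ x y : Site, (ℓ : ℝ) / 4 ≤ l1Dist x y → ∀ j, ∀ z ∈ F j, ∀ z' ∈ F j,
        x ∈ plaquette P z → y ∉ plaquette P z' := by
  have hm : 1 ≤ ℓ / 16 := by omega
  have hm4 : 4 * (ℓ / 16) ≤ ℓ := by omega
  rcases hP with rfl | rfl
  · have hF := cornerSystem_square (by omega : 1 ≤ ℓ)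
    refine ⟨_, hF, fun i a ha => sum_blockClasses_le hF hm (square_determined hm4 i) ha, ?_⟩
    intro x y _ j z hz
    exact absurd hz (Set.notMem_empty z)
  · have hF := cornerSystem_triangle hm hm4
    refine ⟨_, hF, fun i a ha => sum_blockClasses_le hF hm (triangle_determined hm hm4 i) ha, ?_⟩
    intro x y hxy j z hz z' hz' hx hy
    have hd : ℓ ≤ 4 * l1Dist x y := by
      have : (ℓ : ℝ) ≤ 4 * (l1Dist x y : ℝ) := by linarith
      exact_mod_cast this
    rw [mem_plaquette_triangle] at hx hy
    simp only [triangleCorner, Set.mem_ofPred_eq] at hz hz'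
    unfold l1Dist at hd
    obtain ⟨x1, x2⟩ := x
    obtain ⟨y1, y2⟩ := y
    obtain ⟨z1, z2⟩ := z
    obtain ⟨w1, w2⟩ := z'
    simp only [Prod.mk.injEq] at hx hy hz hz' hd
    generalize (ℓ : ℤ) * j.1 = A at *
    generalize (ℓ : ℤ) * j.2 = B at *
    rcases hx with hx | hx | hx <;> rcases hy with hy | hy | hy <;> omega

theorem exp_neg_quarter_pow (β : ℝ) :
    Real.exp (-(Real.exp (-β) / 4)) ^ 4 = Real.exp (-Real.exp (-β)) := by
  rw [← Real.exp_nat_mul]; push_cast; ring_nf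

/-- Two flips outside a regular volume decouple exponentially on the scale `⌈K (β + 1) e^β⌉`. -/
theorem exists_scale_blockUnion {P : Finset Site}
    (hP : P = squarePlaquette ∨ P = trianglePlaquette) : ∃ K : ℝ, 16 ≤ K ∧ ∀ β : ℝ, 0 < β →
      ∀ (I : Finset Site) (τ : Config) (x y : Site), (scale K β : ℝ) / 4 ≤ l1Dist x y →
        |partitionFn P β (blockUnion (scale K β) I) (flip x (flip y τ)) *
              partitionFn P β (blockUnion (scale K β) I) τ -
            partitionFn P β (blockUnion (scale K β) I) (flip x τ) *
              partitionFn P β (blockUnion (scale K β) I) (flip y τ)| ≤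
          2 * 8 ^ 162 * Real.exp (18 - l1Dist x y / scale K β) *
            (partitionFn P β (blockUnion (scale K β) I) (flip x τ) *
              partitionFn P β (blockUnion (scale K β) I) (flip y τ)) := by
  obtain ⟨K, hK, h⟩ := exists_scale_bound
    (ε := 1 / (4 ^ (25 + 1) * (2 ^ 25 * Real.exp 4))) (by positivity) le_rfl
  refine ⟨K, hK, fun β hβ I τ x y hxy => ?_⟩
  have hℓ := sixteen_le_scale hK hβ
  specialize h β hβ
  obtain ⟨F, hF, hsum, hcor⟩ := exists_cornerSystem hP hℓ
  have hpos : (0 : ℝ) ≤ Real.exp (-β) / 4 := by positivity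
  have hδ := fun i => hsum i _ hpos
  set δ := ((scale K β / 16 : ℕ) : ℝ) ^ 3 *
    ((1 + Real.exp (-(Real.exp (-β) / 4 * ((scale K β / 16 : ℕ) : ℝ) / 3))) ^
      (3 * (scale K β + 1)) - 1)
  have hδ0 : 0 ≤ δ := le_trans (Finset.sum_nonneg fun c _ => by positivity) (hδ 0)
  have hl1 : (1 : ℝ) ≤ scale K β := by exact_mod_cast (by omega : 1 ≤ scale K β)
  refine partitionFn_mul_sub_le hF hβ (Real.exp_pos _).le
    (Real.exp_le_one_iff.2 (neg_nonpos.2 hpos)) ?_ hδ0 hδ ?_ I τ (hcor x y hxy)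
  · rw [exp_neg_quarter_pow]
    exact htParam_le hβ
  · rw [zero_mul, Real.exp_zero, mul_one] at h
    rw [← le_div_iff₀ (by positivity)]
    nlinarith

/-- For a single block the decoupling error is as small as desired. -/
theorem exists_scale_block {P : Finset Site}
    (hP : P = squarePlaquette ∨ P = trianglePlaquette) {ε : ℝ} (hε : 0 < ε) {c : ℝ} (hc : 0 ≤ c) :
    ∃ K : ℝ, 16 ≤ K ∧ ∀ β : ℝ, 0 < β →
      ∀ (τ : Config) (x y : Site), (scale K β : ℝ) / 4 ≤ l1Dist x y →
        |partitionFn P β (block (scale K β) 0) (flip x (flip y τ)) *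
              partitionFn P β (block (scale K β) 0) τ -
            partitionFn P β (block (scale K β) 0) (flip x τ) *
              partitionFn P β (block (scale K β) 0) (flip y τ)| * (scale K β * Real.exp (c * β)) ≤
          ε * (partitionFn P β (block (scale K β) 0) (flip x τ) *
              partitionFn P β (block (scale K β) 0) (flip y τ)) := by
  obtain ⟨K, hK, h⟩ := exists_scale_bound (ε := min (1 / 4) (ε / 24)) (by positivity) hc
  refine ⟨K, hK, fun β hβ τ x y hxy => ?_⟩
  have hℓ := sixteen_le_scale hK hβ
  specialize h β hβ
  obtain ⟨F, hF, hsum, hcor⟩ := exists_cornerSystem hP hℓ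
  have hpos : (0 : ℝ) ≤ Real.exp (-β) / 4 := by positivity
  have hδ := fun i => hsum i _ hpos
  set δ := ((scale K β / 16 : ℕ) : ℝ) ^ 3 *
    ((1 + Real.exp (-(Real.exp (-β) / 4 * ((scale K β / 16 : ℕ) : ℝ) / 3))) ^
      (3 * (scale K β + 1)) - 1)
  have hδ0 : 0 ≤ δ := le_trans (Finset.sum_nonneg fun c _ => by positivity) (hδ 0)
  have hl1 : (1 : ℝ) ≤ scale K β := by exact_mod_cast (by omega : 1 ≤ scale K β)
  have hfac : 1 ≤ scale K β * Real.exp (c * β) := one_le_mul_of_one_le_of_one_le hl1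
    (Real.one_le_exp (by positivity))
  have hδ4 : δ ≤ 1 / 4 := le_trans (by nlinarith) (h.trans (min_le_left _ _))
  have key := partitionFn_mul_sub_le_single hF hβ (Real.exp_pos _).le
    (Real.exp_le_one_iff.2 (neg_nonpos.2 hpos)) (by
      rw [exp_neg_quarter_pow]
      exact htParam_le hβ) hδ0 hδ hδ4 0 τ (hcor x y hxy)
  have hZ : 0 ≤ partitionFn P β (block (scale K β) 0) (flip x τ) *
      partitionFn P β (block (scale K β) 0) (flip y τ) :=
    mul_nonneg (partitionFn_pos _ _ _ _).le (partitionFn_pos _ _ _ _).le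
  refine (mul_le_mul_of_nonneg_right key (by linarith)).trans ?_
  have h24 := h.trans (min_le_right _ _)
  calc _ = 24 * (δ * (scale K β * Real.exp (c * β))) * (partitionFn P β (block (scale K β) 0)
      (flip x τ) * partitionFn P β (block (scale K β) 0) (flip y τ)) := by ring
    _ ≤ _ := mul_le_mul_of_nonneg_right (by linarith) hZ

/-! ### Finite-volume expectations -/

section Expectation

variable {P : Finset Site} {β : ℝ} {Λ Λ' : Finset Site} {σ τ : Config} {f g : Config → ℝ}

theorem glue_congr (h : ∀ x, x ∉ Λ → σ x = τ x) (η : Λ → ℤˣ) : glue Λ σ η = glue Λ τ η := by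
  funext x
  by_cases hx : x ∈ Λ
  · rw [glue_of_mem hx, glue_of_mem hx]
  · rw [glue_of_notMem hx, glue_of_notMem hx, h x hx]

theorem cfgSum_boundary (h : ∀ x, x ∉ Λ → σ x = τ x) (F : Config → ℝ) :
    cfgSum Λ σ F = cfgSum Λ τ F :=
  Finset.sum_congr rfl fun η _ => by rw [glue_congr h]

theorem cfgSum_congr (h : ∀ σ, (∀ x, x ∉ Λ → σ x = τ x) → f σ = g σ) :
    cfgSum Λ τ f = cfgSum Λ τ g :=
  Finset.sum_congr rfl fun η _ => h _ fun _ hx => glue_of_notMem hx τ η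

theorem mul_cfgSum (c : ℝ) (F : Config → ℝ) :
    c * cfgSum Λ τ F = cfgSum Λ τ fun σ => c * F σ := Finset.mul_sum _ _ _

/-- Translation invariance of the sum over configurations, for the group structure of `Config`. -/
theorem cfgSum_mul (k : Config) (τ : Config) (F : Config → ℝ) :
    cfgSum Λ (k * τ) F = cfgSum Λ τ fun σ => F (k * σ) := by
  unfold cfgSum
  refine (Fintype.sum_equiv (Equiv.mulLeft fun x : Λ => k x) _ _ fun η => ?_).symm
  refine congrArg F (funext fun x => ?_)
  by_cases hx : x ∈ Λ
  · simp [glue_of_mem hx]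
  · simp [glue_of_notMem hx]

theorem flip_eq_mul (x : Site) (σ : Config) : flip x σ = Pi.mulSingle x (-1) * σ := by
  funext y
  by_cases h : y = x
  · subst h; simp
  · simp [flip_of_ne h, h]

theorem cfgSum_flip_boundary (x : Site) (τ : Config) (F : Config → ℝ) :
    cfgSum Λ (flip x τ) F = cfgSum Λ τ fun σ => F (flip x σ) := by
  simp only [flip_eq_mul, cfgSum_mul]

theorem cfgSum_eq_sum_mul (σ : Config) (F : Config → ℝ) :
    cfgSum Λ σ F = ∑ ε : Λ → ℤˣ, F (glue Λ 1 ε * σ) := by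
  unfold cfgSum
  refine (Fintype.sum_equiv (Equiv.mulRight fun x : Λ => σ x) _ _ fun η => ?_).symm
  congr 1
  funext x
  by_cases hx : x ∈ Λ
  · simp [glue_of_mem hx]
  · simp [glue_of_notMem hx]

/-- Summing out the spins in a smaller volume is a symmetric operation. -/
theorem cfgSum_mul_cfgSum (h : Λ' ⊆ Λ) (τ : Config) (F G : Config → ℝ) :
    cfgSum Λ τ (fun σ => F σ * cfgSum Λ' σ G) = cfgSum Λ τ fun σ => cfgSum Λ' σ F * G σ := by
  have h1 : ∀ k : Λ' → ℤˣ, cfgSum Λ τ (fun σ => F σ * G (glue Λ' 1 k * σ)) =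
      cfgSum Λ τ fun σ => F (glue Λ' 1 k * σ) * G σ := by
    intro k
    rw [← cfgSum_boundary (σ := glue Λ' 1 k * τ) (τ := τ) (fun x hx => by
      simp [glue_of_notMem (fun h' => hx (h h'))]), cfgSum_mul]
    congr 1
    funext σ
    have : glue Λ' 1 k * (glue Λ' 1 k * σ) = σ := by
      funext x
      simp [← mul_assoc, Int.units_mul_self]
    rw [this]
  have h2 : ∀ σ, F σ * cfgSum Λ' σ G = ∑ k : Λ' → ℤˣ, F σ * G (glue Λ' 1 k * σ) := fun σ => by
    rw [cfgSum_eq_sum_mul, Finset.mul_sum]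
  have h3 : ∀ σ, cfgSum Λ' σ F * G σ = ∑ k : Λ' → ℤˣ, F (glue Λ' 1 k * σ) * G σ := fun σ => by
    rw [cfgSum_eq_sum_mul, Finset.sum_mul]
  simp only [h2, h3]
  unfold cfgSum at h1 ⊢
  rw [Finset.sum_comm, Finset.sum_congr rfl fun k _ => h1 k, Finset.sum_comm]

theorem partitionFn_eq_cfgSum : partitionFn P β Λ τ = cfgSum Λ τ (boltzmann P β Λ) := rfl

theorem gibbsExp_eq_div :
    gibbsExp P β Λ τ f = cfgSum Λ τ (fun σ => boltzmann P β Λ σ * f σ) / partitionFn P β Λ τ := by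
  unfold gibbsExp gibbsProb cfgSum
  rw [Finset.sum_div]
  exact Finset.sum_congr rfl fun η _ => by ring

theorem gibbsProb_nonneg (η : Λ → ℤˣ) : 0 ≤ gibbsProb P β Λ τ η :=
  div_nonneg (Real.exp_pos _).le (partitionFn_pos _ _ _ _).le

theorem sum_gibbsProb : ∑ η : Λ → ℤˣ, gibbsProb P β Λ τ η = 1 := by
  unfold gibbsProb
  rw [← Finset.sum_div]
  exact div_self (partitionFn_pos _ _ _ _).ne'

theorem gibbsExp_congr (h : ∀ σ, (∀ x, x ∉ Λ → σ x = τ x) → f σ = g σ) :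
    gibbsExp P β Λ τ f = gibbsExp P β Λ τ g :=
  Finset.sum_congr rfl fun η _ => by rw [h _ fun _ hx => glue_of_notMem hx τ η]

theorem gibbsExp_const (c : ℝ) : gibbsExp P β Λ τ (fun _ => c) = c := by
  unfold gibbsExp
  rw [← Finset.sum_mul, sum_gibbsProb, one_mul]

theorem gibbsExp_sub : gibbsExp P β Λ τ (fun σ => f σ - g σ) =
    gibbsExp P β Λ τ f - gibbsExp P β Λ τ g := by
  unfold gibbsExp
  simp only [mul_sub, Finset.sum_sub_distrib]

theorem gibbsExp_const_mul (c : ℝ) : gibbsExp P β Λ τ (fun σ => c * f σ) =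
    c * gibbsExp P β Λ τ f := by
  unfold gibbsExp
  rw [Finset.mul_sum]
  exact Finset.sum_congr rfl fun η _ => by ring

theorem gibbsExp_mono (h : ∀ σ, (∀ x, x ∉ Λ → σ x = τ x) → f σ ≤ g σ) :
    gibbsExp P β Λ τ f ≤ gibbsExp P β Λ τ g :=
  Finset.sum_le_sum fun η _ => mul_le_mul_of_nonneg_left
    (h _ fun _ hx => glue_of_notMem hx τ η) (gibbsProb_nonneg η)

theorem abs_gibbsExp_le {c : ℝ} (h : ∀ σ, (∀ x, x ∉ Λ → σ x = τ x) → |f σ| ≤ c) :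
    |gibbsExp P β Λ τ f| ≤ c := by
  rw [abs_le]
  constructor
  · rw [← gibbsExp_const (P := P) (β := β) (Λ := Λ) (τ := τ) (-c)]
    exact gibbsExp_mono fun σ hσ => (abs_le.1 (h σ hσ)).1
  · conv_rhs => rw [← gibbsExp_const (P := P) (β := β) (Λ := Λ) (τ := τ) c]
    exact gibbsExp_mono fun σ hσ => (abs_le.1 (h σ hσ)).2

theorem abs_gibbsExp_sub_le {c a : ℝ} (h : ∀ σ, (∀ x, x ∉ Λ → σ x = τ x) → |f σ - a| ≤ c) :
    |gibbsExp P β Λ τ f - a| ≤ c := by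
  have := abs_gibbsExp_le (P := P) (β := β) h
  rwa [gibbsExp_sub, gibbsExp_const] at this

theorem gibbsExp_boundary (h : ∀ x, x ∉ Λ → σ x = τ x) :
    gibbsExp P β Λ σ f = gibbsExp P β Λ τ f := by
  rw [gibbsExp_eq_div, gibbsExp_eq_div, partitionFn_eq_cfgSum, partitionFn_eq_cfgSum,
    cfgSum_boundary h, cfgSum_boundary h]

/-- The expectation in `Λ` depends on the boundary condition only through the spins in plaquettes
which meet `Λ`, apart from the spins of which the observable is a function. -/
theorem gibbsExp_congr_of_range {S : Set Site} (hf : DependsOn f S)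
    (h : ∀ x, x ∉ Λ → (x ∈ S ∨ ∃ z ∈ basePoints P Λ, x ∈ plaquette P z) → σ x = τ x) :
    gibbsExp P β Λ σ f = gibbsExp P β Λ τ f := by
  have hb : ∀ η, boltzmann P β Λ (glue Λ σ η) = boltzmann P β Λ (glue Λ τ η) := fun η => by
    unfold boltzmann
    congr 2
    refine Finset.sum_congr rfl fun z hz => spinProd_congr fun x hx => ?_
    by_cases hxΛ : x ∈ Λ
    · rw [glue_of_mem hxΛ, glue_of_mem hxΛ]
    · rw [glue_of_notMem hxΛ, glue_of_notMem hxΛ, h x hxΛ (Or.inr ⟨z, hz, hx⟩)]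
  unfold gibbsExp gibbsProb partitionFn
  simp only [hb]
  refine Finset.sum_congr rfl fun η _ => ?_
  congr 1
  refine hf fun x hx => ?_
  by_cases hxΛ : x ∈ Λ
  · rw [glue_of_mem hxΛ, glue_of_mem hxΛ]
  · rw [glue_of_notMem hxΛ, glue_of_notMem hxΛ, h x hxΛ (Or.inl hx)]

theorem boltzmann_mul_swap (h : Λ' ⊆ Λ) (hσ : ∀ x, x ∉ Λ' → σ x = τ x) :
    boltzmann P β Λ σ * boltzmann P β Λ' τ = boltzmann P β Λ τ * boltzmann P β Λ' σ := by
  have h1 : ∀ σ, boltzmann P β Λ σ = boltzmann P β Λ' σ *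
      Real.exp (β / 2 * ∑ z ∈ basePoints P Λ \ basePoints P Λ', spinProd σ (plaquette P z)) := by
    intro σ
    unfold boltzmann
    rw [← Real.exp_add, ← mul_add, add_comm, Finset.sum_sdiff (basePoints_mono h)]
  have h2 : ∑ z ∈ basePoints P Λ \ basePoints P Λ', spinProd σ (plaquette P z) =
      ∑ z ∈ basePoints P Λ \ basePoints P Λ', spinProd τ (plaquette P z) :=
    Finset.sum_congr rfl fun z hz => spinProd_congr fun x hx => hσ x fun hx' =>
      (Finset.mem_sdiff.1 hz).2 (mem_basePoints.2 ⟨x, hx', hx⟩)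
  rw [h1 σ, h1 τ, h2]
  ring

/-- The finite-volume Gibbs measures are consistent. -/
theorem gibbsExp_gibbsExp (h : Λ' ⊆ Λ) (τ : Config) (f : Config → ℝ) :
    gibbsExp P β Λ τ (fun σ => gibbsExp P β Λ' σ f) = gibbsExp P β Λ τ f := by
  have key : cfgSum Λ τ (fun σ => boltzmann P β Λ σ * gibbsExp P β Λ' σ f) =
      cfgSum Λ τ fun σ => boltzmann P β Λ σ * f σ := by
    calc cfgSum Λ τ (fun σ => boltzmann P β Λ σ * gibbsExp P β Λ' σ f)
        = cfgSum Λ τ (fun σ => boltzmann P β Λ' σ *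
            cfgSum Λ' σ fun σ' => boltzmann P β Λ σ' * f σ' / partitionFn P β Λ' σ') := by
          refine cfgSum_congr fun σ _ => ?_
          rw [gibbsExp_eq_div, div_eq_mul_inv, mul_comm (cfgSum _ _ _), mul_cfgSum, mul_cfgSum,
            mul_cfgSum]
          refine cfgSum_congr fun σ' hσ' => ?_
          have e : partitionFn P β Λ' σ' = partitionFn P β Λ' σ := cfgSum_boundary hσ' _
          have s := boltzmann_mul_swap (P := P) (β := β) h hσ'
          rw [e, div_eq_mul_inv]
          linear_combination (-(f σ' * (partitionFn P β Λ' σ)⁻¹)) * s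
      _ = cfgSum Λ τ (fun σ => partitionFn P β Λ' σ *
            (boltzmann P β Λ σ * f σ / partitionFn P β Λ' σ)) := cfgSum_mul_cfgSum h τ _ _
      _ = _ := cfgSum_congr fun σ _ => by
          have := (partitionFn_pos P β Λ' σ).ne'
          field_simp
  rw [gibbsExp_eq_div, gibbsExp_eq_div, key]

/-- Functions of the spins outside `Λ` can be taken out of the expectation in `Λ`. -/
theorem gibbsExp_mul_left {S : Set Site} (hf : DependsOn f S) (hS : ∀ x ∈ S, x ∉ Λ) :
    gibbsExp P β Λ τ (fun σ => f σ * g σ) = f τ * gibbsExp P β Λ τ g := by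
  rw [← gibbsExp_const_mul]
  exact gibbsExp_congr fun σ hσ => by rw [hf fun x hx => hσ x (hS x hx)]

/-- The covariance with a function of the spins outside `Λ' ⊆ Λ` is the covariance with the
conditional expectation given these spins. -/
theorem gibbsCov_eq_gibbsExp {S : Set Site} (h : Λ' ⊆ Λ) (hf : DependsOn f S)
    (hS : ∀ x ∈ S, x ∉ Λ') :
    gibbsCov P β Λ τ f g = gibbsExp P β Λ τ fun σ => f σ *
      (gibbsExp P β Λ' σ g - gibbsExp P β Λ τ fun σ => gibbsExp P β Λ' σ g) := by
  unfold gibbsCov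
  rw [← gibbsExp_gibbsExp h τ fun σ => f σ * g σ]
  simp only [gibbsExp_mul_left hf hS, gibbsExp_gibbsExp h]
  rw [← gibbsExp_gibbsExp h τ g, mul_comm (gibbsExp P β Λ τ f), ← gibbsExp_const_mul,
    ← gibbsExp_sub]
  exact gibbsExp_congr fun σ _ => by ring

theorem gibbsCov_comm : gibbsCov P β Λ τ f g = gibbsCov P β Λ τ g f := by
  unfold gibbsCov
  rw [mul_comm (gibbsExp P β Λ τ f)]
  simp only [mul_comm (f _)]

theorem abs_gibbsCov_le {S : Set Site} {a c : ℝ} (h : Λ' ⊆ Λ) (hf : DependsOn f S)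
    (hS : ∀ x ∈ S, x ∉ Λ') (ha : ∀ σ, |f σ| ≤ a)
    (hc : ∀ σ σ', (∀ x, x ∉ Λ → σ x = τ x) → (∀ x, x ∉ Λ → σ' x = τ x) →
      |gibbsExp P β Λ' σ g - gibbsExp P β Λ' σ' g| ≤ c) :
    |gibbsCov P β Λ τ f g| ≤ a * c := by
  have ha0 : 0 ≤ a := (abs_nonneg _).trans (ha τ)
  rw [gibbsCov_eq_gibbsExp h hf hS]
  refine abs_gibbsExp_le fun σ hσ => ?_
  rw [abs_mul]
  gcongr
  · exact ha σ
  · rw [abs_sub_comm]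
    exact abs_gibbsExp_sub_le fun σ' hσ' => hc σ' σ hσ' hσ

theorem abs_gibbsCov_le_two {a b : ℝ} (ha : ∀ σ, |f σ| ≤ a) (hb : ∀ σ, |g σ| ≤ b) :
    |gibbsCov P β Λ τ f g| ≤ 2 * a * b := by
  have ha0 : 0 ≤ a := (abs_nonneg _).trans (ha τ)
  have h1 : |gibbsExp P β Λ τ fun σ => f σ * g σ| ≤ a * b :=
    abs_gibbsExp_le fun σ _ => by rw [abs_mul]; exact mul_le_mul (ha σ) (hb σ) (abs_nonneg _) ha0
  have h2 : |gibbsExp P β Λ τ f * gibbsExp P β Λ τ g| ≤ a * b := by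
    rw [abs_mul]
    exact mul_le_mul (abs_gibbsExp_le fun σ _ => ha σ) (abs_gibbsExp_le fun σ _ => hb σ)
      (abs_nonneg _) ha0
  have h3 := abs_sub (gibbsExp P β Λ τ fun σ => f σ * g σ) (gibbsExp P β Λ τ f * gibbsExp P β Λ τ g)
  unfold gibbsCov
  linarith

end Expectation

/-! ### The response to a flipped boundary spin -/

section Flip

variable {P : Finset Site} {β : ℝ} {Λ : Finset Site} {σ τ : Config} {f g : Config → ℝ}

theorem dependsOn_flip_eq {S : Set Site} (hf : DependsOn f S) {x : Site} (hx : x ∉ S)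
    (σ : Config) : f (flip x σ) = f σ :=
  hf fun y hy => flip_of_ne (fun h : y = x => hx (h ▸ hy)) σ

/-- The part of `h_x` which comes from the plaquettes which do not meet `Λ`. -/
noncomputable def outerWeight (P : Finset Site) (β : ℝ) (Λ : Finset Site) (x : Site)
    (σ : Config) : ℝ :=
  Real.exp (β / 2 * ∑ z ∈ basePoints P {x} \ basePoints P Λ,
    (spinProd (flip x σ) (plaquette P z) - spinProd σ (plaquette P z)))

theorem outerWeight_pos (x : Site) (σ : Config) : 0 < outerWeight P β Λ x σ := Real.exp_pos _

theorem outerWeight_congr {x : Site} (h : ∀ y, y ∉ Λ → σ y = τ y) :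
    outerWeight P β Λ x σ = outerWeight P β Λ x τ := by
  unfold outerWeight
  congr 2
  refine Finset.sum_congr rfl fun z hz => ?_
  have : spinProd σ (plaquette P z) = spinProd τ (plaquette P z) :=
    spinProd_congr fun y hy => h y fun hy' =>
      (Finset.mem_sdiff.1 hz).2 (mem_basePoints.2 ⟨y, hy', hy⟩)
  rw [spinProd_flip, spinProd_flip, this]

theorem flipWeight_mul_boltzmann (x : Site) (σ : Config) :
    flipWeight P β x σ * boltzmann P β Λ σ =
      outerWeight P β Λ x σ * boltzmann P β Λ (flip x σ) := by
  unfold flipWeight boltzmann outerWeight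
  rw [← Real.exp_add, ← Real.exp_add, ← mul_add, ← mul_add]
  congr 2
  rw [← Finset.sum_sdiff (Finset.inter_subset_left : basePoints P {x} ∩ basePoints P Λ ⊆ _),
    Finset.sdiff_inter_self_left, add_assoc]
  congr 1
  rw [Finset.sum_subset Finset.inter_subset_right, ← Finset.sum_add_distrib]
  · exact Finset.sum_congr rfl fun z _ => sub_add_cancel _ _
  · intro z hz hz'
    have hx : x ∉ plaquette P z := fun h =>
      hz' (Finset.mem_inter.2 ⟨mem_basePoints_singleton.2 h, hz⟩)
    rw [spinProd_flip, if_neg hx, sub_self]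

theorem dependsOn_flipWeight (x : Site) :
    DependsOn (flipWeight P β x) {y | ∃ z, x ∈ plaquette P z ∧ y ∈ plaquette P z} := by
  intro σ τ h
  unfold flipWeight
  congr 2
  refine Finset.sum_congr rfl fun z hz => ?_
  have : spinProd σ (plaquette P z) = spinProd τ (plaquette P z) :=
    spinProd_congr fun y hy => h y ⟨z, mem_basePoints_singleton.1 hz, hy⟩
  rw [spinProd_flip, spinProd_flip, this]

theorem gibbsExp_flipWeight_mul (x : Site) (τ : Config) (f : Config → ℝ) :
    gibbsExp P β Λ τ (fun σ => flipWeight P β x σ * f σ) =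
      outerWeight P β Λ x τ * (partitionFn P β Λ (flip x τ) / partitionFn P β Λ τ) *
        gibbsExp P β Λ (flip x τ) fun σ => f (flip x σ) := by
  have h1 : cfgSum Λ τ (fun σ => boltzmann P β Λ σ * (flipWeight P β x σ * f σ)) =
      outerWeight P β Λ x τ * cfgSum Λ (flip x τ)
        fun σ => boltzmann P β Λ σ * f (flip x σ) := by
    rw [cfgSum_flip_boundary, mul_cfgSum]
    refine cfgSum_congr fun σ hσ => ?_
    rw [flip_flip, ← outerWeight_congr hσ, ← mul_assoc (outerWeight _ _ _ _ _),
      ← flipWeight_mul_boltzmann]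
    ring
  rw [gibbsExp_eq_div, gibbsExp_eq_div, h1]
  have := (partitionFn_pos P β Λ (flip x τ)).ne'
  field_simp

theorem gibbsExp_flipWeight (x : Site) (τ : Config) :
    gibbsExp P β Λ τ (flipWeight P β x) =
      outerWeight P β Λ x τ * (partitionFn P β Λ (flip x τ) / partitionFn P β Λ τ) := by
  have := gibbsExp_flipWeight_mul (P := P) (β := β) (Λ := Λ) x τ fun _ => 1
  simpa [gibbsExp_const] using this

/-- Flipping a boundary spin changes expectations by a normalised covariance with `h_x`. -/
theorem gibbsCov_flipWeight {x : Site} (hf : ∀ σ, f (flip x σ) = f σ) (τ : Config) :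
    gibbsCov P β Λ τ (flipWeight P β x) f = gibbsExp P β Λ τ (flipWeight P β x) *
      (gibbsExp P β Λ (flip x τ) f - gibbsExp P β Λ τ f) := by
  unfold gibbsCov
  rw [gibbsExp_flipWeight_mul, ← gibbsExp_flipWeight]
  simp only [hf]
  ring

theorem gibbsExp_flipWeight_pos (x : Site) (τ : Config) :
    0 < gibbsExp P β Λ τ (flipWeight P β x) := by
  rw [gibbsExp_flipWeight]
  exact mul_pos (outerWeight_pos _ _) (div_pos (partitionFn_pos _ _ _ _) (partitionFn_pos _ _ _ _))

theorem flipWeight_flip {x y : Site} (hxy : ∀ z, x ∈ plaquette P z → y ∉ plaquette P z)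
    (σ : Config) : flipWeight P β y (flip x σ) = flipWeight P β y σ :=
  dependsOn_flip_eq (dependsOn_flipWeight y) (by rintro ⟨z, hy, hx⟩; exact hxy z hx hy) σ

theorem outerWeight_flip {x y : Site} (hxy : ∀ z, x ∈ plaquette P z → y ∉ plaquette P z)
    (σ : Config) : outerWeight P β Λ y (flip x σ) = outerWeight P β Λ y σ := by
  unfold outerWeight
  congr 2
  refine Finset.sum_congr rfl fun z hz => ?_
  have hx : x ∉ plaquette P z := fun h =>
    hxy z h (mem_basePoints_singleton.1 (Finset.mem_sdiff.1 hz).1)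
  rw [flip_comm, spinProd_flip x, if_neg hx, spinProd_flip x, if_neg hx]

/-- Decoupling of the partition functions turns into a bound for the influence of the spin at `x`
on the expectation of `h_y`. -/
theorem abs_gibbsExp_flipWeight_sub_le {x y : Site} {ε : ℝ}
    (hxy : ∀ z, x ∈ plaquette P z → y ∉ plaquette P z)
    (h : |partitionFn P β Λ (flip x (flip y τ)) * partitionFn P β Λ τ -
        partitionFn P β Λ (flip x τ) * partitionFn P β Λ (flip y τ)| ≤
      ε * (partitionFn P β Λ (flip x τ) * partitionFn P β Λ (flip y τ))) :
    |gibbsExp P β Λ (flip x τ) (flipWeight P β y) - gibbsExp P β Λ τ (flipWeight P β y)| ≤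
      ε * gibbsExp P β Λ τ (flipWeight P β y) := by
  have h0 := partitionFn_pos P β Λ τ
  have hx := partitionFn_pos P β Λ (flip x τ)
  rw [gibbsExp_flipWeight, gibbsExp_flipWeight, outerWeight_flip hxy, ← mul_sub,
    div_sub_div _ _ hx.ne' h0.ne', abs_mul, abs_of_pos (outerWeight_pos _ _), abs_div,
    abs_of_pos (mul_pos hx h0), mul_left_comm]
  refine mul_le_mul_of_nonneg_left ?_ (outerWeight_pos _ _).le
  rw [div_le_iff₀ (mul_pos hx h0), flip_comm y x]
  refine h.trans (le_of_eq ?_)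
  field_simp

theorem card_basePoints_singleton_le (x : Site) : (basePoints P {x}).card ≤ P.card := by
  unfold basePoints
  refine Finset.card_image_le.trans ?_
  simp

theorem flipWeight_bounds (hβ : 0 ≤ β) (x : Site) (σ : Config) :
    Real.exp (-(β * P.card)) ≤ flipWeight P β x σ ∧ flipWeight P β x σ ≤ Real.exp (β * P.card) := by
  have h : |∑ z ∈ basePoints P {x},
      (spinProd (flip x σ) (plaquette P z) - spinProd σ (plaquette P z))| ≤ 2 * P.card := by
    refine (Finset.abs_sum_le_sum_abs _ _).trans ?_
    refine (Finset.sum_le_card_nsmul _ _ 2 fun z _ => ?_).trans ?_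
    · refine (abs_sub _ _).trans ?_
      rw [abs_spinProd, abs_spinProd]; norm_num
    · rw [nsmul_eq_mul, mul_comm]
      exact mul_le_mul_of_nonneg_left (Nat.cast_le.2 (card_basePoints_singleton_le x)) two_pos.le
  obtain ⟨h1, h2⟩ := abs_le.1 h
  unfold flipWeight
  constructor <;> refine Real.exp_le_exp.2 ?_ <;> nlinarith

end Flip

/-! ### Strong mixing from the decoupling of pairs of flips -/

theorem abs_le_supNorm {f : Config → ℝ} (hf : IsLocal f) (σ : Config) : |f σ| ≤ supNorm f := by
  obtain ⟨V, hV⟩ := hf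
  refine le_ciSup (f := fun σ => |f σ|) ?_ σ
  refine (Set.Finite.subset (Set.finite_range fun η : V → ℤˣ => |f (glue V 1 η)|) ?_).bddAbove
  rintro _ ⟨σ, rfl⟩
  refine ⟨fun x => σ x, ?_⟩
  simp only
  rw [hV fun x hx => by rw [glue_of_mem (Finset.mem_coe.1 hx)]]

theorem supNorm_nonneg (f : Config → ℝ) : 0 ≤ supNorm f := Real.iSup_nonneg fun _ => abs_nonneg _

theorem setDist_le {A B : Set Site} {x y : Site} (hx : x ∈ A) (hy : y ∈ B) :
    setDist A B ≤ l1Dist x y := Nat.sInf_le ⟨x, hx, y, hy, rfl⟩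

theorem block_injective {ℓ : ℕ} {x i j : Site} (hi : x ∈ block ℓ i) (hj : x ∈ block ℓ j) :
    i = j := by
  rw [mem_block] at hi hj
  have key : ∀ a b : ℤ, ∀ u : ℤ, (ℓ : ℤ) * a + 1 ≤ u → u ≤ ℓ * b + ℓ → a ≤ b := by
    intro a b u h1 h2
    by_contra! h
    have : (ℓ : ℤ) * (b + 1) ≤ ℓ * a := mul_le_mul_of_nonneg_left (by omega) (by positivity)
    linarith
  exact Prod.ext (le_antisymm (key _ _ _ hi.1.1 hj.1.2) (key _ _ _ hj.1.1 hi.1.2))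
    (le_antisymm (key _ _ _ hi.2.1 hj.2.2) (key _ _ _ hj.2.1 hi.2.2))

theorem card_block (ℓ : ℕ) (i : Site) : (block ℓ i).card = ℓ ^ 2 := by
  unfold block
  rw [Finset.card_product, Int.card_Icc, Int.card_Icc, sq]
  congr 1 <;> omega

theorem blockUnion_mono {ℓ : ℕ} {I J : Finset Site} (h : I ⊆ J) :
    blockUnion ℓ I ⊆ blockUnion ℓ J := Finset.biUnion_subset_biUnion_of_subset_left _ h

theorem card_blockUnion_le (ℓ : ℕ) (I : Finset Site) :
    (blockUnion ℓ I).card ≤ I.card * ℓ ^ 2 :=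
  Finset.card_biUnion_le_card_mul _ _ _ fun i _ => (card_block ℓ i).le

theorem blockUnion_sdiff_subset {ℓ : ℕ} {I J : Finset Site} :
    blockUnion ℓ I \ blockUnion ℓ (I \ J) ⊆ blockUnion ℓ J := by
  intro x hx
  obtain ⟨h1, h2⟩ := Finset.mem_sdiff.1 hx
  obtain ⟨i, hi, hxi⟩ := mem_blockUnion.1 h1
  by_cases hiJ : i ∈ J
  · exact mem_blockUnion.2 ⟨i, hiJ, hxi⟩
  · exact absurd (mem_blockUnion.2 ⟨i, Finset.mem_sdiff.2 ⟨hi, hiJ⟩, hxi⟩) h2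

theorem disjoint_blockUnion {ℓ : ℕ} {I J : Finset Site} (h : Disjoint I J) {x : Site}
    (hx : x ∈ blockUnion ℓ I) : x ∉ blockUnion ℓ J := by
  intro hx'
  obtain ⟨i, hi, hxi⟩ := mem_blockUnion.1 hx
  obtain ⟨j, hj, hxj⟩ := mem_blockUnion.1 hx'
  exact Finset.disjoint_left.1 h hi (block_injective hxi hxj ▸ hj)

theorem l1Dist_le_of_block {ℓ : ℕ} {i j x y s t : Site} (hx : x ∈ block ℓ j) (ht : t ∈ block ℓ j)
    (hy : y ∈ block ℓ i) (hs : s ∈ block ℓ i) : l1Dist s t ≤ l1Dist x y + 4 * ℓ := by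
  rw [mem_block] at hx ht hy hs
  generalize (ℓ : ℤ) * i.1 = a at *
  generalize (ℓ : ℤ) * i.2 = b at *
  generalize (ℓ : ℤ) * j.1 = a' at *
  generalize (ℓ : ℤ) * j.2 = b' at *
  unfold l1Dist
  omega

section

variable {P : Finset Site} {β : ℝ} {ℓ : ℕ}

/-- The oscillation of conditional expectations is bounded by the sum of their responses to single
flips. -/
theorem abs_gibbsExp_sub_le_sum {Λ Λ' : Finset Site} {f : Config → ℝ} {c : Site → ℝ}
    (h : ∀ x ∈ Λ \ Λ', ∀ σ, |gibbsExp P β Λ' (flip x σ) f - gibbsExp P β Λ' σ f| ≤ c x)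
    {σ σ' : Config} (hσ : ∀ x, x ∉ Λ → σ x = σ' x) :
    |gibbsExp P β Λ' σ f - gibbsExp P β Λ' σ' f| ≤ ∑ x ∈ Λ \ Λ', c x := by
  have e : gibbsExp P β Λ' σ' f =
      gibbsExp P β Λ' (glue (Λ \ Λ') σ fun x => σ' x) f := by
    refine gibbsExp_boundary fun x hx => ?_
    by_cases hxΛ : x ∈ Λ
    · rw [glue_of_mem (Finset.mem_sdiff.2 ⟨hxΛ, hx⟩)]
    · rw [glue_of_notMem (by simp [hxΛ]), hσ x hxΛ]
  rw [e]
  exact abs_sub_le_sum_flip (f := fun σ => gibbsExp P β Λ' σ f) (Q := fun _ => True) (fun _ _ _ _ => trivial)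
    (fun x hx σ _ => h x hx σ) _ _ trivial fun x hx => (glue_of_notMem hx _ _).symm

/-- The influence of the spin at `x` on the expectations of `h_y` in regular volumes decays
exponentially on the scale `ℓ`. -/
def InfluenceBound (P : Finset Site) (β : ℝ) (ℓ : ℕ) (A : ℝ) : Prop :=
  ∀ (I : Finset Site) (τ : Config) (x y : Site), (ℓ : ℝ) / 4 ≤ l1Dist x y →
    |gibbsExp P β (blockUnion ℓ I) (flip x τ) (flipWeight P β y) -
        gibbsExp P β (blockUnion ℓ I) τ (flipWeight P β y)| ≤
      A * Real.exp (-l1Dist x y / ℓ) * gibbsExp P β (blockUnion ℓ I) τ (flipWeight P β y)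

/-- The influence of the spin at `y` on a function of the spins in one block: by `gibbsCov_comm`
and `gibbsCov_flipWeight` it is the influence of the block on `h_y`. -/
theorem InfluenceBound.abs_gibbsExp_flip_sub_le_block {A : ℝ} (hH : InfluenceBound P β ℓ A) (hβ : 0 < β)
    (hℓ : 1 ≤ ℓ) (hA : 4 ≤ A) {I : Finset Site} {i : Site} (hi : i ∈ I) {y : Site}
    (hy : y ∉ blockUnion ℓ I) {G : Config → ℝ} (hG : DependsOn G (block ℓ i : Set Site)) {c : ℝ}
    (hc : ∀ σ, |G σ| ≤ c) {R : ℝ} (hR : ∀ x ∈ block ℓ i, R ≤ l1Dist x y) (τ : Config) :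
    |gibbsExp P β (blockUnion ℓ I) (flip y τ) G - gibbsExp P β (blockUnion ℓ I) τ G| ≤
      c * (A * ℓ ^ 2 * Real.exp (2 * (β * P.card))) * Real.exp (-R / ℓ) := by
  have hℓ0 : (1 : ℝ) ≤ ℓ := by exact_mod_cast hℓ
  have hc0 : 0 ≤ c := (abs_nonneg _).trans (hc τ)
  have hA0 : 0 ≤ A := by linarith
  have hℓ2 : (1 : ℝ) ≤ ℓ ^ 2 := one_le_pow₀ hℓ0
  -- for a site close to the block the trivial bound `2 c` suffices
  rcases lt_or_ge R (ℓ / 4) with hR4 | hR4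
  · have h1 : (3 / 4 : ℝ) ≤ Real.exp (-R / ℓ) := by
      have : -(1 / 4 : ℝ) ≤ -R / ℓ := by
        rw [le_div_iff₀ (by linarith)]; linarith
      linarith [Real.add_one_le_exp (-R / ℓ)]
    have h2 : 1 ≤ Real.exp (2 * (β * P.card)) := Real.one_le_exp (by positivity)
    have h3 := abs_sub (gibbsExp P β (blockUnion ℓ I) (flip y τ) G)
      (gibbsExp P β (blockUnion ℓ I) τ G)
    have h4 := abs_gibbsExp_le (P := P) (β := β) (Λ := blockUnion ℓ I) (τ := τ) fun σ _ => hc σ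
    have h5 := abs_gibbsExp_le (P := P) (β := β) (Λ := blockUnion ℓ I) (τ := flip y τ)
      fun σ _ => hc σ
    have h6 : (4 : ℝ) * 1 * 1 * (3 / 4) ≤
        A * ℓ ^ 2 * Real.exp (2 * (β * P.card)) * Real.exp (-R / ℓ) := by gcongr
    have h7 := mul_le_mul_of_nonneg_left h6 hc0
    linarith
  · have hyi : y ∉ block ℓ i := fun h => hy (mem_blockUnion.2 ⟨i, hi, h⟩)
    have hGy : ∀ σ, G (flip y σ) = G σ := fun σ => dependsOn_flip_eq hG (by simpa using hyi) σ
    have hcov := gibbsCov_flipWeight (P := P) (β := β) (Λ := blockUnion ℓ I) hGy τ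
    have hE := gibbsExp_flipWeight_pos (P := P) (β := β) (Λ := blockUnion ℓ I) y τ
    have hElow : Real.exp (-(β * P.card)) ≤
        gibbsExp P β (blockUnion ℓ I) τ (flipWeight P β y) := by
      rw [← gibbsExp_const (P := P) (β := β) (Λ := blockUnion ℓ I) (τ := τ)
        (Real.exp (-(β * P.card)))]
      exact gibbsExp_mono fun σ _ => (flipWeight_bounds hβ.le y σ).1
    have hsub : blockUnion ℓ I \ blockUnion ℓ (I \ {i}) ⊆ block ℓ i := by
      refine blockUnion_sdiff_subset.trans ?_
      simp [blockUnion]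
    have hosc : |gibbsCov P β (blockUnion ℓ I) τ G (flipWeight P β y)| ≤
        c * ∑ x ∈ blockUnion ℓ I \ blockUnion ℓ (I \ {i}),
          A * Real.exp (-R / ℓ) * Real.exp (β * P.card) := by
      refine abs_gibbsCov_le (blockUnion_mono Finset.sdiff_subset) hG (fun x hx => ?_) hc
        fun σ σ' hσ hσ' => abs_gibbsExp_sub_le_sum (fun x hx σ => ?_)
          fun x hx => (hσ x hx).trans (hσ' x hx).symm
      · refine disjoint_blockUnion (I := {i}) (by simp) ?_
        simpa [blockUnion] using hx
      · have hRx := hR x (hsub hx)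
        refine (hH (I \ {i}) σ x y (hR4.trans hRx)).trans ?_
        have hv : gibbsExp P β (blockUnion ℓ (I \ {i})) σ (flipWeight P β y) ≤
            Real.exp (β * P.card) := by
          rw [← gibbsExp_const (P := P) (β := β) (Λ := blockUnion ℓ (I \ {i})) (τ := σ)
            (Real.exp (β * P.card))]
          exact gibbsExp_mono fun σ _ => (flipWeight_bounds hβ.le y σ).2
        have hv0 := (gibbsExp_flipWeight_pos (P := P) (β := β) (Λ := blockUnion ℓ (I \ {i})) y σ).le
        gcongr
    rw [Finset.sum_const, nsmul_eq_mul] at hosc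
    have hcard : ((blockUnion ℓ I \ blockUnion ℓ (I \ {i})).card : ℝ) ≤ ℓ ^ 2 := by
      have := Finset.card_le_card hsub
      rw [card_block] at this
      exact_mod_cast this
    rw [gibbsCov_comm, hcov, abs_mul, abs_of_pos hE] at hosc
    have hfin : Real.exp (-(β * P.card)) *
        |gibbsExp P β (blockUnion ℓ I) (flip y τ) G - gibbsExp P β (blockUnion ℓ I) τ G| ≤
        c * (ℓ ^ 2 * (A * Real.exp (-R / ℓ) * Real.exp (β * P.card))) :=
      (mul_le_mul_of_nonneg_right hElow (abs_nonneg _)).trans (hosc.trans (by gcongr))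
    rw [Real.exp_neg, inv_mul_le_iff₀ (Real.exp_pos _)] at hfin
    refine hfin.trans (le_of_eq ?_)
    rw [two_mul (β * _), Real.exp_add]
    ring

/-- The influence of the spin at `y` on a function of the spins in several blocks `J`. The blocks
are treated one at a time, by conditioning on the spins in them. -/
theorem InfluenceBound.abs_gibbsExp_flip_sub_le {A : ℝ} (hH : InfluenceBound P β ℓ A) (hβ : 0 < β)
    (hℓ : 1 ≤ ℓ) (hA : 4 ≤ A) {y : Site} {f : Config → ℝ} {S : Set Site} (hf : DependsOn f S)
    (hyS : y ∉ S) {c : ℝ} (hc : ∀ σ, |f σ| ≤ c) {R : Site → ℝ} (J : Finset Site) :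
    ∀ I : Finset Site, J ⊆ I → y ∉ blockUnion ℓ I →
      (∀ x ∈ S, x ∈ blockUnion ℓ I → x ∈ blockUnion ℓ J) →
      (∀ j ∈ J, ∀ x ∈ block ℓ j, R j ≤ l1Dist x y) → ∀ τ,
      |gibbsExp P β (blockUnion ℓ I) (flip y τ) f - gibbsExp P β (blockUnion ℓ I) τ f| ≤
        c * (A * ℓ ^ 2 * Real.exp (2 * (β * P.card))) * ∑ j ∈ J, Real.exp (-R j / ℓ) := by
  induction J using Finset.induction_on with
  | empty =>
    intro I _ hy hS _ τ
    have h0 : ∀ x ∈ S, x ∉ blockUnion ℓ I := fun x hx hxI => by simpa [blockUnion] using hS x hx hxI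
    have h1 : ∀ τ, gibbsExp P β (blockUnion ℓ I) τ f = f τ := fun τ => by
      rw [← gibbsExp_const (P := P) (β := β) (Λ := blockUnion ℓ I) (τ := τ) (f τ)]
      exact gibbsExp_congr fun σ hσ => hf fun x hx => hσ x (h0 x hx)
    rw [h1, h1, dependsOn_flip_eq hf hyS]
    simp
  | insert j J hj ih =>
    intro I hJI hy hS hR τ
    obtain ⟨hjI, hJI⟩ := Finset.insert_subset_iff.1 hJI
    set D := A * ℓ ^ 2 * Real.exp (2 * (β * P.card)) with hD
    have hsub : blockUnion ℓ (I \ {j}) ⊆ blockUnion ℓ I := blockUnion_mono Finset.sdiff_subset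
    have hyj : y ∉ block ℓ j := fun h => hy (mem_blockUnion.2 ⟨j, hjI, h⟩)
    have hmem : ∀ x ∈ blockUnion ℓ I, x ∉ blockUnion ℓ (I \ {j}) → x ∈ block ℓ j := by
      intro x hx hx'
      have := blockUnion_sdiff_subset (Finset.mem_sdiff.2 ⟨hx, hx'⟩)
      simpa [blockUnion] using this
    set v : Config → ℝ := fun σ => gibbsExp P β (blockUnion ℓ (I \ {j})) σ f with hv
    set G : Config → ℝ := fun σ => v (glue (block ℓ j) τ fun x => σ x) with hG
    have hih : ∀ σ, |v (flip y σ) - v σ| ≤ c * D * ∑ j ∈ J, Real.exp (-R j / ℓ) := by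
      refine ih (I \ {j}) (fun k hk => ?_) (fun h => hy (hsub h)) (fun x hx hxI => ?_)
        (fun k hk => hR k (Finset.mem_insert_of_mem hk))
      · exact Finset.mem_sdiff.2 ⟨hJI hk, by simpa using fun h : k = j => hj (h ▸ hk)⟩
      · obtain ⟨k, hk, hxk⟩ := mem_blockUnion.1 (hS x hx (hsub hxI))
        rcases Finset.mem_insert.1 hk with rfl | hk
        · exact absurd hxI (disjoint_blockUnion (I := {k}) (by simp) (by simpa [blockUnion]))
        · exact mem_blockUnion.2 ⟨k, hk, hxk⟩
    have hGdep : DependsOn G (block ℓ j : Set Site) := by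
      intro σ σ' h
      simp only [hG]
      congr 2
      funext x
      exact h x (Finset.mem_coe.2 x.2)
    have hGle : ∀ σ, |G σ| ≤ c := fun σ => abs_gibbsExp_le fun σ _ => hc σ
    have hB := hH.abs_gibbsExp_flip_sub_le_block hβ hℓ hA hjI hy hGdep hGle (hR j (Finset.mem_insert_self _ _)) τ
    -- `G` is the conditional expectation `v`, as a function of the spins in the block `j` only
    have e1 : gibbsExp P β (blockUnion ℓ I) τ f = gibbsExp P β (blockUnion ℓ I) τ G := by
      rw [← gibbsExp_gibbsExp hsub]
      refine gibbsExp_congr fun σ hσ => gibbsExp_boundary fun x hx => ?_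
      by_cases hxj : x ∈ block ℓ j
      · rw [glue_of_mem hxj]
      · rw [glue_of_notMem hxj, hσ x fun h => hxj (hmem x h hx)]
    have e2 : |gibbsExp P β (blockUnion ℓ I) (flip y τ) f -
        gibbsExp P β (blockUnion ℓ I) (flip y τ) G| ≤
          c * D * ∑ j ∈ J, Real.exp (-R j / ℓ) := by
      rw [← gibbsExp_gibbsExp hsub, ← gibbsExp_sub]
      refine abs_gibbsExp_le fun σ hσ => ?_
      have e3 : G σ = v (flip y σ) := by
        refine gibbsExp_boundary fun x hx => ?_
        by_cases hxj : x ∈ block ℓ j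
        · rw [glue_of_mem hxj, flip_of_ne fun h : x = y => hyj (h ▸ hxj)]
        · rw [glue_of_notMem hxj]
          by_cases hxy : x = y
          · subst hxy
            rw [flip_self, hσ _ hy, flip_self, neg_neg]
          · rw [flip_of_ne hxy, hσ x fun h => hxj (hmem x h hx), flip_of_ne hxy]
      rw [e3, abs_sub_comm]
      exact hih σ
    rw [Finset.sum_insert hj, mul_add, e1]
    have := abs_sub_le (gibbsExp P β (blockUnion ℓ I) (flip y τ) f)
      (gibbsExp P β (blockUnion ℓ I) (flip y τ) G) (gibbsExp P β (blockUnion ℓ I) τ G)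
    linarith

theorem gibbsCov_eq_zero_of_spinSupport {f g : Config → ℝ} (hf : IsLocal f)
    (h : spinSupport f = ∅) (Λ : Finset Site) (τ : Config) : gibbsCov P β Λ τ f g = 0 := by
  have hc : ∀ σ, f σ = f τ := fun σ => (isLeast_spinSupport hf).1 fun x hx => by
    rw [h] at hx; exact absurd hx (Set.notMem_empty x)
  have hf' : f = fun _ => f τ := funext hc
  rw [hf']
  unfold gibbsCov
  simp only
  rw [gibbsExp_const_mul, gibbsExp_const, sub_self]

theorem InfluenceBound.strongMixing {A : ℝ} (hH : InfluenceBound P β ℓ A) (hβ : 0 < β)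
    (hℓ : 1 ≤ ℓ) (hA : 4 ≤ A) :
    StrongMixing P β ℓ (A * ℓ ^ 4 * Real.exp (2 * (β * P.card) + 4)) (1 / (ℓ : ℝ)) := by
  rintro Λ ⟨I, hI⟩ τ f g hf hg
  have hI' : Λ = blockUnion ℓ I := hI
  have hfl : IsLocal f := ⟨Λ, hf⟩
  have hgl : IsLocal g := ⟨Λ, hg⟩
  have hℓ0 : (1 : ℝ) ≤ ℓ := by exact_mod_cast hℓ
  have hnf := supNorm_nonneg f
  have hng := supNorm_nonneg g
  have hSfΛ : spinSupport f ⊆ Λ := (isLeast_spinSupport hfl).2 hf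
  have hSgΛ : spinSupport g ⊆ Λ := (isLeast_spinSupport hgl).2 hg
  have hSf_fin := Λ.finite_toSet.subset hSfΛ
  have hSg_fin := Λ.finite_toSet.subset hSgΛ
  have hrhs : 0 ≤ A * ℓ ^ 4 * Real.exp (2 * (β * P.card) + 4) * supNorm f * supNorm g *
      (spinSupport f).ncard * (spinSupport g).ncard *
        Real.exp (-(1 / (ℓ : ℝ)) * setDist (spinSupport f) (spinSupport g)) := by positivity
  rcases (spinSupport f).eq_empty_or_nonempty with hfe | hfne
  · rw [gibbsCov_eq_zero_of_spinSupport hfl hfe, abs_zero]; exact hrhs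
  rcases (spinSupport g).eq_empty_or_nonempty with hge | hgne
  · rw [gibbsCov_comm, gibbsCov_eq_zero_of_spinSupport hgl hge, abs_zero]; exact hrhs
  have hcf : (1 : ℝ) ≤ (spinSupport f).ncard := by
    exact_mod_cast (Set.ncard_pos hSf_fin).2 hfne
  have hcg : (1 : ℝ) ≤ (spinSupport g).ncard := by
    exact_mod_cast (Set.ncard_pos hSg_fin).2 hgne
  set d := setDist (spinSupport f) (spinSupport g) with hd
  -- for close supports the trivial bound suffices; otherwise no block meets both supports
  rcases le_or_gt d (4 * ℓ) with hd4 | hd4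
  · refine (abs_gibbsCov_le_two (abs_le_supNorm hfl) (abs_le_supNorm hgl)).trans ?_
    have hd4' : (d : ℝ) ≤ 4 * ℓ := by exact_mod_cast hd4
    have h1 : 1 ≤ Real.exp (2 * (β * P.card) + 4) * Real.exp (-(1 / (ℓ : ℝ)) * d) := by
      rw [← Real.exp_add]
      refine Real.one_le_exp ?_
      have : (1 / (ℓ : ℝ)) * d ≤ 4 := by
        rw [one_div_mul_eq_div, div_le_iff₀ (by linarith)]; exact hd4'
      have : 0 ≤ 2 * (β * P.card) := by positivity
      linarith
    calc 2 * supNorm f * supNorm g = 2 * 1 * 1 * 1 * 1 * (supNorm f * supNorm g) := by ring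
      _ ≤ A * ℓ ^ 4 * (Real.exp (2 * (β * P.card) + 4) * Real.exp (-(1 / (ℓ : ℝ)) * d)) *
          (spinSupport f).ncard * (spinSupport g).ncard * (supNorm f * supNorm g) := by
          gcongr
          · linarith
          · exact one_le_pow₀ hℓ0
      _ = _ := by ring
  · set Sf := hSf_fin.toFinset with hSf
    set Sg := hSg_fin.toFinset with hSg
    -- the blocks which meet the two supports
    choose! idx hidx hidx' using fun x (hx : x ∈ blockUnion ℓ I) => mem_blockUnion.1 hx
    set If := Sf.image idx with hIf
    set J := Sg.image idx with hJ
    have hSfI : ∀ x ∈ spinSupport f, x ∈ blockUnion ℓ I := fun x hx => hI' ▸ hSfΛ hx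
    have hSgI : ∀ x ∈ spinSupport g, x ∈ blockUnion ℓ I := fun x hx => hI' ▸ hSgΛ hx
    have hIfmem : ∀ i ∈ If, ∃ s ∈ spinSupport f, s ∈ block ℓ i := by
      intro i hi
      obtain ⟨s, hs, rfl⟩ := Finset.mem_image.1 hi
      have hs' : s ∈ spinSupport f := by simpa [hSf] using hs
      exact ⟨s, hs', hidx' s (hSfI s hs')⟩
    have hJmem : ∀ i ∈ J, ∃ s ∈ spinSupport g, s ∈ block ℓ i := by
      intro i hi
      obtain ⟨s, hs, rfl⟩ := Finset.mem_image.1 hi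
      have hs' : s ∈ spinSupport g := by simpa [hSg] using hs
      exact ⟨s, hs', hidx' s (hSgI s hs')⟩
    have hdist : ∀ i ∈ If, ∀ j ∈ J, ∀ y ∈ block ℓ i, ∀ x ∈ block ℓ j,
        d ≤ l1Dist x y + 4 * ℓ := by
      intro i hi j hj y hy x hx
      obtain ⟨s, hs, hs'⟩ := hIfmem i hi
      obtain ⟨t, ht, ht'⟩ := hJmem j hj
      exact (setDist_le hs ht).trans (l1Dist_le_of_block hx ht' hy hs')
    have hJI : J ⊆ I \ If := by
      intro j hj
      obtain ⟨t, ht, ht'⟩ := hJmem j hj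
      refine Finset.mem_sdiff.2 ⟨?_, fun hjf => ?_⟩
      · obtain ⟨s, hs, rfl⟩ := Finset.mem_image.1 hj
        exact hidx s (hSgI s (by simpa [hSg] using hs))
      · have := hdist j hjf j hj t ht' t ht'
        simp only [l1Dist, sub_self, Int.natAbs_zero] at this
        omega
    have hsub : blockUnion ℓ (I \ If) ⊆ Λ := hI' ▸ blockUnion_mono Finset.sdiff_subset
    have key : |gibbsCov P β Λ τ f g| ≤ supNorm f * ∑ x ∈ Λ \ blockUnion ℓ (I \ If),
        supNorm g * (A * ℓ ^ 2 * Real.exp (2 * (β * P.card))) *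
          ∑ j ∈ J, Real.exp (-((d : ℝ) - 4 * ℓ) / ℓ) := by
      refine abs_gibbsCov_le hsub (isLeast_spinSupport hfl).1 (fun x hx => ?_)
        (abs_le_supNorm hfl) fun σ σ' hσ hσ' => abs_gibbsExp_sub_le_sum (fun y hy σ => ?_)
          fun x hx => (hσ x hx).trans (hσ' x hx).symm
      · have hxi : idx x ∈ If := Finset.mem_image_of_mem _ (by simpa [hSf] using hx)
        refine disjoint_blockUnion (I := If) Finset.disjoint_sdiff ?_
        exact mem_blockUnion.2 ⟨_, hxi, hidx' x (hSfI x hx)⟩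
      · have hyf : y ∈ blockUnion ℓ If := by
          rw [hI'] at hy; exact blockUnion_sdiff_subset hy
        obtain ⟨i, hi, hyi⟩ := mem_blockUnion.1 hyf
        have hyn := (Finset.mem_sdiff.1 hy).2
        refine hH.abs_gibbsExp_flip_sub_le hβ hℓ hA (isLeast_spinSupport hgl).1 (fun hyg => ?_)
          (abs_le_supNorm hgl) J (I \ If) hJI hyn (fun x hx _ => ?_) (fun j hj x hx => ?_) σ
        · refine hyn (mem_blockUnion.2 ⟨idx y, hJI (Finset.mem_image_of_mem _ ?_),
            hidx' y (hSgI y hyg)⟩)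
          simpa [hSg] using hyg
        · exact mem_blockUnion.2 ⟨idx x, Finset.mem_image_of_mem _ (by simpa [hSg] using hx),
            hidx' x (hSgI x hx)⟩
        · have : (d : ℝ) ≤ l1Dist x y + 4 * ℓ := by exact_mod_cast hdist i hi j hj y hyi x hx
          linarith
    refine key.trans ?_
    rw [Finset.sum_const, Finset.sum_const, nsmul_eq_mul, nsmul_eq_mul]
    have hc1 : ((Λ \ blockUnion ℓ (I \ If)).card : ℝ) ≤ (spinSupport f).ncard * ℓ ^ 2 := by
      have h1 : (Λ \ blockUnion ℓ (I \ If)).card ≤ Sf.card * ℓ ^ 2 := by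
        rw [hI']
        exact (Finset.card_le_card blockUnion_sdiff_subset).trans
          ((card_blockUnion_le _ _).trans (Nat.mul_le_mul_right _ Finset.card_image_le))
      rw [Set.ncard_eq_toFinset_card _ hSf_fin]
      exact_mod_cast h1
    have hc2 : (J.card : ℝ) ≤ (spinSupport g).ncard := by
      rw [Set.ncard_eq_toFinset_card _ hSg_fin]
      exact_mod_cast Finset.card_image_le
    have he : Real.exp (-((d : ℝ) - 4 * ℓ) / ℓ) = Real.exp 4 * Real.exp (-(1 / (ℓ : ℝ)) * d) := by
      rw [← Real.exp_add]
      congr 1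
      field_simp
      ring
    rw [he]
    calc _ ≤ supNorm f * (((spinSupport f).ncard * ℓ ^ 2) * (supNorm g *
          (A * ℓ ^ 2 * Real.exp (2 * (β * P.card))) * ((spinSupport g).ncard *
            (Real.exp 4 * Real.exp (-(1 / (ℓ : ℝ)) * d))))) := by gcongr
      _ = _ := by rw [Real.exp_add]; ring

end

/-! ### Strong mixing and the finite-volume condition for the two models -/

theorem card_plaquette_le {P : Finset Site} (hP : P = squarePlaquette ∨ P = trianglePlaquette) :
    P.card ≤ 4 := by
  rcases hP with rfl | rfl
  · exact Finset.card_le_four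
  · exact Finset.card_le_three.trans (by norm_num)

theorem notMem_plaquette_of_far {P : Finset Site}
    (hP : P = squarePlaquette ∨ P = trianglePlaquette) {x y z : Site} (hxy : 3 ≤ l1Dist x y)
    (hx : x ∈ plaquette P z) : y ∉ plaquette P z := by
  intro hy
  unfold l1Dist at hxy
  rcases hP with rfl | rfl
  · rw [mem_plaquette_square] at hx hy
    simp only [Prod.ext_iff] at hx hy
    omega
  · rw [mem_plaquette_triangle] at hx hy
    simp only [Prod.ext_iff] at hx hy
    omega

theorem three_le_l1Dist {ℓ : ℕ} (hℓ : 16 ≤ ℓ) {x y : Site} (h : (ℓ : ℝ) / 4 ≤ l1Dist x y) :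
    3 ≤ l1Dist x y := by
  have h1 : (16 : ℝ) ≤ ℓ := by exact_mod_cast hℓ
  have h2 : (3 : ℝ) ≤ l1Dist x y := by linarith
  exact_mod_cast h2

theorem exists_influenceBound {P : Finset Site}
    (hP : P = squarePlaquette ∨ P = trianglePlaquette) : ∃ K : ℝ, 16 ≤ K ∧ ∀ β : ℝ, 0 < β →
      InfluenceBound P β (scale K β) (2 * 8 ^ 162 * Real.exp 18) := by
  obtain ⟨K, hK, h⟩ := exists_scale_blockUnion hP
  refine ⟨K, hK, fun β hβ I τ x y hxy => ?_⟩
  have hℓ := sixteen_le_scale hK hβ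
  have := abs_gibbsExp_flipWeight_sub_le
    (fun z hx => notMem_plaquette_of_far hP (three_le_l1Dist hℓ hxy) hx) (h β hβ I τ x y hxy)
  convert this using 2
  rw [mul_assoc, ← Real.exp_add]
  congr 2
  ring

theorem influenceConst_ge : (4 : ℝ) ≤ 2 * 8 ^ 162 * Real.exp 18 := by
  have h1 : (1 : ℝ) ≤ Real.exp 18 := Real.one_le_exp (by norm_num)
  have h2 : (2 : ℝ) ≤ 8 ^ 162 := by
    calc (2 : ℝ) ≤ 8 ^ 1 := by norm_num
      _ ≤ 8 ^ 162 := pow_le_pow_right₀ (by norm_num) (by norm_num)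
  nlinarith

theorem exists_strongMixing {P : Finset Site}
    (hP : P = squarePlaquette ∨ P = trianglePlaquette) :
    ∃ c₀ : ℝ, 0 < c₀ ∧ ∃ L : ℝ → ℕ,
      (∀ β : ℝ, 0 < β → 1 ≤ L β ∧
        StrongMixing P β (L β) (Real.exp (c₀ * (β + 1))) (1 / (L β : ℝ))) ∧
      (fun β : ℝ => (L β : ℝ)) =O[atTop] (fun β : ℝ => β * Real.exp β) := by
  obtain ⟨K, hK, h⟩ := exists_influenceBound hP
  set A : ℝ := 2 * 8 ^ 162 * Real.exp 18 with hA
  have hA0 : 0 < A := by positivity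
  set M : ℝ := A * (2 * K) ^ 4 * Real.exp 4 with hM
  have hM0 : 0 < M := by positivity
  refine ⟨M + 16, by positivity, scale K, fun β hβ => ?_, isBigO_scale (by linarith)⟩
  have hℓ := sixteen_le_scale hK hβ
  refine ⟨by omega, fun Λ hΛ τ f g hf hg => ?_⟩
  refine ((h β hβ).strongMixing hβ (by omega) influenceConst_ge Λ hΛ τ f g hf hg).trans ?_
  have hnf := supNorm_nonneg f
  have hng := supNorm_nonneg g
  have hcard : (P.card : ℝ) ≤ 4 := by exact_mod_cast card_plaquette_le hP
  have key : A * (scale K β : ℝ) ^ 4 * Real.exp (2 * (β * P.card) + 4) ≤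
      Real.exp ((M + 16) * (β + 1)) := by
    calc A * (scale K β : ℝ) ^ 4 * Real.exp (2 * (β * P.card) + 4)
        ≤ A * (2 * K * Real.exp (2 * (β + 1))) ^ 4 * Real.exp (2 * (β * 4) + 4) := by
          gcongr
          exact scale_le_exp (by linarith) hβ
      _ = M * Real.exp (8 * (β + 1) + 8 * β) := by
          rw [mul_pow, ← Real.exp_nat_mul, Real.exp_add (2 * (β * 4)), Real.exp_add (8 * (β + 1)),
            hM]
          ring_nf
      _ ≤ Real.exp M * Real.exp (16 * (β + 1)) := by
          gcongr
          · linarith [Real.add_one_le_exp M]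
          · linarith
      _ ≤ Real.exp ((M + 16) * (β + 1)) := by
          rw [← Real.exp_add]
          exact Real.exp_le_exp.2 (by nlinarith)
  gcongr

/-- On the scale `⌈K (β + 1) e^β⌉` the finite-volume condition holds. -/
theorem exists_finiteVolumeCondition {P : Finset Site}
    (hP : P = squarePlaquette ∨ P = trianglePlaquette) {ε : ℝ} (hε : 0 < ε) :
    ∃ K : ℝ, 16 ≤ K ∧ ∀ β : ℝ, 0 < β → FiniteVolumeCondition P ε β (scale K β) := by
  obtain ⟨K, hK, h⟩ := exists_scale_block hP hε (by norm_num : (0 : ℝ) ≤ 16)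
  refine ⟨K, hK, fun β hβ => ?_⟩
  have hℓ := sixteen_le_scale hK hβ
  specialize h β hβ
  set ℓ := scale K β
  have hℓ0 : (0 : ℝ) < ℓ := by exact_mod_cast (by omega : 0 < ℓ)
  have hcard : (P.card : ℝ) ≤ 4 := by exact_mod_cast card_plaquette_le hP
  set a := Real.exp (4 * β * hamNorm P) * ℓ with ha
  have ha0 : 0 < a := by positivity
  have hcov : ∀ (x y : Site) (τ : Config), (ℓ : ℝ) / 4 ≤ l1Dist x y →
      |gibbsCov P β (block ℓ 0) τ (flipWeight P β x) (flipWeight P β y)| ≤ ε / a := by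
    intro x y τ hxy
    have hfar : ∀ z, x ∈ plaquette P z → y ∉ plaquette P z := fun z hx =>
      notMem_plaquette_of_far hP (three_le_l1Dist hℓ hxy) hx
    have hle : ∀ w, gibbsExp P β (block ℓ 0) τ (flipWeight P β w) ≤ Real.exp (4 * β) := by
      intro w
      rw [← gibbsExp_const (P := P) (β := β) (Λ := block ℓ 0) (τ := τ) (Real.exp (4 * β))]
      refine gibbsExp_mono fun σ _ => (flipWeight_bounds hβ.le w σ).2.trans (Real.exp_le_exp.2 ?_)
      nlinarith
    have hpos : ∀ w, 0 < gibbsExp P β (block ℓ 0) τ (flipWeight P β w) := fun w =>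
      gibbsExp_flipWeight_pos w τ
    have hinf := abs_gibbsExp_flipWeight_sub_le (P := P) (β := β) (Λ := block ℓ 0) (τ := τ)
      (ε := ε / (ℓ * Real.exp (16 * β))) hfar (by
        have := h τ x y hxy
        rw [← le_div_iff₀ (by positivity)] at this
        exact this.trans (le_of_eq (by ring)))
    rw [gibbsCov_flipWeight (flipWeight_flip hfar), abs_mul, abs_of_pos (hpos x)]
    calc _ ≤ Real.exp (4 * β) * (ε / (ℓ * Real.exp (16 * β)) * Real.exp (4 * β)) :=
          mul_le_mul (hle x) (hinf.trans (mul_le_mul_of_nonneg_left (hle y) (by positivity)))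
            (abs_nonneg _) (Real.exp_pos _).le
      _ = ε / (ℓ * Real.exp (8 * β)) := by
          have : Real.exp (16 * β) = Real.exp (4 * β) * Real.exp (4 * β) * Real.exp (8 * β) := by
            rw [← Real.exp_add, ← Real.exp_add]; ring_nf
          rw [this]
          field_simp
      _ ≤ ε / a := by
          rw [ha, mul_comm (Real.exp _)]
          refine div_le_div_of_nonneg_left hε.le (by positivity)
            (mul_le_mul_of_nonneg_left (Real.exp_le_exp.2 ?_) hℓ0.le)
          unfold hamNorm
          nlinarith
  have hφ : mixPhi P β ℓ ≤ ENNReal.ofReal (ε / a) :=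
    iSup_le fun x => iSup_le fun y => iSup_le fun _ => iSup_le fun _ => iSup_le fun hxy =>
      iSup_le fun τ => ENNReal.ofReal_le_ofReal (hcov x y τ hxy)
  unfold FiniteVolumeCondition
  refine (mul_le_mul_right hφ _).trans ?_
  rw [← ENNReal.ofReal_mul ha0.le, mul_div_cancel₀ _ ha0.ne']

theorem mixScale_isBigO {P : Finset Site} {ε K : ℝ} (hK : 16 ≤ K)
    (h : ∀ β : ℝ, 0 < β → FiniteVolumeCondition P ε β (scale K β)) :
    (fun β : ℝ => (mixScale P ε β : ℝ)) =O[atTop] (fun β : ℝ => β * Real.exp β) := by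
  refine IsBigO.trans (IsBigO.of_bound 1 ?_) (isBigO_scale (by linarith : 1 ≤ K))
  filter_upwards [eventually_gt_atTop 0] with β hβ
  rw [one_mul, Real.norm_of_nonneg (Nat.cast_nonneg _), Real.norm_of_nonneg (Nat.cast_nonneg _)]
  have h16 := sixteen_le_scale hK hβ
  have hmem : scale K β ∈ {ℓ : ℕ | 1 ≤ ℓ ∧ FiniteVolumeCondition P ε β ℓ} :=
    ⟨by omega, h β hβ⟩
  exact_mod_cast Nat.sInf_le hmem

/-! ### Insensitivity to distant boundary conditions -/

/-- The index of the block which contains `x`. -/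
def blockIndex (ℓ : ℕ) (x : Site) : Site := ((x.1 - 1) / ℓ, (x.2 - 1) / ℓ)

theorem mem_block_blockIndex {ℓ : ℕ} (hℓ : 1 ≤ ℓ) (x : Site) : x ∈ block ℓ (blockIndex ℓ x) := by
  have hℓ' : (0 : ℤ) < ℓ := by exact_mod_cast hℓ
  have key : ∀ a : ℤ, (ℓ : ℤ) * ((a - 1) / ℓ) + 1 ≤ a ∧ a ≤ ℓ * ((a - 1) / ℓ) + ℓ := by
    intro a
    have h1 := Int.mul_ediv_add_emod (a - 1) ℓ
    have h2 := Int.emod_nonneg (a - 1) hℓ'.ne'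
    have h3 := Int.emod_lt_of_pos (a - 1) hℓ'
    constructor <;> linarith
  exact mem_block.2 ⟨key _, key _⟩

/-- The box `{-n, …, n}²`. -/
noncomputable def centredBox (n : ℕ) : Finset Site := Finset.Icc (-(n : ℤ)) n ×ˢ Finset.Icc (-(n : ℤ)) n

theorem mem_centredBox {n : ℕ} {i : Site} :
    i ∈ centredBox n ↔ (-(n : ℤ) ≤ i.1 ∧ i.1 ≤ n) ∧ -(n : ℤ) ≤ i.2 ∧ i.2 ≤ n := by
  simp [centredBox]

theorem card_centredBox (n : ℕ) : (centredBox n).card = (2 * n + 1) ^ 2 := by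
  unfold centredBox
  rw [Finset.card_product, Int.card_Icc, sq]
  congr 1 <;> omega

theorem centredBox_mono {m n : ℕ} (h : m ≤ n) : centredBox m ⊆ centredBox n := fun i hi => by
  rw [mem_centredBox] at hi ⊢; omega

theorem exists_subset_centredBox (J : Finset Site) : ∃ m, J ⊆ centredBox m := by
  refine ⟨J.sup fun i => i.1.natAbs + i.2.natAbs, fun i hi => mem_centredBox.2 ?_⟩
  have : i.1.natAbs + i.2.natAbs ≤ _ :=
    Finset.le_sup (f := fun i : Site => i.1.natAbs + i.2.natAbs) hi
  omega

theorem exists_subset_blockUnion {ℓ : ℕ} (hℓ : 1 ≤ ℓ) (V : Finset Site) :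
    ∃ m, V ⊆ blockUnion ℓ (centredBox m) := by
  obtain ⟨m, hm⟩ := exists_subset_centredBox (V.image (blockIndex ℓ))
  exact ⟨m, fun x hx => mem_blockUnion.2
    ⟨_, hm (Finset.mem_image_of_mem _ hx), mem_block_blockIndex hℓ x⟩⟩

theorem le_l1Dist_of_notMem {ℓ m n : ℕ} (hℓ : 1 ≤ ℓ) {x y : Site}
    (hx : x ∈ blockUnion ℓ (centredBox m)) (hy : y ∉ blockUnion ℓ (centredBox n)) :
    (ℓ : ℤ) * (n - m) ≤ l1Dist x y := by
  obtain ⟨i, hi, hxi⟩ := mem_blockUnion.1 hx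
  have hyi := mem_block_blockIndex hℓ y
  have hn : blockIndex ℓ y ∉ centredBox n := fun h => hy (mem_blockUnion.2 ⟨_, h, hyi⟩)
  generalize blockIndex ℓ y = j at *
  rw [mem_centredBox] at hi hn
  rw [mem_block] at hxi hyi
  have hup : ∀ a b c : ℤ, b ≤ c → a + (ℓ : ℤ) * b ≤ a + ℓ * c := fun a b c h => by gcongr
  have hlow : ∀ a b : ℤ, a ≤ b → (ℓ : ℤ) * a ≤ ℓ * b := fun a b h => by gcongr
  unfold l1Dist
  push_cast
  have e1 := abs_nonneg (x.1 - y.1)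
  have e2 := abs_nonneg (x.2 - y.2)
  have e3 := neg_abs_le (x.1 - y.1)
  have e4 := neg_abs_le (x.2 - y.2)
  have e5 := le_abs_self (x.1 - y.1)
  have e6 := le_abs_self (x.2 - y.2)
  have m1 := hlow _ _ hi.1.1
  have m2 := hlow _ _ hi.1.2
  have m3 := hlow _ _ hi.2.1
  have m4 := hlow _ _ hi.2.2
  have hcases : j.1 ≤ -n - 1 ∨ n + 1 ≤ j.1 ∨ j.2 ≤ -n - 1 ∨ n + 1 ≤ j.2 := by omega
  rcases hcases with h | h | h | h <;> have := hlow _ _ h <;> linarith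

/-- Expectations of local functions in large volumes are insensitive to the boundary condition. -/
def BoundaryInsensitive (P : Finset Site) (β : ℝ) : Prop :=
  ∀ f : Config → ℝ, IsLocal f → ∀ ε : ℝ, 0 < ε → ∃ Λ : Finset Site, ∀ σ τ : Config,
    |gibbsExp P β Λ σ f - gibbsExp P β Λ τ f| ≤ ε

theorem card_basePoints_le (P Λ : Finset Site) : (basePoints P Λ).card ≤ Λ.card * P.card :=
  Finset.card_image_le.trans (Finset.card_product _ _).le

theorem card_plaquettes_centredBox_le (P : Finset Site) (ℓ : ℕ) {n : ℕ} (hn : 1 ≤ n) :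
    (((basePoints P (blockUnion ℓ (centredBox n))).biUnion (plaquette P)).card : ℝ) ≤
      9 * n ^ 2 * ℓ ^ 2 * P.card ^ 2 := by
  have h1 : ((basePoints P (blockUnion ℓ (centredBox n))).biUnion (plaquette P)).card ≤
      ((2 * n + 1) ^ 2 * ℓ ^ 2 * P.card) * P.card := by
    refine (Finset.card_biUnion_le_card_mul _ _ P.card fun z _ => Finset.card_image_le).trans ?_
    refine Nat.mul_le_mul_right _ ((card_basePoints_le _ _).trans (Nat.mul_le_mul_right _ ?_))
    rw [← card_centredBox]
    exact card_blockUnion_le _ _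
  have h2 : (((basePoints P (blockUnion ℓ (centredBox n))).biUnion (plaquette P)).card : ℝ) ≤
      ((2 * n + 1) ^ 2 * ℓ ^ 2 * P.card) * P.card := by exact_mod_cast h1
  have h3 : (1 : ℝ) ≤ n := by exact_mod_cast hn
  have h4 : ((2 * n + 1) ^ 2 : ℝ) ≤ (3 * n) ^ 2 :=
    pow_le_pow_left₀ (by positivity) (by linarith) 2
  calc _ ≤ ((2 * n + 1) ^ 2 : ℝ) * (ℓ ^ 2 * P.card * P.card) := by linarith
    _ ≤ (3 * n) ^ 2 * (ℓ ^ 2 * P.card * P.card) :=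
        mul_le_mul_of_nonneg_right h4 (by positivity)
    _ = 9 * n ^ 2 * ℓ ^ 2 * P.card ^ 2 := by ring

/-- The total influence of the spins outside a box of blocks on a function of the spins near to
the origin. -/
theorem InfluenceBound.abs_gibbsExp_sub_le_box {P : Finset Site} {β : ℝ} {ℓ : ℕ} {A : ℝ}
    (hH : InfluenceBound P β ℓ A) (hβ : 0 < β) (hℓ : 1 ≤ ℓ) (hA : 4 ≤ A) {f : Config → ℝ} {c : ℝ}
    (hc : ∀ σ, |f σ| ≤ c) {J : Finset Site} (hf : DependsOn f (blockUnion ℓ J : Set Site))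
    {m n : ℕ} (hm : J ⊆ centredBox m) (hn : 1 ≤ n) (hmn : m ≤ n) (σ τ : Config) :
    |gibbsExp P β (blockUnion ℓ (centredBox n)) σ f -
        gibbsExp P β (blockUnion ℓ (centredBox n)) τ f| ≤
      (9 * n ^ 2 * ℓ ^ 2 * P.card ^ 2) * (c * (A * ℓ ^ 2 * Real.exp (2 * (β * P.card))) *
        (J.card * (Real.exp m * Real.exp (-n)))) := by
  have hℓ0 : (1 : ℝ) ≤ ℓ := by exact_mod_cast hℓ
  have hc0 : 0 ≤ c := (abs_nonneg _).trans (hc τ)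
  set D := c * (A * ℓ ^ 2 * Real.exp (2 * (β * P.card))) with hD
  have hD0 : 0 ≤ D := by positivity
  set Λ := blockUnion ℓ (centredBox n) with hΛ
  have hJn : J ⊆ centredBox n := hm.trans (centredBox_mono hmn)
  have hVΛ : blockUnion ℓ J ⊆ Λ := blockUnion_mono hJn
  set B := (basePoints P Λ).biUnion (plaquette P) with hB
  have e : gibbsExp P β Λ τ f = gibbsExp P β Λ (glue (Λ ∪ B) σ fun x => τ x) f := by
    refine gibbsExp_congr_of_range hf fun x hx h => ?_
    have hxB : x ∈ Λ ∪ B := by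
      rcases h with h | ⟨z, hz, hxz⟩
      · exact absurd (hVΛ h) hx
      · exact Finset.mem_union_right _ (Finset.mem_biUnion.2 ⟨z, hz, hxz⟩)
    rw [glue_of_mem hxB]
  rw [e]
  refine (abs_gibbsExp_sub_le_sum (Λ := Λ ∪ B)
    (c := fun _ => D * ∑ j ∈ J, Real.exp (-((ℓ : ℝ) * (n - m)) / ℓ)) (fun y hy σ => ?_)
    fun x hx => (glue_of_notMem hx _ _).symm).trans ?_
  · have hyΛ := (Finset.mem_sdiff.1 hy).2
    refine hH.abs_gibbsExp_flip_sub_le hβ hℓ hA hf (fun h => hyΛ (hVΛ h)) hc J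
      (centredBox n) hJn hyΛ (fun x hx _ => hx) (fun j hj x hx => ?_) σ
    have := le_l1Dist_of_notMem hℓ (mem_blockUnion.2 ⟨j, hm hj, hx⟩) hyΛ
    exact_mod_cast this
  · have he : -((ℓ : ℝ) * (n - m)) / ℓ = m + -n := by field_simp; ring
    rw [Finset.sum_const, Finset.sum_const, nsmul_eq_mul, nsmul_eq_mul, he, Real.exp_add]
    have h0 : (Λ ∪ B) \ Λ ⊆ B := by
      rw [Finset.union_sdiff_left]; exact Finset.sdiff_subset
    have h1 : (((Λ ∪ B) \ Λ).card : ℝ) ≤ B.card := Nat.cast_le.2 (Finset.card_le_card h0)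
    have h2 : (B.card : ℝ) ≤ 9 * n ^ 2 * ℓ ^ 2 * P.card ^ 2 := card_plaquettes_centredBox_le P ℓ hn
    have h3 : 0 ≤ D * (J.card * (Real.exp m * Real.exp (-n))) :=
      mul_nonneg hD0 (mul_nonneg (Nat.cast_nonneg _) (mul_pos (Real.exp_pos _) (Real.exp_pos _)).le)
    exact mul_le_mul_of_nonneg_right (h1.trans h2) h3

theorem InfluenceBound.boundaryInsensitive {P : Finset Site} {β : ℝ} {ℓ : ℕ} {A : ℝ}
    (hH : InfluenceBound P β ℓ A) (hβ : 0 < β) (hℓ : 1 ≤ ℓ) (hA : 4 ≤ A) :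
    BoundaryInsensitive P β := by
  intro f hf ε hε
  obtain ⟨V, hV⟩ := id hf
  obtain ⟨m, hm⟩ := exists_subset_centredBox (V.image (blockIndex ℓ))
  set J := V.image (blockIndex ℓ) with hJ
  have hVJ : DependsOn f (blockUnion ℓ J : Set Site) := fun σ τ h => hV fun x hx => h x
    (mem_blockUnion.2 ⟨_, Finset.mem_image_of_mem _ hx, mem_block_blockIndex hℓ x⟩)
  set D := supNorm f * (A * ℓ ^ 2 * Real.exp (2 * (β * P.card))) with hD
  have hlim : Tendsto (fun n : ℕ => ((9 : ℝ) * (ℓ ^ 2 * P.card ^ 2) * (D * (J.card * Real.exp m))) *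
      ((n : ℝ) ^ 2 * Real.exp (-n))) atTop (𝓝 0) := by
    have := (((Real.tendsto_pow_mul_exp_neg_atTop_nhds_zero 2).comp
      tendsto_natCast_atTop_atTop).const_mul
        ((9 : ℝ) * (ℓ ^ 2 * P.card ^ 2) * (D * (J.card * Real.exp m))))
    rwa [mul_zero] at this
  obtain ⟨n, hn1, hnm, hnε⟩ := ((eventually_ge_atTop 1).and ((eventually_ge_atTop m).and
    (hlim.eventually_le_const hε))).exists
  refine ⟨_, fun σ τ => (hH.abs_gibbsExp_sub_le_box hβ hℓ hA (abs_le_supNorm hf) hVJ hm hn1 hnm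
    σ τ).trans (le_trans (le_of_eq ?_) hnε)⟩
  ring

/-! ### Local functions and Gibbs measures -/

section

variable {P : Finset Site} {β : ℝ} {Λ : Finset Site} {f g : Config → ℝ}

theorem IsLocal.continuous (hf : IsLocal f) : Continuous f := by
  obtain ⟨V, hV⟩ := hf
  have h : f = (fun η : V → ℤˣ => f (glue V 1 η)) ∘ fun σ x => σ x := by
    funext σ
    exact hV fun x hx => by rw [glue_of_mem (Finset.mem_coe.1 hx)]
  rw [h]
  exact continuous_of_discreteTopology.comp (by fun_prop)

theorem IsLocal.integrable (hf : IsLocal f) (μ : Measure Config) [IsFiniteMeasure μ] :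
    Integrable f μ :=
  Integrable.of_bound hf.continuous.aestronglyMeasurable (supNorm f)
    (ae_of_all _ fun σ => abs_le_supNorm hf σ)

theorem IsLocal.mul (hf : IsLocal f) (hg : IsLocal g) : IsLocal fun σ => f σ * g σ := by
  obtain ⟨V, hV⟩ := hf
  obtain ⟨W, hW⟩ := hg
  refine ⟨V ∪ W, fun σ τ h => ?_⟩
  simp only
  rw [hV fun x hx => h x (by simp at hx ⊢; exact Or.inl hx),
    hW fun x hx => h x (by simp at hx ⊢; exact Or.inr hx)]

theorem isLocal_gibbsExp (hf : IsLocal f) : IsLocal fun τ => gibbsExp P β Λ τ f := by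
  obtain ⟨V, hV⟩ := hf
  refine ⟨V ∪ (basePoints P Λ).biUnion (plaquette P), fun σ τ h => ?_⟩
  refine gibbsExp_congr_of_range hV fun x _ hx => h x ?_
  rw [Finset.mem_coe, Finset.mem_union, Finset.mem_biUnion]
  exact hx

theorem isLocal_gibbsProb (η : Λ → ℤˣ) : IsLocal fun τ => gibbsProb P β Λ τ η := by
  have h : ∀ τ, gibbsProb P β Λ τ η = gibbsExp P β Λ τ
      fun σ => if ∀ x : Λ, σ x = η x then 1 else 0 := by
    intro τ
    unfold gibbsExp
    rw [Finset.sum_eq_single η]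
    · simp only
      rw [if_pos fun x : Λ => glue_of_mem x.2 τ η, mul_one]
    · intro ξ _ hξ
      simp only
      rw [if_neg, mul_zero]
      exact fun h => hξ (funext fun x => by rw [← h x, glue_of_mem x.2])
    · simp
  simp only [h]
  refine isLocal_gibbsExp ⟨Λ, fun σ τ h => ?_⟩
  have : ∀ x : Λ, σ x = τ x := fun x => h x x.2
  simp only [this]

theorem measurable_glue (η : Λ → ℤˣ) : Measurable fun τ => glue Λ τ η := by
  refine measurable_pi_lambda _ fun x => ?_
  by_cases hx : x ∈ Λ
  · simp only [glue_of_mem hx]; exact measurable_const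
  · simp only [glue_of_notMem hx]; exact measurable_pi_apply x

theorem gibbsMeasure_apply {A : Set Config} (hA : MeasurableSet A) (τ : Config) :
    gibbsMeasure P β Λ τ A =
      ∑ η : Λ → ℤˣ, ENNReal.ofReal (gibbsProb P β Λ τ η) * A.indicator 1 (glue Λ τ η) := by
  simp [gibbsMeasure, Measure.dirac_apply' _ hA]

theorem gibbsMeasure_eq_ofReal {A : Set Config} (hA : MeasurableSet A) (τ : Config) :
    gibbsMeasure P β Λ τ A = ENNReal.ofReal (gibbsExp P β Λ τ (A.indicator 1)) := by
  rw [gibbsMeasure_apply hA]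
  unfold gibbsExp
  have h0 : ∀ η ∈ (Finset.univ : Finset (Λ → ℤˣ)),
      0 ≤ gibbsProb P β Λ τ η * A.indicator (1 : Config → ℝ) (glue Λ τ η) := fun η _ =>
    mul_nonneg (gibbsProb_nonneg η) (Set.indicator_nonneg (fun _ _ => zero_le_one) _)
  rw [ENNReal.ofReal_sum_of_nonneg h0]
  refine Finset.sum_congr rfl fun η _ => ?_
  rw [ENNReal.ofReal_mul (gibbsProb_nonneg η)]
  by_cases h : glue Λ τ η ∈ A <;> simp [h]

theorem measurable_gibbsMeasure (P : Finset Site) (β : ℝ) (Λ : Finset Site) :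
    Measurable (gibbsMeasure P β Λ) := by
  refine Measure.measurable_of_measurable_coe _ fun A hA => ?_
  simp only [gibbsMeasure_apply hA]
  refine Finset.measurable_sum _ fun η _ => ?_
  exact (isLocal_gibbsProb η).continuous.measurable.ennreal_ofReal.mul
    ((measurable_one.indicator hA).comp (measurable_glue η))

instance isProbabilityMeasure_gibbsMeasure (τ : Config) :
    IsProbabilityMeasure (gibbsMeasure P β Λ τ) := by
  constructor
  rw [gibbsMeasure_eq_ofReal MeasurableSet.univ, Set.indicator_univ]
  have := gibbsExp_const (P := P) (β := β) (Λ := Λ) (τ := τ) 1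
  change gibbsExp P β Λ τ 1 = 1 at this
  rw [this, ENNReal.ofReal_one]

theorem integral_gibbsMeasure (hf : IsLocal f) (τ : Config) :
    ∫ σ, f σ ∂gibbsMeasure P β Λ τ = gibbsExp P β Λ τ f := by
  unfold gibbsMeasure gibbsExp
  rw [integral_finsetSum_measure]
  · refine Finset.sum_congr rfl fun η _ => ?_
    rw [integral_smul_measure, integral_dirac, ENNReal.toReal_ofReal (gibbsProb_nonneg η),
      smul_eq_mul]
  · intro η _
    exact (hf.integrable _).smul_measure ENNReal.ofReal_ne_top

theorem isLocal_indicator_cylinder (s : Finset Site) (S : Set (s → ℤˣ)) :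
    IsLocal ((cylinder s S).indicator (1 : Config → ℝ)) := by
  refine ⟨s, fun σ τ h => ?_⟩
  have hr : s.restrict σ = s.restrict τ := funext fun x => h x x.2
  have : σ ∈ cylinder s S ↔ τ ∈ cylinder s S := by
    rw [mem_cylinder, mem_cylinder, hr]
  by_cases hτ : τ ∈ cylinder s S
  · simp [hτ, this.2 hτ]
  · simp [hτ, mt this.1 hτ]

theorem ext_of_cylinder {μ ν : Measure Config} [IsProbabilityMeasure μ] [IsProbabilityMeasure ν]
    (h : ∀ (s : Finset Site) (S : Set (s → ℤˣ)), MeasurableSet S →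
      μ (cylinder s S) = ν (cylinder s S)) : μ = ν := by
  refine ext_of_generate_finite _ generateFrom_measurableCylinders.symm
    isPiSystem_measurableCylinders (fun A hA => ?_) (by simp)
  obtain ⟨s, S, hS, rfl⟩ := (mem_measurableCylinders A).1 hA
  exact h s S hS

/-! ### The infinite-volume Gibbs measure -/

theorem BoundaryInsensitive.exists_abs_sub_le (h : BoundaryInsensitive P β) (hf : IsLocal f)
    {ε : ℝ} (hε : 0 < ε) : ∃ (Λ₀ : Finset Site) (a : ℝ), ∀ Λ, Λ₀ ≤ Λ → ∀ τ,
      |gibbsExp P β Λ τ f - a| ≤ ε := by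
  obtain ⟨Λ₀, hΛ₀⟩ := h f hf ε hε
  refine ⟨Λ₀, gibbsExp P β Λ₀ 1 f, fun Λ hΛ τ => ?_⟩
  rw [← gibbsExp_gibbsExp hΛ]
  exact abs_gibbsExp_sub_le fun σ _ => hΛ₀ σ 1

/-- The limit is found by compactness; insensitivity to the boundary condition makes it a limit
in the strong sense. -/
theorem BoundaryInsensitive.exists_tendsto (h : BoundaryInsensitive P β) :
    ∃ μ : Measure Config, IsProbabilityMeasure μ ∧ ∀ (τ : Config) (f : Config → ℝ), IsLocal f →
      Tendsto (fun Λ : Finset Site => gibbsExp P β Λ τ f) atTop (𝓝 (∫ σ, f σ ∂μ)) := by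
  set U : Ultrafilter (Finset Site) := Ultrafilter.of atTop with hU
  set μs : Finset Site → ProbabilityMeasure Config := fun Λ => ⟨gibbsMeasure P β Λ 1, inferInstance⟩
    with hμs
  set μ : ProbabilityMeasure Config := (U.map μs).lim with hμ
  have hlim : Tendsto μs U (𝓝 μ) := (U.map μs).le_nhds_lim
  refine ⟨μ, inferInstance, fun τ f hf => ?_⟩
  have hU1 : Tendsto (fun Λ : Finset Site => gibbsExp P β Λ 1 f) U (𝓝 (∫ σ, f σ ∂μ)) := by
    have := ProbabilityMeasure.tendsto_iff_forall_integral_tendsto.1 hlim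
      (BoundedContinuousFunction.mkOfCompact ⟨f, hf.continuous⟩)
    simpa [hμs, integral_gibbsMeasure hf] using this
  rw [Metric.tendsto_atTop]
  intro ε hε
  obtain ⟨Λ₀, a, hΛ₀⟩ := h.exists_abs_sub_le hf (by positivity : 0 < ε / 3)
  have ha : |(∫ σ, f σ ∂μ) - a| ≤ ε / 3 := by
    refine le_of_tendsto (hU1.sub_const a).abs ?_
    exact (Ultrafilter.of_le atTop) ((eventually_ge_atTop Λ₀).mono fun Λ hΛ => hΛ₀ Λ hΛ 1)
  refine ⟨Λ₀, fun Λ hΛ => ?_⟩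
  have h1 := hΛ₀ Λ hΛ τ
  rw [Real.dist_eq]
  rw [abs_sub_comm] at ha
  have := abs_sub_le (gibbsExp P β Λ τ f) a (∫ σ, f σ ∂μ)
  linarith

/-- The DLR equation of a cylinder event, as an equation between integrals of local functions. -/
theorem lintegral_gibbsMeasure_cylinder (μ : Measure Config) [IsFiniteMeasure μ] (s : Finset Site)
    (S : Set (s → ℤˣ)) (hS : MeasurableSet S) :
    ∫⁻ τ, gibbsMeasure P β Λ τ (cylinder s S) ∂μ =
      ENNReal.ofReal (∫ τ, gibbsExp P β Λ τ ((cylinder s S).indicator 1) ∂μ) := by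
  rw [ofReal_integral_eq_lintegral_ofReal
    ((isLocal_gibbsExp (isLocal_indicator_cylinder s S)).integrable μ)]
  · exact lintegral_congr fun τ => gibbsMeasure_eq_ofReal hS.cylinder τ
  · refine ae_of_all _ fun τ => ?_
    have : gibbsExp P β Λ τ (fun _ => 0) ≤ gibbsExp P β Λ τ ((cylinder s S).indicator 1) :=
      gibbsExp_mono fun σ _ => Set.indicator_nonneg (fun _ _ => zero_le_one) _
    rwa [gibbsExp_const] at this

theorem measure_cylinder_eq (μ : Measure Config) [IsFiniteMeasure μ] (s : Finset Site)
    (S : Set (s → ℤˣ)) (hS : MeasurableSet S) :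
    μ (cylinder s S) = ENNReal.ofReal (∫ σ, (cylinder s S).indicator 1 σ ∂μ) := by
  rw [integral_indicator_one hS.cylinder, ofReal_measureReal]

theorem isGibbs_of_tendsto {μ : Measure Config} [IsProbabilityMeasure μ]
    (h : ∀ (τ : Config) (f : Config → ℝ), IsLocal f →
      Tendsto (fun Λ : Finset Site => gibbsExp P β Λ τ f) atTop (𝓝 (∫ σ, f σ ∂μ))) :
    IsGibbs P β μ := by
  refine ⟨inferInstance, fun Λ A hA => ?_⟩
  have hm := measurable_gibbsMeasure P β Λ
  have hbind : ∀ A, MeasurableSet A →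
      μ.bind (gibbsMeasure P β Λ) A = ∫⁻ τ, gibbsMeasure P β Λ τ A ∂μ := fun A hA =>
    Measure.bind_apply hA hm.aemeasurable
  have : IsProbabilityMeasure (μ.bind (gibbsMeasure P β Λ)) := ⟨by
    rw [hbind _ MeasurableSet.univ]
    simp⟩
  rw [← hbind A hA]
  congr 1
  refine ext_of_cylinder fun s S hS => ?_
  rw [hbind _ hS.cylinder, lintegral_gibbsMeasure_cylinder μ s S hS, measure_cylinder_eq μ s S hS]
  congr 1
  have hloc := isLocal_indicator_cylinder s S
  refine tendsto_nhds_unique ?_ (h 1 _ (isLocal_gibbsExp hloc))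
  refine (h 1 _ hloc).congr' ?_
  filter_upwards [eventually_ge_atTop Λ] with Λ' hΛ'
  exact (gibbsExp_gibbsExp hΛ' 1 _).symm

theorem BoundaryInsensitive.eq_of_isGibbs (h : BoundaryInsensitive P β) {μ ν : Measure Config}
    (hμ : IsGibbs P β μ) (hν : IsGibbs P β ν) : ν = μ := by
  have := hμ.1
  have := hν.1
  refine ext_of_cylinder fun s S hS => ?_
  rw [measure_cylinder_eq μ s S hS, measure_cylinder_eq ν s S hS]
  congr 1
  have hloc := isLocal_indicator_cylinder s S
  -- the DLR equation in a large volume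
  have key : ∀ (ρ : Measure Config), IsGibbs P β ρ → ∀ (Λ : Finset Site) (a ε : ℝ),
      (∀ τ, |gibbsExp P β Λ τ ((cylinder s S).indicator 1) - a| ≤ ε) →
        |(∫ σ, (cylinder s S).indicator 1 σ ∂ρ) - a| ≤ ε := by
    intro ρ hρ Λ a ε ha
    have := hρ.1
    have e : ∫ σ, (cylinder s S).indicator (1 : Config → ℝ) σ ∂ρ =
        ∫ τ, gibbsExp P β Λ τ ((cylinder s S).indicator 1) ∂ρ := by
      have h1 := hρ.2 Λ _ hS.cylinder
      rw [lintegral_gibbsMeasure_cylinder ρ s S hS, measure_cylinder_eq ρ s S hS,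
        ENNReal.ofReal_eq_ofReal_iff] at h1
      · exact h1
      · exact integral_nonneg fun σ => Set.indicator_nonneg (fun _ _ => zero_le_one) _
      · refine integral_nonneg fun τ => ?_
        have : gibbsExp P β Λ τ (fun _ => 0) ≤ gibbsExp P β Λ τ ((cylinder s S).indicator 1) :=
          gibbsExp_mono fun σ _ => Set.indicator_nonneg (fun _ _ => zero_le_one) _
        rwa [gibbsExp_const] at this
    have hint := (isLocal_gibbsExp (P := P) (β := β) (Λ := Λ) hloc).integrable ρ
    have h2 := norm_integral_le_of_norm_le_const (μ := ρ)
      (f := fun τ => gibbsExp P β Λ τ ((cylinder s S).indicator 1) - a) (ae_of_all _ ha)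
    rw [integral_sub hint (integrable_const a)] at h2
    simpa [e] using h2
  refine eq_of_forall_dist_le fun ε hε => ?_
  obtain ⟨Λ, a, hΛ⟩ := h.exists_abs_sub_le hloc (half_pos hε)
  have h1 := key μ hμ Λ a _ (hΛ Λ le_rfl)
  have h2 := key ν hν Λ a _ (hΛ Λ le_rfl)
  rw [Real.dist_eq]
  have h3 := abs_sub_le (∫ σ, (cylinder s S).indicator (1 : Config → ℝ) σ ∂ν) a
    (∫ σ, (cylinder s S).indicator 1 σ ∂μ)
  rw [abs_sub_comm a] at h3
  linarith

theorem expDecay_of_strongMixing {μ : Measure Config} {ℓ : ℕ} {C m : ℝ} (hℓ : 1 ≤ ℓ) (hC : 0 < C)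
    (hm : 0 < m) (hSM : StrongMixing P β ℓ C m)
    (h : ∀ (τ : Config) (f : Config → ℝ), IsLocal f →
      Tendsto (fun Λ : Finset Site => gibbsExp P β Λ τ f) atTop (𝓝 (∫ σ, f σ ∂μ))) :
    ExpDecay μ := by
  refine ⟨C, hC, m, hm, fun f g hf hg => ?_⟩
  have hlim := ((h 1 _ (hf.mul hg)).sub ((h 1 f hf).mul (h 1 g hg))).abs
  obtain ⟨V, hV⟩ := id hf
  obtain ⟨W, hW⟩ := id hg
  refine le_of_tendsto_of_frequently hlim (frequently_atTop.2 fun Λ => ?_)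
  obtain ⟨n, hn⟩ := exists_subset_blockUnion hℓ (Λ ∪ V ∪ W)
  refine ⟨_, fun x hx => hn (by simp [hx]), ?_⟩
  exact hSM _ ⟨_, rfl⟩ 1 f g (fun σ τ hστ => hV fun x hx => hστ x (hn (by
      rw [Finset.mem_coe] at hx; simp [hx])))
    fun σ τ hστ => hW fun x hx => hστ x (hn (by rw [Finset.mem_coe] at hx; simp [hx]))

/-! ### The magnetisation -/

theorem spinProd_mul (k σ : Config) (V : Finset Site) :
    spinProd (k * σ) V = spinProd k V * spinProd σ V := by
  unfold spinProd
  rw [← Finset.prod_mul_distrib]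
  simp

theorem spinProd_plaquette (k : Config) (P : Finset Site) (z : Site) :
    spinProd k (plaquette P z) = ∏ b ∈ P, (((k (b + z) : ℤˣ) : ℤ) : ℝ) :=
  Finset.prod_image fun _ _ _ _ h => add_right_cancel h

/-- A spin transformation which leaves all plaquettes unchanged is a symmetry of the model. -/
theorem gibbsExp_symm {k : Config} (hk : ∀ z, spinProd k (plaquette P z) = 1) (τ : Config) :
    gibbsExp P β Λ (k * τ) f = gibbsExp P β Λ τ fun σ => f (k * σ) := by
  have hb : ∀ σ, boltzmann P β Λ (k * σ) = boltzmann P β Λ σ := fun σ => by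
    unfold boltzmann
    simp only [spinProd_mul, hk, one_mul]
  rw [gibbsExp_eq_div, gibbsExp_eq_div, partitionFn_eq_cfgSum, partitionFn_eq_cfgSum, cfgSum_mul,
    cfgSum_mul]
  simp only [hb]

/-- The symmetry flips the spins of a column in the square model, and the spins on two of the three
diagonal sublattices in the triangular model. -/
theorem exists_symmetry (hP : P = squarePlaquette ∨ P = trianglePlaquette) (x : Site) :
    ∃ k : Config, k x = -1 ∧ ∀ z, spinProd k (plaquette P z) = 1 := by
  rcases hP with rfl | rfl
  · refine ⟨fun y => if y.1 = x.1 then -1 else 1, by simp, fun z => ?_⟩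
    rw [spinProd_plaquette, squarePlaquette, Finset.prod_insert (by decide),
      Finset.prod_insert (by decide), Finset.prod_insert (by decide), Finset.prod_singleton]
    by_cases h1 : z.1 = x.1 <;> by_cases h2 : 1 + z.1 = x.1 <;> simp [h1, h2]
  · refine ⟨fun y => if (y.1 + y.2 - x.1 - x.2) % 3 = 1 then 1 else -1, by simp, fun z => ?_⟩
    rw [spinProd_plaquette, trianglePlaquette, Finset.prod_insert (by decide),
      Finset.prod_insert (by decide), Finset.prod_singleton]
    have h0 : (z.1 + z.2 - x.1 - x.2) % 3 = 0 ∨ (z.1 + z.2 - x.1 - x.2) % 3 = 1 ∨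
        (z.1 + z.2 - x.1 - x.2) % 3 = 2 := by omega
    simp only [Prod.fst_add, Prod.snd_add, zero_add]
    rcases h0 with h | h | h
    · rw [if_neg (by omega), if_pos (by omega), if_neg (by omega)]; simp
    · rw [if_pos (by omega), if_neg (by omega), if_neg (by omega)]; simp
    · rw [if_neg (by omega), if_neg (by omega), if_pos (by omega)]; simp

theorem isLocal_spin (x : Site) : IsLocal fun σ : Config => (((σ x : ℤˣ) : ℤ) : ℝ) :=
  ⟨{x}, fun σ τ h => by simp only; rw [h x (by simp)]⟩

theorem integral_spin_eq_zero (hP : P = squarePlaquette ∨ P = trianglePlaquette)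
    {μ : Measure Config} (h : ∀ (τ : Config) (f : Config → ℝ), IsLocal f →
      Tendsto (fun Λ : Finset Site => gibbsExp P β Λ τ f) atTop (𝓝 (∫ σ, f σ ∂μ))) (x : Site) :
    ∫ σ, (((σ x : ℤˣ) : ℤ) : ℝ) ∂μ = 0 := by
  obtain ⟨k, hkx, hk⟩ := exists_symmetry hP x
  have h1 := h (k * 1) _ (isLocal_spin x)
  have h2 := (h 1 _ (isLocal_spin x)).neg
  have e : ∀ Λ, gibbsExp P β Λ (k * 1) (fun σ => (((σ x : ℤˣ) : ℤ) : ℝ)) =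
      -gibbsExp P β Λ 1 fun σ => (((σ x : ℤˣ) : ℤ) : ℝ) := by
    intro Λ
    rw [gibbsExp_symm hk, ← neg_one_mul, ← gibbsExp_const_mul]
    refine gibbsExp_congr fun σ _ => ?_
    simp [hkx]
  simp only [e] at h1
  have := tendsto_nhds_unique h1 h2
  linarith

end

end PlaquetteModel

theorem theorem1 (P : Finset Site) (hP : P = squarePlaquette ∨ P = trianglePlaquette) :
    -- the strong mixing scale is finite at every positive temperature and is `O(β e^β)`
    (∀ ε : ℝ, 0 < ε →
      (∀ β : ℝ, 0 < β → ∃ ℓ : ℕ, 1 ≤ ℓ ∧ FiniteVolumeCondition P ε β ℓ) ∧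
      (fun β : ℝ => (mixScale P ε β : ℝ)) =O[atTop] (fun β : ℝ => β * Real.exp β)) ∧
    -- strong mixing on regular volumes at every positive temperature, on the scale `O(β e^β)`
    (∃ c₀ : ℝ, 0 < c₀ ∧ ∃ L : ℝ → ℕ,
      (∀ β : ℝ, 0 < β → 1 ≤ L β ∧
        StrongMixing P β (L β) (Real.exp (c₀ * (β + 1))) (1 / (L β : ℝ))) ∧
      (fun β : ℝ => (L β : ℝ)) =O[atTop] (fun β : ℝ => β * Real.exp β)) ∧
    -- the infinite-volume Gibbs measure
    (∀ β : ℝ, 0 < β → ∃ μ : Measure Config,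
      IsGibbs P β μ ∧ (∀ ν : Measure Config, IsGibbs P β ν → ν = μ) ∧
      (∀ (τ : Config) (f : Config → ℝ), IsLocal f →
        Tendsto (fun Λ : Finset Site => gibbsExp P β Λ τ f) atTop (𝓝 (∫ σ, f σ ∂μ))) ∧
      ExpDecay μ ∧
      ∀ x : Site, ∫ σ, (((σ x : ℤˣ) : ℤ) : ℝ) ∂μ = 0) := by
  obtain ⟨c₀, hc₀, L, hL, hLO⟩ := exists_strongMixing hP
  refine ⟨fun ε hε => ?_, ⟨c₀, hc₀, L, hL, hLO⟩, fun β hβ => ?_⟩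
  · obtain ⟨K, hK, h⟩ := exists_finiteVolumeCondition hP hε
    refine ⟨fun β hβ => ⟨scale K β, ?_, h β hβ⟩, mixScale_isBigO hK h⟩
    have := sixteen_le_scale hK hβ
    omega
  · obtain ⟨K, hK, h⟩ := exists_influenceBound hP
    have h16 := sixteen_le_scale hK hβ
    have hbi := (h β hβ).boundaryInsensitive hβ (by omega) influenceConst_ge
    obtain ⟨μ, hμ, hlim⟩ := hbi.exists_tendsto
    have hG := isGibbs_of_tendsto hlim
    obtain ⟨hL1, hSM⟩ := hL β hβ
    have hL0 : (0 : ℝ) < L β := by exact_mod_cast hL1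
    exact ⟨μ, hG, fun ν hν => hbi.eq_of_isGibbs hG hν, hlim,
      expDecay_of_strongMixing hL1 (Real.exp_pos _) (by positivity) hSM hlim,
      integral_spin_eq_zero hP hlim⟩
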